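/- Let $0<\alpha<1$, $\lambda\ge 1$, $\tau>0$. Let $g_\lambda(t)=t^{2\alpha-1}(1+t^2\lambda)^{-1}$ for $t>0$, and consider the double-exponential change of variable $t=t(x)>0$ given by $\tau t^2=\exp(\pi\sinh x)$, $x\in\mathbb{R}$, which leads to the transformed integrand $$g_{\lambda,\psi_{DE}}(x)=g_\lambda(t(x))\,t'(x)=\frac{\pi}{2}\,\tau^{1-\alpha}\,\frac{\exp(\alpha\pi\sinh x)}{\tau+\lambda\exp(\pi\sinh x)}\cosh x .$$ Let $h>0$, let $M,N$ be positive integers, and let $d>0$ be strictly smaller than the distance from the real axis to the nearest pole of $g_{\lambda,\psi_{DE}}$, that is, $d<|\operatorname{Im} z|$ for every $z\in\mathbb{C}$ with $\tau+\lambda\exp(\pi\sinh z)=0$. Then $g_{\lambda,\psi_{DE}}$ is integrable on $\mathbb{R}$, and $$\left|\int_{-\infty}^{+\infty} g_{\lambda,\psi_{DE}}(x)\,dx-h\sum_{\ell=-M}^{N}g_{\lambda,\psi_{DE}}(\ell h)\right|\le \frac{1}{\alpha(1-\alpha)}\,\xi(d)\,\lambda^{-\alpha}\,\frac{e^{-\pi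 d/h}}{2\sinh(\pi d/h)}$$ $$\qquad+\frac{\tau^{-\alpha}}{2\alpha}\exp\left(\frac{\alpha\pi}{2}\right)\exp\left(-\frac{\alpha\pi}{2}e^{Mh}\right)+\frac{\lambda^{-1}\tau^{1-\alpha}}{2(1-\alpha)}\exp\left(\frac{(1-\alpha)\pi}{2}\right)\exp\left(-\frac{(1-\alpha)\pi}{2}e^{Nh}\right),$$ where $\xi(d)=\dfrac{2}{\cos d\,\cos\left(\frac{\pi}{2}\sin d\right)}$. -/

import Mathlib

namespace DEQuadrature

noncomputable section

/-- The truncated trapezoidal rule `T_{M,N,h}(f) = h ∑_{ℓ = -M}^{N} f(ℓ h)`. -/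
def truncTrapezoid (M N : ℕ) (h : ℝ) (f : ℝ → ℝ) : ℝ :=
  h * ∑ l ∈ Finset.Icc (-(M : ℤ)) (N : ℤ), f ((l : ℝ) * h)

/-- The quadrature error `|∫_ℝ f(x) dx - T_{M,N,h}(f)|`. -/
def quadError (M N : ℕ) (h : ℝ) (f : ℝ → ℝ) : ℝ :=
  |(∫ x : ℝ, f x) - truncTrapezoid M N h f|

/-- The integrand `g_λ(t) = t^{2α-1} (1 + t² λ)⁻¹`, for `t > 0`. -/
def integrand (α lam t : ℝ) : ℝ :=
  t ^ (2 * α - 1) * (1 + t ^ 2 * lam)⁻¹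

/-- The change of variable `t = t(x) > 0` given by `τ t² = (exp ((π/2) sinh x))² = exp (π sinh x)`. -/
def deMap (τ x : ℝ) : ℝ :=
  Real.exp (Real.pi / 2 * Real.sinh x) / Real.sqrt τ

/-- The transformed integrand `g_{λ,ψ}(x) = g_λ(ψ(x)) ψ'(x)` for the change of variable `deMap`. -/
def deIntegrand (α lam τ x : ℝ) : ℝ :=
  integrand α lam (deMap τ x) * deriv (deMap τ) x

/-- `ξ(d) = 2 / (cos d · cos ((π/2) sin d))`. -/
def xi (d : ℝ) : ℝ :=
  2 / (Real.cos d * Real.cos (Real.pi / 2 * Real.sin d))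

/-- The equation defining the change of variable. -/
theorem deMap_sq {τ : ℝ} (hτ : 0 < τ) (x : ℝ) :
    τ * deMap τ x ^ 2 = Real.exp (Real.pi * Real.sinh x) := by
  have h : Real.exp (Real.pi / 2 * Real.sinh x) ^ 2 = Real.exp (Real.pi * Real.sinh x) := by
    rw [← Real.exp_nat_mul]
    congr 1
    push_cast
    ring
  rw [deMap, div_pow, Real.sq_sqrt hτ.le, h]
  field_simp

theorem hasDerivAt_deMap (τ x : ℝ) :
    HasDerivAt (deMap τ) (Real.pi / 2 * Real.cosh x * deMap τ x) x := by
  have h := (((Real.hasDerivAt_sinh x).const_mul (Real.pi / 2)).exp).div_const (Real.sqrt τ)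
  refine h.congr_deriv ?_
  rw [deMap]
  ring

/-- The explicit form of the transformed integrand. -/
theorem deIntegrand_eq {τ : ℝ} (hτ : 0 < τ) (α lam x : ℝ) :
    deIntegrand α lam τ x =
      Real.pi / 2 * τ ^ (1 - α) * Real.exp (α * Real.pi * Real.sinh x) /
        (τ + lam * Real.exp (Real.pi * Real.sinh x)) * Real.cosh x := by
  have hpos : 0 < deMap τ x := div_pos (Real.exp_pos _) (Real.sqrt_pos.2 hτ)
  have hsq := deMap_sq hτ x
  have hden : 1 + deMap τ x ^ 2 * lam =
      (τ + lam * Real.exp (Real.pi * Real.sinh x)) / τ := by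
    rw [← hsq]
    field_simp
  have hpow : deMap τ x ^ (2 * α - 1) * deMap τ x =
      τ ^ (-α) * Real.exp (α * Real.pi * Real.sinh x) := by
    have h1 : deMap τ x ^ (2 * α - 1) * deMap τ x = deMap τ x ^ (2 * α) := by
      rw [← Real.rpow_add_one hpos.ne']
      congr 1
      ring
    have h2 : deMap τ x ^ 2 = Real.exp (Real.pi * Real.sinh x) / τ := by
      rw [← hsq]
      field_simp
    rw [h1, Real.rpow_mul hpos.le, Real.rpow_two, h2,
      Real.div_rpow (Real.exp_pos _).le hτ.le, ← Real.exp_mul, Real.rpow_neg hτ.le,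
      div_eq_mul_inv, mul_comm]
    congr 2
    ring
  have hτp : τ ^ (1 - α) = τ ^ (-α) * τ := by
    rw [← Real.rpow_add_one hτ.ne']
    congr 1
    ring
  rw [deIntegrand, integrand, (hasDerivAt_deMap τ x).deriv, hden, hτp, inv_div]
  calc deMap τ x ^ (2 * α - 1) * (τ / (τ + lam * Real.exp (Real.pi * Real.sinh x))) *
        (Real.pi / 2 * Real.cosh x * deMap τ x)
      = (deMap τ x ^ (2 * α - 1) * deMap τ x) *
        (τ / (τ + lam * Real.exp (Real.pi * Real.sinh x))) * (Real.pi / 2 * Real.cosh x) := by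
        ring
    _ = _ := by rw [hpow]; ring

end

end DEQuadrature

/-! Put c = log(τ/λ)/π. The integrand is λ^(-α) times `nInt α c`, and the substitution v = π(sinh x
- c) turns the latter into half the density `logi α`. Its poles are the solutions of sinh z = c +
(2n+1)i. By Poisson summation the error of the untruncated trapezoidal rule is a sum of the Fourier
integrals `oscInt α c L` over L = ±2πk/h, k ≥ 1. The core of the proof is `norm_oscInt_le_kap`: with
t = tan d, the modulus of such an integral is at most e^(-Ld) / (α(1-α) cos³ d). The geometric
series in k then gives 1/(e^(2πd/h) - 1), which is the hyperbolic factor of the theorem, and 2/cos³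
d ≤ ξ(d) because cos(πy/2) ≤ 1 - y².

Shifting the contour to Im z = d does not prove this. For c ≠ 0 the height d may be arbitrarily
close to that of the first pole, where the integral of the modulus blows up while ξ(d) stays
bounded. The contour is therefore moved beyond the first pole, at height arctan T with c²T²(1+T²) =
1. The residue contributes only π e^(-L arctan T), and the new line stays away from the poles, so
that `LineBound` controls the modulus there by W times the integrand of the real problem. What
remains is to compare π plus the new line integral with the target constant. The comparison is
tight: 1/(α(1-α)) may be as small as 4. It is done separately for near, middle and far poles, with
the spare 2/3 of `integral_logi_le`. If the pole is very far, or c = 0, no crossing is needed.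

Truncation is not symmetric in sign. Dropping positive terms can only help the bound for sum minus
integral. For integral minus sum, a unimodal function either has its integral over [-Mh, Nh]
dominated by the finite sum, or is monotone on both tails, whose sums are then at most the tail
integrals. For 0 ≤ c ≤ 3/8 the integrand is unimodal (`unimodal_nInt`). For larger c it is the sum
of two unimodal functions, e^(-απc) `nInt α 0` and `remInt α c`. That costs the additional error of
the c = 0 integrand, which is paid for by the sharper estimate `norm_oscInt_add_le_kap`. When h is
too large for that estimate, the asserted bound exceeds the whole integral. Negative c is reduced to
positive c by x ↦ -x, which replaces (α, c) by (1-α, -c). -/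

namespace DEQuadrature

open Real MeasureTheory Filter Topology Set

noncomputable section

/-! ### Moving horizontal contours, with and without a simple pole -/

/-- A holomorphic function on a closed horizontal strip that decays at both ends has the same
integral over both boundary lines. -/
theorem integral_line_eq_of_differentiableAt {f : ℂ → ℂ} {d : ℝ} (hd : 0 ≤ d)
    (hf : ∀ z : ℂ, 0 ≤ z.im → z.im ≤ d → DifferentiableAt ℂ f z)
    (h0 : Integrable fun x : ℝ => f x) (h1 : Integrable fun x : ℝ => f (x + d * Complex.I))
    {g : ℝ → ℝ} (hg : Tendsto g (cocompact ℝ) (𝓝 0))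
    (hfg : ∀ᶠ x : ℝ in cocompact ℝ, ∀ y : ℝ, 0 ≤ y → y ≤ d → ‖f (x + y * Complex.I)‖ ≤ g x) :
    ∫ x : ℝ, f x = ∫ x : ℝ, f (x + d * Complex.I) := by
  have hrect : ∀ R : ℝ, 0 ≤ R → (∫ x in (-R)..R, f x) - (∫ x in (-R)..R, f (x + d * Complex.I)) =
      Complex.I • (∫ y in (0 : ℝ)..d, f (((-R : ℝ) : ℂ) + y * Complex.I)) -
        Complex.I • (∫ y in (0 : ℝ)..d, f ((R : ℂ) + y * Complex.I)) := by
    intro R hR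
    have := Complex.integral_boundary_rect_eq_zero_of_differentiableOn f ((-R : ℝ) : ℂ)
      ((R : ℂ) + d * Complex.I) (by
        intro z hz
        have hz2 := hz.2
        simp only [Complex.ofReal_im, Complex.add_im, Complex.mul_im, Complex.ofReal_re,
          Complex.I_im, Complex.I_re, mul_one, mul_zero, add_zero, zero_add, uIcc_of_le hd,
          mem_preimage, mem_Icc] at hz2
        exact (hf z hz2.1 hz2.2).differentiableWithinAt)
    simp only [Complex.ofReal_im, Complex.ofReal_re, Complex.add_im, Complex.mul_im,
          Complex.I_im, Complex.I_re, mul_one, mul_zero, add_zero, zero_add, Complex.ofReal_zero,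
          Complex.add_re, Complex.mul_re, sub_zero, zero_mul] at this
    linear_combination this
  have hside : ∀ u : ℝ → ℝ, Tendsto u atTop (cocompact ℝ) →
      Tendsto (fun R => Complex.I • (∫ y in (0 : ℝ)..d, f ((u R : ℂ) + y * Complex.I))) atTop
        (𝓝 0) := by
    intro u hu
    rw [tendsto_zero_iff_norm_tendsto_zero]
    have hlim : Tendsto (fun R => g (u R) * |d - 0|) atTop (𝓝 0) := by
      simpa using (hg.comp hu).mul_const |d - 0|
    refine squeeze_zero' (Eventually.of_forall fun _ => norm_nonneg _) ?_ hlim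
    filter_upwards [hu.eventually hfg] with R hR
    rw [norm_smul, Complex.norm_I, one_mul]
    refine intervalIntegral.norm_integral_le_of_norm_le_const fun y hy => ?_
    rw [uIoc_of_le hd] at hy
    exact hR y hy.1.le hy.2
  have hL := (intervalIntegral_tendsto_integral h0 tendsto_neg_atTop_atBot tendsto_id).sub
    (intervalIntegral_tendsto_integral h1 tendsto_neg_atTop_atBot tendsto_id)
  have hcoc : Tendsto (fun R : ℝ => R) atTop (cocompact ℝ) := by
    rw [cocompact_eq_atBot_atTop]; exact tendsto_id.mono_right le_sup_right
  have hcoc' : Tendsto (fun R : ℝ => -R) atTop (cocompact ℝ) := by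
    rw [cocompact_eq_atBot_atTop]; exact tendsto_neg_atTop_atBot.mono_right le_sup_left
  have hR := (hside _ hcoc').sub (hside _ hcoc)
  have heq := tendsto_nhds_unique (hL.congr' ?_) hR
  · rw [sub_zero] at heq
    exact sub_eq_zero.1 heq
  · filter_upwards [eventually_ge_atTop 0] with R hRp
    exact hrect R hRp

theorem integral_div_sq_add_sq {a : ℝ} (ha : 0 < a) :
    Integrable (fun x : ℝ => a / (x ^ 2 + a ^ 2)) ∧ ∫ x : ℝ, a / (x ^ 2 + a ^ 2) = π := by
  have hfun : (fun x : ℝ => a / (x ^ 2 + a ^ 2)) = fun x => a⁻¹ * (1 + (a⁻¹ * x) ^ 2)⁻¹ := by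
    ext x
    have : 0 < x ^ 2 + a ^ 2 := by positivity
    field_simp
    ring
  rw [hfun]
  constructor
  · exact (integrable_inv_one_add_sq.comp_mul_left' (inv_ne_zero ha.ne')).const_mul _
  · rw [integral_const_mul, Measure.integral_comp_mul_left (fun x => (1 + x ^ 2)⁻¹),
      integral_univ_inv_one_add_sq]
    simp [abs_of_pos ha, ha.ne']

/-- A kernel with a simple pole of residue one at `z₀` and integrable on horizontal lines. -/
def poleKernel (z₀ z : ℂ) : ℂ := 1 / (z - z₀) - 1 / (z - starRingEnd ℂ z₀)

theorem poleKernel_line {x₀ y₀ x y : ℝ} :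
    poleKernel (x₀ + y₀ * Complex.I) (x + y * Complex.I) =
      1 / (((x - x₀ : ℝ) : ℂ) + ((y - y₀ : ℝ) : ℂ) * Complex.I)
        - 1 / (((x - x₀ : ℝ) : ℂ) + ((y + y₀ : ℝ) : ℂ) * Complex.I) := by
  unfold poleKernel
  congr 2
  · push_cast; ring
  · simp only [map_add, Complex.conj_ofReal, map_mul, Complex.conj_I]; push_cast; ring

theorem one_div_line {x a : ℝ} (ha : a ≠ 0) :
    1 / ((x : ℂ) + (a : ℂ) * Complex.I) =
      ((x / (x ^ 2 + a ^ 2) : ℝ) : ℂ) - ((a / (x ^ 2 + a ^ 2) : ℝ) : ℂ) * Complex.I := by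
  have h1 : ((x : ℂ) + (a : ℂ) * Complex.I) ≠ 0 := fun h => by
    have := congrArg Complex.im h; simp at this; exact ha this
  have h3 : ((x : ℂ) ^ 2 + (a : ℂ) ^ 2) ≠ 0 := by
    have : x ^ 2 + a ^ 2 ≠ 0 := by positivity
    exact_mod_cast this
  push_cast
  field_simp
  linear_combination ((a : ℂ) ^ 2) * Complex.I_sq

/-- On the real line the kernel is 2i times a Poisson kernel, of total mass π. -/
theorem integral_poleKernel_real {x₀ y₀ : ℝ} (hy : 0 < y₀) :
    Integrable (fun x : ℝ => poleKernel (x₀ + y₀ * Complex.I) x) ∧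
      ∫ x : ℝ, poleKernel (x₀ + y₀ * Complex.I) x = 2 * π * Complex.I := by
  have hfun : (fun x : ℝ => poleKernel (x₀ + y₀ * Complex.I) x) =
      fun x : ℝ => (2 * Complex.I) * ((y₀ / ((x - x₀) ^ 2 + y₀ ^ 2) : ℝ) : ℂ) := by
    ext x
    have h := poleKernel_line (x₀ := x₀) (y₀ := y₀) (x := x) (y := 0)
    simp only [Complex.ofReal_zero, zero_mul, add_zero, zero_sub, zero_add] at h
    rw [h]
    rw [one_div_line (neg_ne_zero.2 hy.ne'), one_div_line hy.ne']
    simp only [even_two, Even.neg_pow]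
    push_cast
    ring
  obtain ⟨hi, he⟩ := integral_div_sq_add_sq hy
  rw [hfun]
  constructor
  · exact ((hi.comp_sub_right x₀).ofReal (𝕜 := ℂ)).const_mul _
  · rw [integral_const_mul, integral_complex_ofReal,
      integral_sub_right_eq_self (fun x : ℝ => y₀ / (x ^ 2 + y₀ ^ 2)), he]
    ring

theorem one_div_sub_one_div_line {x a b : ℝ} (ha : 0 < a) (hb : 0 < b) :
    1 / ((x : ℂ) + (a : ℂ) * Complex.I) - 1 / ((x : ℂ) + (b : ℂ) * Complex.I) =
      ((x * (b ^ 2 - a ^ 2) / ((x ^ 2 + a ^ 2) * (x ^ 2 + b ^ 2)) : ℝ) : ℂ) +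
        ((b / (x ^ 2 + b ^ 2) - a / (x ^ 2 + a ^ 2) : ℝ) : ℂ) * Complex.I := by
  have e3 : x * (b ^ 2 - a ^ 2) / ((x ^ 2 + a ^ 2) * (x ^ 2 + b ^ 2)) =
      x / (x ^ 2 + a ^ 2) - x / (x ^ 2 + b ^ 2) := by
    have : x ^ 2 + a ^ 2 ≠ 0 := by positivity
    have : x ^ 2 + b ^ 2 ≠ 0 := by positivity
    field_simp
    ring
  rw [one_div_line ha.ne', one_div_line hb.ne', e3]
  push_cast
  ring

/-- Both poles lie below the line: the real part is odd about x₀, and the imaginary part is a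
difference of two Poisson kernels of equal mass. -/
theorem integral_poleKernel_above {x₀ y₀ d : ℝ} (hy : 0 < y₀) (hd : y₀ < d) :
    Integrable (fun x : ℝ => poleKernel (x₀ + y₀ * Complex.I) (x + d * Complex.I)) ∧
      ∫ x : ℝ, poleKernel (x₀ + y₀ * Complex.I) (x + d * Complex.I) = 0 := by
  set a := d - y₀
  set b := d + y₀
  have ha : 0 < a := sub_pos.2 hd
  have hb : 0 < b := by simp only [b]; linarith
  set r : ℝ → ℝ := fun x => x * (b ^ 2 - a ^ 2) / ((x ^ 2 + a ^ 2) * (x ^ 2 + b ^ 2))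
  set m : ℝ → ℝ := fun x => b / (x ^ 2 + b ^ 2) - a / (x ^ 2 + a ^ 2)
  obtain ⟨ia, ea⟩ := integral_div_sq_add_sq ha
  obtain ⟨ib, eb⟩ := integral_div_sq_add_sq hb
  have hr : Integrable r := by
    refine ((ib.const_mul (|b ^ 2 - a ^ 2| / (2 * a * b)))).mono' ?_ (Eventually.of_forall ?_)
    · apply Continuous.aestronglyMeasurable
      refine Continuous.div (by fun_prop) (by fun_prop) fun x => ?_
      positivity
    · intro x
      simp only [r, norm_div, norm_mul, Real.norm_eq_abs]
      have h1 : 0 < x ^ 2 + a ^ 2 := by positivity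
      have h2 : 0 < x ^ 2 + b ^ 2 := by positivity
      rw [abs_of_pos h1, abs_of_pos h2]
      have h3 : |x| * (2 * a) ≤ x ^ 2 + a ^ 2 := by
        rw [← sq_abs x]; nlinarith [sq_nonneg (|x| - a)]
      have h4 : 0 ≤ |b ^ 2 - a ^ 2| := abs_nonneg _
      rw [show |b ^ 2 - a ^ 2| / (2 * a * b) * (b / (x ^ 2 + b ^ 2)) =
        |b ^ 2 - a ^ 2| / ((2 * a) * (x ^ 2 + b ^ 2)) by field_simp,
        div_le_div_iff₀ (by positivity) (by positivity)]
      calc |x| * |b ^ 2 - a ^ 2| * (2 * a * (x ^ 2 + b ^ 2))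
          = (|x| * (2 * a)) * (|b ^ 2 - a ^ 2| * (x ^ 2 + b ^ 2)) := by ring
        _ ≤ (x ^ 2 + a ^ 2) * (|b ^ 2 - a ^ 2| * (x ^ 2 + b ^ 2)) := by gcongr
        _ = _ := by ring
  have hr0 : ∫ x, r x = 0 := by
    have h := integral_neg_eq_self r volume
    have h2 : (fun x => r (-x)) = fun x => -r x := by
      ext x; simp only [r, neg_sq]; ring
    rw [h2, integral_neg] at h
    linarith
  have hm : Integrable m := ib.sub ia
  have hm0 : ∫ x, m x = 0 := by
    simp only [m]
    rw [integral_sub ib ia, ea, eb, sub_self]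
  have hfun : (fun x : ℝ => poleKernel (x₀ + y₀ * Complex.I) (x + d * Complex.I)) =
      fun x : ℝ => ((r (x - x₀) : ℝ) : ℂ) + ((m (x - x₀) : ℝ) : ℂ) * Complex.I := by
    ext x
    rw [poleKernel_line]
    exact one_div_sub_one_div_line ha hb
  rw [hfun]
  have i1 := (hr.comp_sub_right x₀).ofReal (𝕜 := ℂ)
  have i2 := ((hm.comp_sub_right x₀).ofReal (𝕜 := ℂ)).mul_const Complex.I
  refine ⟨i1.add i2, ?_⟩
  have hadd : ∫ x : ℝ, (((r (x - x₀) : ℝ) : ℂ) + ((m (x - x₀) : ℝ) : ℂ) * Complex.I) =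
      (∫ x : ℝ, ((r (x - x₀) : ℝ) : ℂ)) + ∫ x : ℝ, ((m (x - x₀) : ℝ) : ℂ) * Complex.I :=
    integral_add i1 i2
  rw [hadd, integral_mul_const, integral_complex_ofReal, integral_complex_ofReal,
    integral_sub_right_eq_self r, integral_sub_right_eq_self m, hr0, hm0]
  simp

theorem norm_poleKernel_le {x₀ y₀ x y : ℝ} (hx : x ≠ x₀) :
    ‖poleKernel (x₀ + y₀ * Complex.I) (x + y * Complex.I)‖ ≤ 2 / |x - x₀| := by
  rw [poleKernel_line]
  have key : ∀ w : ℝ, ‖1 / (((x - x₀ : ℝ) : ℂ) + (w : ℂ) * Complex.I)‖ ≤ 1 / |x - x₀| := by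
    intro w
    have hne : 0 < |x - x₀| := abs_pos.2 (sub_ne_zero.2 hx)
    rw [norm_div, norm_one]
    refine one_div_le_one_div_of_le hne ?_
    simpa using Complex.abs_re_le_norm (((x - x₀ : ℝ) : ℂ) + (w : ℂ) * Complex.I)
  calc _ ≤ _ := norm_sub_le _ _
    _ ≤ 1 / |x - x₀| + 1 / |x - x₀| := add_le_add (key _) (key _)
    _ = _ := by ring

/-- Moving a horizontal line of integration across a simple pole of `N / D`. -/
theorem integral_line_sub_of_simple_pole {N D : ℂ → ℂ} (hN : Differentiable ℂ N)
    (hD : Differentiable ℂ D) {x₀ y₀ d : ℝ} (hy : 0 < y₀) (hyd : y₀ < d)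
    (hD0 : D (x₀ + y₀ * Complex.I) = 0) (hD' : deriv D (x₀ + y₀ * Complex.I) ≠ 0)
    (hne : ∀ z : ℂ, 0 ≤ z.im → z.im ≤ d → z ≠ x₀ + y₀ * Complex.I → D z ≠ 0)
    (h0 : Integrable fun x : ℝ => N x / D x)
    (h1 : Integrable fun x : ℝ => N (x + d * Complex.I) / D (x + d * Complex.I))
    {g : ℝ → ℝ} (hg : Tendsto g (cocompact ℝ) (𝓝 0))
    (hfg : ∀ᶠ x : ℝ in cocompact ℝ, ∀ y : ℝ, 0 ≤ y → y ≤ d →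
      ‖N (x + y * Complex.I) / D (x + y * Complex.I)‖ ≤ g x) :
    (∫ x : ℝ, N x / D x) - (∫ x : ℝ, N (x + d * Complex.I) / D (x + d * Complex.I)) =
      2 * π * Complex.I *
        (N (x₀ + y₀ * Complex.I) / deriv D (x₀ + y₀ * Complex.I)) := by
  set z₀ : ℂ := x₀ + y₀ * Complex.I with hz₀
  have hz₀im : z₀.im = y₀ := by simp [hz₀]
  set r : ℂ := N z₀ / deriv D z₀
  set q : ℂ → ℂ := dslope D z₀
  have hq : Differentiable ℂ q := by
    rw [← differentiableOn_univ]
    exact (Complex.differentiableOn_dslope univ_mem).2 hD.differentiableOn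
  have hDq : ∀ z, D z = (z - z₀) * q z := by
    intro z
    have := sub_smul_dslope D z₀ z
    rw [hD0, sub_zero, smul_eq_mul] at this
    exact this.symm
  have hqz₀ : q z₀ = deriv D z₀ := dslope_same _ _
  set U : Set ℂ := {z | q z ≠ 0}
  have hUo : IsOpen U := isOpen_ne_fun hq.continuous continuous_const
  have hUz₀ : z₀ ∈ U := by simpa [U, hqz₀] using hD'
  have hUs : ∀ z : ℂ, 0 ≤ z.im → z.im ≤ d → z ∈ U := by
    intro z h1 h2
    by_cases h : z = z₀
    · rw [h]; exact hUz₀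
    · intro hz
      exact hne z h1 h2 h (by rw [hDq, hz, mul_zero])
  set P : ℂ → ℂ := fun z => N z / q z
  have hP : DifferentiableOn ℂ P U := fun z hz =>
    ((hN z).div (hq z) hz).differentiableWithinAt
  have hPs : DifferentiableOn ℂ (dslope P z₀) U :=
    (Complex.differentiableOn_dslope (hUo.mem_nhds hUz₀)).2 hP
  have hPz₀ : P z₀ = r := by simp only [P, r, hqz₀]
  -- The divided difference of P = N/q at z₀ is N/D with its pole removed. Adding r/(z - conj z₀),
  -- singular only below the real axis, turns the subtracted term into r times `poleKernel`, which
  -- is integrable on lines.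
  set Δ : ℂ → ℂ := fun z => dslope P z₀ z + r / (z - starRingEnd ℂ z₀)
  have hΔ : ∀ z, z ≠ z₀ → Δ z = N z / D z - r * poleKernel z₀ z := by
    intro z hz
    have h2 : dslope P z₀ z = (N z / q z - r) / (z - z₀) := by
      rw [dslope_of_ne _ hz, slope_def_field, hPz₀]
    simp only [Δ, h2, poleKernel, hDq z]
    have : z - z₀ ≠ 0 := sub_ne_zero.2 hz
    have e : N z / ((z - z₀) * q z) = N z / q z / (z - z₀) := by
      rw [div_div, mul_comm]
    rw [e]
    ring
  have hΔd : ∀ z : ℂ, 0 ≤ z.im → z.im ≤ d → DifferentiableAt ℂ Δ z := by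
    intro z h1 h2
    refine ((hPs.differentiableAt (hUo.mem_nhds (hUs z h1 h2)))).add ?_
    refine (differentiableAt_const r).div (by fun_prop) ?_
    intro h
    have := congrArg Complex.im h
    simp only [Complex.sub_im, Complex.conj_im, hz₀im, sub_neg_eq_add, Complex.zero_im] at this
    linarith
  obtain ⟨ik0, ek0⟩ := integral_poleKernel_real (x₀ := x₀) hy
  obtain ⟨ik1, ek1⟩ := integral_poleKernel_above (x₀ := x₀) hy hyd
  have e0 : (fun x : ℝ => Δ x) = fun x : ℝ => N x / D x - r * poleKernel z₀ x := by
    ext x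
    refine hΔ _ fun h => ?_
    have := congrArg Complex.im h
    rw [hz₀im, Complex.ofReal_im] at this
    linarith
  have e1 : (fun x : ℝ => Δ (x + d * Complex.I)) = fun x : ℝ =>
      N (x + d * Complex.I) / D (x + d * Complex.I) - r * poleKernel z₀ (x + d * Complex.I) := by
    ext x
    refine hΔ _ fun h => ?_
    have := congrArg Complex.im h
    rw [hz₀im] at this
    simp at this
    linarith
  have key := integral_line_eq_of_differentiableAt (f := Δ) (hy.trans hyd).le hΔd
    (by rw [e0]; exact h0.sub (ik0.const_mul r)) (by rw [e1]; exact h1.sub (ik1.const_mul r))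
    (g := fun x => g x + ‖r‖ * (2 / |x - x₀|)) (by
      have h2 : Tendsto (fun x : ℝ => 2 / |x - x₀|) (cocompact ℝ) (𝓝 0) := by
        refine Tendsto.div_atTop tendsto_const_nhds ?_
        have h3 : Tendsto (fun x : ℝ => x - x₀) (cocompact ℝ) (cocompact ℝ) :=
          (Homeomorph.subRight x₀).isClosedEmbedding.tendsto_cocompact
        exact (tendsto_norm_cocompact_atTop (E := ℝ)).comp h3
      simpa using hg.add (h2.const_mul ‖r‖)) (by
      have hx₀ : ∀ᶠ x : ℝ in cocompact ℝ, x ≠ x₀ :=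
        (isCompact_singleton (x := x₀)).compl_mem_cocompact
      filter_upwards [hfg, hx₀] with x hx hxx y hy1 hy2
      have hzne : (x : ℂ) + y * Complex.I ≠ z₀ := fun h => by
        have := congrArg Complex.re h
        simp [hz₀] at this
        exact hxx this
      rw [hΔ _ hzne]
      refine (norm_sub_le _ _).trans (add_le_add (hx y hy1 hy2) ?_)
      rw [norm_mul]
      exact mul_le_mul_of_nonneg_left (norm_poleKernel_le hxx) (norm_nonneg _))
  rw [e0, e1, integral_sub h0 (ik0.const_mul r), integral_sub h1 (ik1.const_mul r),
    integral_const_mul, integral_const_mul, ek0, ek1] at key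
  linear_combination key

/-! ### The complexified integrand and its modulus on a horizontal line -/

/-- The one-sided logistic density `e^{αv} / (1 + e^v)`. -/
def logi (α v : ℝ) : ℝ := exp (α * v) / (1 + exp v)

/-- Denominator of the complexified integrand. -/
def cDen (c : ℝ) (z : ℂ) : ℂ := 1 + Complex.exp (π * (Complex.sinh z - c))

/-- Numerator of the complexified integrand, with an oscillating factor `e^{iLz}`. -/
def cNum (α c L : ℝ) (z : ℂ) : ℂ :=
  π / 2 * Complex.cosh z * Complex.exp (α * (π * (Complex.sinh z - c))) *
    Complex.exp (L * Complex.I * z)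

theorem differentiable_cDen (c : ℝ) : Differentiable ℂ (cDen c) := by
  unfold cDen; fun_prop

theorem differentiable_cNum (α c L : ℝ) : Differentiable ℂ (cNum α c L) := by
  unfold cNum; fun_prop

theorem sinh_line (x d : ℝ) : Complex.sinh (x + d * Complex.I) =
    ((sinh x * cos d : ℝ) : ℂ) + ((cosh x * sin d : ℝ) : ℂ) * Complex.I := by
  rw [Complex.sinh_add, Complex.cosh_mul_I, Complex.sinh_mul_I]
  push_cast
  ring

theorem cosh_line (x d : ℝ) : Complex.cosh (x + d * Complex.I) =
    ((cosh x * cos d : ℝ) : ℂ) + ((sinh x * sin d : ℝ) : ℂ) * Complex.I := by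
  rw [Complex.cosh_add, Complex.cosh_mul_I, Complex.sinh_mul_I]
  push_cast
  ring

theorem normSq_line (a b : ℝ) : ‖(a : ℂ) + (b : ℂ) * Complex.I‖ ^ 2 = a ^ 2 + b ^ 2 := by
  rw [← Complex.normSq_eq_norm_sq, Complex.normSq_add_mul_I]

theorem norm_cosh_line_sq (x d : ℝ) : ‖Complex.cosh (x + d * Complex.I)‖ ^ 2 =
    (cosh x * cos d) ^ 2 + (sinh x * sin d) ^ 2 := by
  rw [cosh_line, normSq_line]

theorem arg_line (c x d : ℝ) : (π : ℂ) * (Complex.sinh (x + d * Complex.I) - c) =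
    ((π * (sinh x * cos d - c) : ℝ) : ℂ) + ((π * (cosh x * sin d) : ℝ) : ℂ) * Complex.I := by
  rw [sinh_line]; push_cast; ring

/-- Since 1 + e^w = 2 e^(w/2) cosh(w/2), this is |cosh(a + ib)|² = sinh² a + cos² b. It separates
the distance from the column u = 0 of the poles from the height θ along it. -/
theorem norm_one_add_exp_sq (u θ : ℝ) : ‖1 + Complex.exp ((u : ℂ) + (θ : ℂ) * Complex.I)‖ ^ 2 =
    4 * exp u * (sinh (u / 2) ^ 2 + cos (θ / 2) ^ 2) := by
  have h : 1 + Complex.exp ((u : ℂ) + (θ : ℂ) * Complex.I) =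
      ((1 + exp u * cos θ : ℝ) : ℂ) + ((exp u * sin θ : ℝ) : ℂ) * Complex.I := by
    rw [Complex.exp_add, Complex.exp_mul_I]
    push_cast
    ring
  rw [h, normSq_line]
  have h1 : cos θ = 2 * cos (θ / 2) ^ 2 - 1 := by rw [← cos_two_mul]; congr 1; ring
  have h2 : exp u = exp (u / 2) ^ 2 := by rw [← exp_nat_mul]; congr 1; push_cast; ring
  have h3 : exp (u / 2) * exp (-(u / 2)) = 1 := by rw [← exp_add]; simp
  have h4 : 2 * sinh (u / 2) * exp (u / 2) = exp u - 1 := by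
    rw [sinh_eq, h2]; linear_combination -h3
  have h5 : 4 * exp u * sinh (u / 2) ^ 2 = (exp u - 1) ^ 2 := by rw [← h4, h2]; ring
  have h6 := sin_sq_add_cos_sq θ
  rw [mul_add, h5]
  linear_combination exp u ^ 2 * h6 + 2 * exp u * h1

theorem one_add_exp_sq (u : ℝ) : (1 + exp u) ^ 2 = 4 * exp u * cosh (u / 2) ^ 2 := by
  have h := norm_one_add_exp_sq u 0
  simp only [Complex.ofReal_zero, zero_mul, add_zero, zero_div, cos_zero, one_pow] at h
  rw [cosh_sq, ← h]
  rw [← Complex.ofReal_exp, ← Complex.ofReal_one, ← Complex.ofReal_add, Complex.norm_real,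
    Real.norm_eq_abs, sq_abs]

/-- The inequality behind the line bounds: on the line `Im z = arctan t` the modulus of the
integrand is at most `W` times its value on the real line, up to the change of variables. -/
def LineBound (t c W : ℝ) : Prop :=
  ∀ X : ℝ, (1 / (1 + t ^ 2) + X ^ 2 + t ^ 2 * X ^ 2) * cosh (π / 2 * (X - c)) ^ 2 ≤
    W ^ 2 * (1 / (1 + t ^ 2) + X ^ 2) *
      (sinh (π / 2 * (X - c)) ^ 2 + cos (π / 2 * (t * √(1 / (1 + t ^ 2) + X ^ 2))) ^ 2)

theorem cos_sq_arctan' (t : ℝ) : cos (arctan t) ^ 2 = 1 / (1 + t ^ 2) := by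
  rw [cos_arctan, div_pow, sq_sqrt (by positivity), one_pow]

theorem sin_arctan_eq (t : ℝ) : sin (arctan t) = t * cos (arctan t) := by
  rw [sin_arctan, cos_arctan]; ring

/-- With d = arctan t and X = sinh x cos d, the real part of sinh z, one has cosh x cos d = √(cos² d
+ X²), and the imaginary part of sinh z is t times this root. These are the quantities in
`LineBound`. -/
theorem LineBound.norm_le {t c W : ℝ} (hW : 0 ≤ W) (h : LineBound t c W) (x : ℝ) :
    ‖Complex.cosh (x + arctan t * Complex.I)‖ * (1 + exp (π * (sinh x * cos (arctan t) - c))) ≤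
      W * (cosh x * cos (arctan t)) * ‖cDen c (x + arctan t * Complex.I)‖ := by
  set k := cos (arctan t) with hk
  have hkpos : 0 < k := cos_arctan_pos t
  have hk2 : k ^ 2 = 1 / (1 + t ^ 2) := cos_sq_arctan' t
  have hX := h (sinh x * k)
  set u := π * (sinh x * k - c)
  have hu : π / 2 * (sinh x * k - c) = u / 2 := by simp only [u]; ring
  have hc2 : 1 / (1 + t ^ 2) + (sinh x * k) ^ 2 = (cosh x * k) ^ 2 := by
    rw [← hk2, mul_pow, mul_pow, cosh_sq]; ring
  have hcp : 0 < cosh x * k := mul_pos (cosh_pos x) hkpos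
  rw [hc2, sqrt_sq hcp.le, hu] at hX
  have hsin : sin (arctan t) = t * k := sin_arctan_eq t
  have hden : ‖cDen c (x + arctan t * Complex.I)‖ ^ 2 =
      4 * exp u * (sinh (u / 2) ^ 2 + cos (π / 2 * (t * (cosh x * k))) ^ 2) := by
    rw [cDen, arg_line, norm_one_add_exp_sq]
    simp only [u, hk]
    rw [hsin, ← hk]
    congr 4
    ring
  refine (sq_le_sq₀ (by positivity) (by positivity)).1 ?_
  rw [mul_pow, mul_pow, hden, one_add_exp_sq, norm_cosh_line_sq, hsin, ← hk]
  have he : 0 < exp u := exp_pos u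
  calc ((cosh x * k) ^ 2 + (sinh x * (t * k)) ^ 2) * (4 * exp u * cosh (u / 2) ^ 2)
      = 4 * exp u * (((cosh x * k) ^ 2 + t ^ 2 * (sinh x * k) ^ 2) * cosh (u / 2) ^ 2) := by ring
    _ ≤ 4 * exp u * (W ^ 2 * (cosh x * k) ^ 2 *
        (sinh (u / 2) ^ 2 + cos (π / 2 * (t * (cosh x * k))) ^ 2)) := by gcongr
    _ = _ := by ring

theorem norm_cNum (α c L x d : ℝ) : ‖cNum α c L (x + d * Complex.I)‖ =
    π / 2 * ‖Complex.cosh (x + d * Complex.I)‖ * exp (α * (π * (sinh x * cos d - c))) *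
      exp (-(L * d)) := by
  rw [cNum, norm_mul, norm_mul, norm_mul, arg_line, Complex.norm_exp, Complex.norm_exp]
  have h1 : ‖(π : ℂ) / 2‖ = π / 2 := by
    rw [show (π : ℂ) / 2 = ((π / 2 : ℝ) : ℂ) by push_cast; ring, Complex.norm_real,
      Real.norm_eq_abs, abs_of_pos (by positivity)]
  have h2 : ((α : ℂ) * (((π * (sinh x * cos d - c) : ℝ) : ℂ) +
      ((π * (cosh x * sin d) : ℝ) : ℂ) * Complex.I)).re = α * (π * (sinh x * cos d - c)) := by
    rw [Complex.re_ofReal_mul, Complex.add_re, Complex.ofReal_re, Complex.re_ofReal_mul]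
    simp
  have h3 : ((L : ℂ) * Complex.I * (x + d * Complex.I)).re = -(L * d) := by
    rw [mul_assoc, Complex.re_ofReal_mul]
    simp
  rw [h1, h2, h3]

theorem LineBound.norm_div_le {t c W : ℝ} (hW : 0 ≤ W) (h : LineBound t c W) (α L x : ℝ) :
    ‖cNum α c L (x + arctan t * Complex.I) / cDen c (x + arctan t * Complex.I)‖ ≤
      W / 2 * exp (-(L * arctan t)) *
        (logi α (π * (sinh x * cos (arctan t) - c)) * (π * (cosh x * cos (arctan t)))) := by
  have h1 := h.norm_le hW x
  have hk := cos_arctan_pos t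
  set k := cos (arctan t)
  set u := π * (sinh x * k - c)
  rw [norm_div, norm_cNum]
  set D := ‖cDen c (x + arctan t * Complex.I)‖
  have hD : 0 ≤ D := norm_nonneg _
  have hE : 0 < 1 + exp u := by positivity
  -- At a zero of the denominator the quotient is 0 by convention, so the bound holds there too.
  rcases hD.eq_or_lt with hD0 | hDpos
  · rw [← hD0, div_zero]
    have := cosh_pos x
    unfold logi
    positivity
  · rw [div_le_iff₀ hDpos]
    unfold logi
    have e : W / 2 * exp (-(L * arctan t)) * (exp (α * u) / (1 + exp u) * (π * (cosh x * k))) * D =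
        π / 2 * exp (α * u) * exp (-(L * arctan t)) * (W * (cosh x * k) * D) / (1 + exp u) := by
      ring
    rw [e, le_div_iff₀ hE]
    calc _ = π / 2 * exp (α * u) * exp (-(L * arctan t)) *
        (‖Complex.cosh (x + arctan t * Complex.I)‖ * (1 + exp u)) := by ring
      _ ≤ _ := by gcongr

theorem re_add_mul_I (a b : ℝ) : ((a : ℂ) + (b : ℂ) * Complex.I).re = a := by simp

theorem logi_pos (α v : ℝ) : 0 < logi α v := by unfold logi; positivity

theorem continuous_logi (α : ℝ) : Continuous (logi α) := by
  unfold logi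
  exact Continuous.div (by fun_prop) (by fun_prop) fun v => by positivity

/-- For s = e^v ≤ 1, 1/(1 + s) ≤ 1 - s/2. The correction s/2 is kept because it produces the spare
2/3 in `integral_logi_le`. -/
theorem logi_le_neg {α v : ℝ} (hv : v ≤ 0) :
    logi α v ≤ exp (α * v) - 1 / 2 * exp ((1 + α) * v) := by
  unfold logi
  rw [div_le_iff₀ (by positivity), show (1 + α) * v = α * v + v by ring, exp_add]
  have h1 : exp v ≤ 1 := exp_le_one_iff.2 hv
  nlinarith [exp_pos (α * v), exp_pos v, mul_nonneg (exp_pos (α * v)).le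
    (mul_nonneg (exp_pos v).le (sub_nonneg.2 h1))]

theorem logi_neg (α v : ℝ) : logi α (-v) = logi (1 - α) v := by
  unfold logi
  rw [div_eq_div_iff (by positivity) (by positivity), exp_neg,
    show (1 - α) * v = v + α * -v by ring, exp_add]
  have := exp_pos v
  field_simp
  ring

theorem logi_le_pos {α v : ℝ} (hv : 0 ≤ v) :
    logi α v ≤ exp ((α - 1) * v) - 1 / 2 * exp ((α - 2) * v) := by
  have h := logi_le_neg (α := 1 - α) (v := -v) (by linarith)
  rw [logi_neg, sub_sub_cancel] at h
  have e1 : (1 - α) * -v = (α - 1) * v := by ring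
  have e2 : (1 + (1 - α)) * -v = (α - 2) * v := by ring
  rwa [e1, e2] at h

theorem integrableOn_logi_Iic {α : ℝ} (hα : 0 < α) : IntegrableOn (logi α) (Iic 0) := by
  refine (integrableOn_exp_mul_Iic hα 0).mono' (continuous_logi α).aestronglyMeasurable ?_
  refine (ae_restrict_iff' measurableSet_Iic).2 (Eventually.of_forall fun v hv => ?_)
  rw [Real.norm_of_nonneg (logi_pos _ _).le]
  have := logi_le_neg (α := α) hv
  have := exp_pos ((1 + α) * v)
  linarith

theorem integrableOn_logi_Ioi {α : ℝ} (hα : α < 1) : IntegrableOn (logi α) (Ioi 0) := by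
  refine (integrableOn_exp_mul_Ioi (a := α - 1) (by linarith) 0).mono'
    (continuous_logi α).aestronglyMeasurable ?_
  refine (ae_restrict_iff' measurableSet_Ioi).2 (Eventually.of_forall fun v hv => ?_)
  rw [Real.norm_of_nonneg (logi_pos _ _).le]
  have := logi_le_pos (α := α) (le_of_lt hv)
  have := exp_pos ((α - 2) * v)
  linarith

theorem integrable_logi {α : ℝ} (h0 : 0 < α) (h1 : α < 1) : Integrable (logi α) := by
  rw [← integrableOn_univ, ← Iic_union_Ioi (a := (0 : ℝ))]
  exact (integrableOn_logi_Iic h0).union (integrableOn_logi_Ioi h1)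

/-- The exact value is π / sin(πα); an elementary bound is enough. The 2/3 is the minimum, at α =
1/2, of 1/(2(1+α)) + 1/(2(2-α)), and later makes room for the residue. -/
theorem integral_logi_le {α : ℝ} (h0 : 0 < α) (h1 : α < 1) :
    ∫ v, logi α v ≤ 1 / (α * (1 - α)) - 2 / 3 := by
  rw [← intervalIntegral.integral_Iic_add_Ioi (integrableOn_logi_Iic h0)
    (integrableOn_logi_Ioi h1)]
  have a1 : ∫ v in Iic (0 : ℝ), logi α v ≤ 1 / α - 1 / 2 * (1 / (1 + α)) := by
    have i1 := integrableOn_exp_mul_Iic h0 0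
    have i2 := (integrableOn_exp_mul_Iic (a := 1 + α) (by linarith) 0).const_mul (1 / 2)
    calc _ ≤ ∫ v in Iic (0 : ℝ), (exp (α * v) - 1 / 2 * exp ((1 + α) * v)) :=
          setIntegral_mono_on (integrableOn_logi_Iic h0) (i1.sub i2) measurableSet_Iic
            fun v hv => logi_le_neg hv
      _ = _ := by
          rw [integral_sub i1 i2, integral_const_mul, integral_exp_mul_Iic h0,
            integral_exp_mul_Iic (by linarith)]
          simp
  have a2 : ∫ v in Ioi (0 : ℝ), logi α v ≤ 1 / (1 - α) - 1 / 2 * (1 / (2 - α)) := by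
    have i1 := integrableOn_exp_mul_Ioi (a := α - 1) (by linarith) 0
    have i2 := (integrableOn_exp_mul_Ioi (a := α - 2) (by linarith) 0).const_mul (1 / 2)
    calc _ ≤ ∫ v in Ioi (0 : ℝ), (exp ((α - 1) * v) - 1 / 2 * exp ((α - 2) * v)) :=
          setIntegral_mono_on (integrableOn_logi_Ioi h1) (i1.sub i2) measurableSet_Ioi
            fun v hv => logi_le_pos (le_of_lt hv)
      _ = _ := by
          rw [integral_sub i1 i2, integral_const_mul, integral_exp_mul_Ioi (by linarith),
            integral_exp_mul_Ioi (by linarith)]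
          simp only [mul_zero, exp_zero]
          rw [show α - 1 = -(1 - α) by ring, show α - 2 = -(2 - α) by ring, neg_div_neg_eq,
            neg_div_neg_eq]
  have h2 : 0 < 1 - α := by linarith
  have h3 : 0 < 2 - α := by linarith
  have h4 : 0 < 1 + α := by linarith
  have e : 1 / (α * (1 - α)) = 1 / α + 1 / (1 - α) := by field_simp; ring
  have e2 : 2 / 3 ≤ 1 / 2 * (1 / (1 + α)) + 1 / 2 * (1 / (2 - α)) := by
    have : 1 / 2 * (1 / (1 + α)) + 1 / 2 * (1 / (2 - α)) = 3 / (2 * ((1 + α) * (2 - α))) := by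
      field_simp; ring
    rw [this, div_le_div_iff₀ (by norm_num) (by positivity)]
    nlinarith [sq_nonneg (2 * α - 1)]
  linarith

theorem integral_logi_nonneg (α : ℝ) : 0 ≤ ∫ v, logi α v :=
  integral_nonneg fun v => (logi_pos α v).le

/-- Change of variables `u = π (k sinh x - c)`. -/
theorem integrable_logi_comp {α k : ℝ} (h0 : 0 < α) (h1 : α < 1) (c : ℝ) (hk : 0 < k) :
    Integrable (fun x => logi α (π * (sinh x * k - c)) * (π * (cosh x * k))) ∧
      ∫ x, logi α (π * (sinh x * k - c)) * (π * (cosh x * k)) = ∫ v, logi α v := by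
  set u : ℝ → ℝ := fun x => π * (sinh x * k - c)
  have hder : ∀ x ∈ (univ : Set ℝ), HasDerivWithinAt u (π * (cosh x * k)) univ x := fun x _ =>
    ((((hasDerivAt_sinh x).mul_const k).sub_const c).const_mul π).hasDerivWithinAt
  have hinj : InjOn u univ := by
    intro x _ y _ h
    have h2 : sinh x * k = sinh y * k := by
      have := mul_left_cancel₀ pi_pos.ne' h
      linarith
    exact sinh_injective (mul_right_cancel₀ hk.ne' h2)
  have himg : u '' univ = univ := by
    rw [image_univ, range_eq_univ]
    intro v
    obtain ⟨x, hx⟩ := sinh_surjective ((v / π + c) / k)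
    refine ⟨x, ?_⟩
    simp only [u, hx]
    have := pi_pos
    field_simp
    ring
  have habs : ∀ x, |π * (cosh x * k)| = π * (cosh x * k) := fun x =>
    abs_of_pos (by have := cosh_pos x; positivity)
  have e1 := integrableOn_image_iff_integrableOn_abs_deriv_smul MeasurableSet.univ hder hinj
    (logi α)
  have e2 := integral_image_eq_integral_abs_deriv_smul MeasurableSet.univ hder hinj (logi α)
  rw [himg] at e1 e2
  simp only [habs, smul_eq_mul, setIntegral_univ, integrableOn_univ] at e1 e2
  have hcomm : (fun x => logi α (π * (sinh x * k - c)) * (π * (cosh x * k))) =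
      fun x => π * (cosh x * k) * logi α (u x) := by
    ext x; rw [mul_comm]
  rw [hcomm]
  exact ⟨e1.1 (integrable_logi h0 h1), e2.symm⟩

/-- The normalized double-exponential integrand. -/
def nInt (α c x : ℝ) : ℝ := π / 2 * cosh x * logi α (π * (sinh x - c))

theorem nInt_pos (α c x : ℝ) : 0 < nInt α c x := by
  have := cosh_pos x
  have := logi_pos α (π * (sinh x - c))
  unfold nInt; positivity

theorem continuous_nInt (α c : ℝ) : Continuous (nInt α c) := by
  unfold nInt
  exact (by fun_prop : Continuous fun x => π / 2 * cosh x).mul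
    ((continuous_logi α).comp (by fun_prop))

theorem integrable_nInt {α : ℝ} (h0 : 0 < α) (h1 : α < 1) (c : ℝ) :
    Integrable (nInt α c) ∧ ∫ x, nInt α c x = (∫ v, logi α v) / 2 := by
  obtain ⟨i, e⟩ := integrable_logi_comp h0 h1 c one_pos
  have hfun : nInt α c = fun x => 1 / 2 *
      (logi α (π * (sinh x * 1 - c)) * (π * (cosh x * 1))) := by
    ext x; simp only [nInt, mul_one]; ring
  rw [hfun]
  exact ⟨i.const_mul _, by rw [integral_const_mul, e]; ring⟩

theorem cNum_div_cDen_real (α c L x : ℝ) : cNum α c L x / cDen c x =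
    (nInt α c x : ℂ) * Complex.exp (L * Complex.I * x) := by
  unfold cNum cDen nInt logi
  push_cast
  ring

/-- The oscillatory integral `∫ g(x) e^{iLx} dx` of the normalized integrand. -/
def oscInt (α c L : ℝ) : ℂ := ∫ x : ℝ, (nInt α c x : ℂ) * Complex.exp (L * Complex.I * x)

theorem norm_exp_I_mul (L x : ℝ) : ‖Complex.exp (L * Complex.I * x)‖ = 1 := by
  rw [show (L : ℂ) * Complex.I * x = ((L * x : ℝ) : ℂ) * Complex.I by push_cast; ring,
    Complex.norm_exp_ofReal_mul_I]

theorem norm_oscInt_le {α : ℝ} (h0 : 0 < α) (h1 : α < 1) (c L : ℝ) :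
    ‖oscInt α c L‖ ≤ (∫ v, logi α v) / 2 := by
  rw [← (integrable_nInt h0 h1 c).2]
  refine (norm_integral_le_integral_norm _).trans (le_of_eq ?_)
  congr 1
  ext x
  rw [norm_mul, norm_exp_I_mul, mul_one, Complex.norm_real, Real.norm_of_nonneg (nInt_pos _ _ _).le]

theorem integrable_cNum_div_real {α : ℝ} (h0 : 0 < α) (h1 : α < 1) (c L : ℝ) :
    Integrable fun x : ℝ => cNum α c L x / cDen c x := by
  refine Integrable.mono' (integrable_nInt h0 h1 c).1 ?_ (Eventually.of_forall fun x => ?_)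
  · exact (((differentiable_cNum α c L).continuous.comp Complex.continuous_ofReal).measurable.div
      ((differentiable_cDen c).continuous.comp
        Complex.continuous_ofReal).measurable).aestronglyMeasurable
  · rw [cNum_div_cDen_real, norm_mul, norm_exp_I_mul, mul_one, Complex.norm_real,
      Real.norm_of_nonneg (nInt_pos _ _ _).le]

theorem LineBound.integrable {α : ℝ} (h0 : 0 < α) (h1 : α < 1) {t c W : ℝ} (hW : 0 ≤ W)
    (h : LineBound t c W) (L : ℝ) :
    (Integrable fun x : ℝ => cNum α c L (x + arctan t * Complex.I) /
      cDen c (x + arctan t * Complex.I)) ∧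
    ‖∫ x : ℝ, cNum α c L (x + arctan t * Complex.I) / cDen c (x + arctan t * Complex.I)‖ ≤
      W / 2 * exp (-(L * arctan t)) * ∫ v, logi α v := by
  obtain ⟨i, e⟩ := integrable_logi_comp h0 h1 c (cos_arctan_pos t)
  constructor
  · refine Integrable.mono' (i.const_mul (W / 2 * exp (-(L * arctan t)))) ?_
      (Eventually.of_forall fun x => h.norm_div_le hW α L x)
    exact (((differentiable_cNum α c L).continuous.comp (by fun_prop)).measurable.div
      ((differentiable_cDen c).continuous.comp (by fun_prop)).measurable).aestronglyMeasurable
  · rw [← e, ← integral_const_mul]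
    exact norm_integral_le_of_norm_le (i.const_mul _)
      (Eventually.of_forall fun x => h.norm_div_le hW α L x)

/-! ### Decay of the integrand, uniform in the strip -/

theorem sinh_abs_ge (x : ℝ) : (exp |x| - 1) / 2 ≤ sinh |x| := by
  rw [sinh_eq]
  have : exp (-|x|) ≤ 1 := exp_le_one_iff.2 (neg_nonpos.2 (abs_nonneg x))
  linarith

theorem cosh_le_exp_abs (x : ℝ) : cosh x ≤ exp |x| := by
  rw [← cosh_abs, cosh_eq]
  have : exp (-|x|) ≤ exp |x| := exp_le_exp.2 (by have := abs_nonneg x; linarith)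
  linarith

/-- Whatever θ is, |1 + e^(u+iθ)| ≥ |1 - e^u|; away from u = 0 this gives exponential decay on both
sides, at any rate β ≤ min(α, 1-α). -/
theorem logi_div_bound {α β u U : ℝ} (hβ : 0 < β) (hβ1 : β ≤ α) (hβ2 : β ≤ 1 - α) (hU : 1 ≤ U)
    (hu : U ≤ |u|) : exp (α * u) / |1 - exp u| ≤ 2 * exp (-(β * U)) := by
  have he : (2 : ℝ) ≤ exp 1 := by have := add_one_le_exp (1 : ℝ); linarith
  rcases le_or_gt 0 u with h | h
  · rw [abs_of_nonneg h] at hu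
    have h1 : 2 ≤ exp u := he.trans (exp_le_exp.2 (hU.trans hu))
    rw [abs_of_neg (by linarith), div_le_iff₀ (by linarith)]
    have h2 : exp (α * u) ≤ exp u * exp (-(β * U)) := by
      rw [← exp_add]; refine exp_le_exp.2 ?_
      nlinarith
    nlinarith [exp_pos (-(β * U))]
  · rw [abs_of_neg h] at hu
    have h1 : exp u ≤ 1 / 2 := by
      have h3 : exp u ≤ exp (-1) := exp_le_exp.2 (by linarith)
      have h4 : exp (-1) * exp 1 = 1 := by rw [← exp_add]; simp
      nlinarith [exp_pos (-1)]
    rw [abs_of_pos (by linarith), div_le_iff₀ (by linarith)]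
    have h2 : exp (α * u) ≤ exp (-(β * U)) := exp_le_exp.2 (by nlinarith)
    nlinarith [exp_pos (-(β * U))]

theorem sq_mul_exp_neg_le {k w : ℝ} (hk : 0 < k) (hw : 0 < w) :
    w * exp (-(k * w)) ≤ 2 / k ^ 2 * w⁻¹ := by
  have h := quadratic_le_exp_of_nonneg (mul_pos hk hw).le
  have h2 : (k * w) ^ 2 / 2 ≤ exp (k * w) := by nlinarith [mul_pos hk hw]
  rw [exp_neg, ← div_eq_mul_inv, ← div_eq_mul_inv, div_le_div_iff₀ (exp_pos _) hw,
    div_mul_eq_mul_div, le_div_iff₀ (by positivity)]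
  nlinarith

/-- Throughout the strip |Re sinh z - c| ≥ sinh|x| cos d - |c|, so the decay is doubly exponential.
Only e^(-|x|) is kept, enough for the vertical sides of the contour and for Poisson summation. -/
theorem exists_decay {α : ℝ} (h0 : 0 < α) (h1 : α < 1) (c : ℝ) {L d : ℝ} (hL : 0 ≤ L)
    (hd : d < π / 2) : ∃ C R : ℝ, ∀ x y : ℝ, R ≤ |x| → 0 ≤ y → y ≤ d →
      ‖cNum α c L (x + y * Complex.I) / cDen c (x + y * Complex.I)‖ ≤ C * exp (-|x|) := by
  by_cases hd0 : 0 ≤ d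
  swap
  · exact ⟨0, 0, fun x y _ h1 h2 => absurd (h1.trans h2) hd0⟩
  set β := min α (1 - α)
  have hβ : 0 < β := lt_min h0 (by linarith)
  set k := cos d
  have hk : 0 < k := cos_pos_of_mem_Ioo ⟨by linarith [pi_pos], hd⟩
  set K := β * π * k / 2
  have hK : 0 < K := by positivity
  set A := exp (β * π * |c| + K)
  refine ⟨π * A * (2 / K ^ 2), (|c| + 1) / k, fun x y hx hy0 hyd => ?_⟩
  have hcy : k ≤ cos y := cos_le_cos_of_nonneg_of_le_pi hy0 (by linarith [pi_pos]) hyd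
  set u := π * (sinh x * cos y - c)
  set U := π * (sinh |x| * k - |c|)
  have hsx : |x| ≤ sinh |x| := self_le_sinh_iff.2 (abs_nonneg x)
  have hU1 : 1 ≤ U := by
    have h2 : |c| + 1 ≤ sinh |x| * k := by
      rw [div_le_iff₀ hk] at hx
      exact hx.trans (mul_le_mul_of_nonneg_right hsx hk.le)
    have := pi_gt_three
    simp only [U]
    nlinarith
  have hUu : U ≤ |u| := by
    simp only [u, U]
    rw [abs_mul, abs_of_pos pi_pos]
    refine mul_le_mul_of_nonneg_left ?_ pi_pos.le
    have h3 : |sinh x * cos y| = sinh |x| * cos y := by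
      rw [abs_mul, abs_sinh, abs_of_pos (hk.trans_le hcy)]
    have h4 := abs_sub_abs_le_abs_sub (sinh x * cos y) c
    rw [h3] at h4
    have h5 : sinh |x| * k ≤ sinh |x| * cos y :=
      mul_le_mul_of_nonneg_left hcy ((abs_nonneg x).trans hsx)
    linarith
  have hb := logi_div_bound (α := α) hβ (min_le_left _ _) (min_le_right _ _) hU1 hUu
  have hcosh : ‖Complex.cosh (x + y * Complex.I)‖ ≤ cosh x := by
    refine (sq_le_sq₀ (norm_nonneg _) (cosh_pos x).le).1 ?_
    rw [norm_cosh_line_sq]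
    have := sin_sq_add_cos_sq y
    have := cosh_sq x
    nlinarith [sq_nonneg (sin y)]
  have hden : |1 - exp u| ≤ ‖cDen c (x + y * Complex.I)‖ := by
    rw [cDen, arg_line]
    have h6 := abs_norm_sub_norm_le (1 : ℂ) (-Complex.exp (((π * (sinh x * cos y - c) : ℝ) : ℂ) +
      ((π * (cosh x * sin y) : ℝ) : ℂ) * Complex.I))
    rw [norm_neg, Complex.norm_exp, norm_one, sub_neg_eq_add] at h6
    rwa [re_add_mul_I] at h6
  have hpos : 0 < |1 - exp u| := by
    rw [abs_pos, sub_ne_zero]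
    intro h
    have : u = 0 := by rw [← exp_eq_one_iff]; exact h.symm
    rw [this, abs_zero] at hUu
    linarith
  rw [norm_div, norm_cNum]
  have hLy : exp (-(L * y)) ≤ 1 := exp_le_one_iff.2 (by nlinarith)
  have hw := sq_mul_exp_neg_le hK (exp_pos |x|)
  have hUexp : exp (-(β * U)) ≤ A * exp (-(K * exp |x|)) := by
    rw [← exp_add]
    refine exp_le_exp.2 ?_
    have h7 := sinh_abs_ge x
    have h8 : β * π * k * ((exp |x| - 1) / 2) ≤ β * π * k * sinh |x| := by gcongr
    simp only [U, K]
    linarith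
  calc π / 2 * ‖Complex.cosh (x + y * Complex.I)‖ * exp (α * u) * exp (-(L * y)) /
        ‖cDen c (x + y * Complex.I)‖
      ≤ π / 2 * cosh x * exp (α * u) * 1 / |1 - exp u| := by
        have := cosh_pos x
        gcongr
    _ = π / 2 * cosh x * (exp (α * u) / |1 - exp u|) := by ring
    _ ≤ π / 2 * exp |x| * (2 * (A * exp (-(K * exp |x|)))) := by
        have := cosh_le_exp_abs x
        have := cosh_pos x
        gcongr
        exact hb.trans (by gcongr)
    _ = π * A * (exp |x| * exp (-(K * exp |x|))) := by ring
    _ ≤ π * A * (2 / K ^ 2 * (exp |x|)⁻¹) := by gcongr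
    _ = _ := by rw [exp_neg]; ring

theorem tendsto_const_mul_exp_neg_abs (C : ℝ) :
    Tendsto (fun x : ℝ => C * exp (-|x|)) (cocompact ℝ) (𝓝 0) := by
  simpa using (tendsto_exp_neg_atTop_nhds_zero.comp
    (tendsto_norm_cocompact_atTop (E := ℝ))).const_mul C

theorem eventually_decay {α : ℝ} (h0 : 0 < α) (h1 : α < 1) (c : ℝ) {L d : ℝ} (hL : 0 ≤ L)
    (hd : d < π / 2) : ∃ C : ℝ, ∀ᶠ x : ℝ in cocompact ℝ, ∀ y : ℝ, 0 ≤ y → y ≤ d →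
      ‖cNum α c L (x + y * Complex.I) / cDen c (x + y * Complex.I)‖ ≤ C * exp (-|x|) := by
  obtain ⟨C, R, h⟩ := exists_decay h0 h1 c hL hd
  refine ⟨C, ?_⟩
  filter_upwards [(tendsto_norm_cocompact_atTop (E := ℝ)).eventually_ge_atTop R] with x hx y h2 h3
  exact h x y hx h2 h3

/-! ### Fourier integrals bounded from a shifted line -/

theorem norm_oscInt_le_of_lineBound {α : ℝ} (h0 : 0 < α) (h1 : α < 1) {t c W L : ℝ} (ht : 0 ≤ t)
    (hL : 0 ≤ L) (hW : 0 ≤ W) (h : LineBound t c W)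
    (hne : ∀ z : ℂ, 0 ≤ z.im → z.im ≤ arctan t → cDen c z ≠ 0) :
    ‖oscInt α c L‖ ≤ W / 2 * exp (-(L * arctan t)) * ∫ v, logi α v := by
  obtain ⟨C, hC⟩ := eventually_decay h0 h1 c hL (arctan_lt_pi_div_two t)
  obtain ⟨i, e⟩ := h.integrable h0 h1 hW L
  have key := integral_line_eq_of_differentiableAt (f := fun z => cNum α c L z / cDen c z)
    (arctan_nonneg.2 ht)
    (fun z h2 h3 => (differentiable_cNum α c L z).div (differentiable_cDen c z) (hne z h2 h3))
    (integrable_cNum_div_real h0 h1 c L) i (tendsto_const_mul_exp_neg_abs C) hC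
  have : oscInt α c L = ∫ x : ℝ, cNum α c L x / cDen c x := by
    simp only [oscInt, cNum_div_cDen_real]
  rw [this, key]
  exact e

theorem deriv_cDen (c : ℝ) (z : ℂ) : deriv (cDen c) z =
    Complex.exp (π * (Complex.sinh z - c)) * (π * Complex.cosh z) := by
  have := (((((Complex.hasDerivAt_sinh z).sub_const (c : ℂ)).const_mul (π : ℂ)).cexp).const_add
    (1 : ℂ)).deriv
  exact this

/-- At the pole exp(π(sinh z₀ - c)) = -1 and the factor π cosh z₀ cancels between numerator and
derivative of the denominator. The residue has modulus e^(-L y₀)/2, independent of α and c. -/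
theorem norm_oscInt_le_of_cross {α : ℝ} (h0 : 0 < α) (h1 : α < 1) {t c W L x₀ y₀ : ℝ}
    (hL : 0 ≤ L) (hW : 0 ≤ W) (h : LineBound t c W) (hy : 0 < y₀) (hyt : y₀ < arctan t)
    (hz : Complex.sinh (x₀ + y₀ * Complex.I) = c + Complex.I)
    (hne : ∀ z : ℂ, 0 ≤ z.im → z.im ≤ arctan t → z ≠ x₀ + y₀ * Complex.I → cDen c z ≠ 0) :
    ‖oscInt α c L‖ ≤ π * exp (-(L * y₀)) +
      W / 2 * exp (-(L * arctan t)) * ∫ v, logi α v := by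
  obtain ⟨C, hC⟩ := eventually_decay h0 h1 c hL (arctan_lt_pi_div_two t)
  obtain ⟨i, e⟩ := h.integrable h0 h1 hW L
  have hexp : Complex.exp (π * (Complex.sinh (x₀ + y₀ * Complex.I) - c)) = -1 := by
    rw [hz, add_sub_cancel_left, Complex.exp_pi_mul_I]
  have hcosh : Complex.cosh (x₀ + y₀ * Complex.I) ≠ 0 := by
    intro h
    have h2 := norm_cosh_line_sq x₀ y₀
    rw [h, norm_zero] at h2
    have h3 : 0 < cosh x₀ * cos y₀ := mul_pos (cosh_pos _)
      (cos_pos_of_mem_Ioo ⟨by linarith [pi_pos], hyt.trans (arctan_lt_pi_div_two t)⟩)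
    nlinarith [sq_nonneg (sinh x₀ * sin y₀)]
  have key := integral_line_sub_of_simple_pole (differentiable_cNum α c L) (differentiable_cDen c)
    hy hyt (by rw [cDen, hexp]; ring)
    (by
      rw [deriv_cDen, hexp]
      exact mul_ne_zero (by norm_num) (mul_ne_zero (by exact_mod_cast pi_ne_zero) hcosh))
    hne (integrable_cNum_div_real h0 h1 c L) i (tendsto_const_mul_exp_neg_abs C) hC
  have hJ : oscInt α c L = ∫ x : ℝ, cNum α c L x / cDen c x := by
    simp only [oscInt, cNum_div_cDen_real]
  rw [← hJ, sub_eq_iff_eq_add] at key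
  rw [key]
  refine (norm_add_le _ _).trans (add_le_add ?_ e)
  have hX : sinh x₀ * cos y₀ = c := by
    have := congrArg Complex.re hz
    rw [sinh_line, re_add_mul_I] at this
    rw [this]
    simp
  rw [norm_mul, norm_div, norm_cNum, deriv_cDen, hexp, hX]
  have hcn : ‖Complex.cosh (x₀ + y₀ * Complex.I)‖ ≠ 0 := norm_ne_zero_iff.2 hcosh
  have hpi : ‖(π : ℂ)‖ = π := by rw [Complex.norm_real, Real.norm_of_nonneg pi_pos.le]
  simp only [norm_mul, norm_neg, norm_one, Complex.norm_I, hpi, Complex.norm_ofNat, sub_self,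
    mul_zero, exp_zero]
  have := pi_pos
  apply le_of_eq
  field_simp

/-! ### Elementary bounds for sine and cosine -/

/-- Iterating this comparison gives the Taylor bounds that follow, and later the Padé bounds for
arctan. -/
theorem le_of_hasDerivAt_le {f g f' g' : ℝ → ℝ} (hf : ∀ x, HasDerivAt f (f' x) x)
    (hg : ∀ x, HasDerivAt g (g' x) x) (h0 : f 0 = g 0) (h : ∀ x, 0 ≤ x → f' x ≤ g' x)
    {x : ℝ} (hx : 0 ≤ x) : f x ≤ g x := by
  have hm : MonotoneOn (fun x => g x - f x) (Ici 0) := by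
    refine monotoneOn_of_deriv_nonneg (convex_Ici 0)
      (fun y _ => ((hg y).sub (hf y)).continuousAt.continuousWithinAt)
      (fun y _ => ((hg y).sub (hf y)).differentiableAt.differentiableWithinAt) fun y hy => ?_
    rw [interior_Ici] at hy
    have e : deriv (fun x => g x - f x) y = g' y - f' y := ((hg y).sub (hf y)).deriv
    rw [e]
    linarith [h y (le_of_lt hy)]
  have := hm (mem_Ici.2 le_rfl) (mem_Ici.2 hx) hx
  simp only [h0, sub_self] at this
  linarith

theorem sub_cube_le_sin {x : ℝ} (hx : 0 ≤ x) : x - x ^ 3 / 6 ≤ sin x := by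
  refine le_of_hasDerivAt_le (f := fun x => x - x ^ 3 / 6) (f' := fun x => 1 - x ^ 2 / 2)
    (fun x => ?_) hasDerivAt_sin (by simp) (fun x _ => one_sub_sq_div_two_le_cos) hx
  refine ((hasDerivAt_id x).sub ((hasDerivAt_pow 3 x).div_const 6)).congr_deriv ?_
  push_cast; ring

theorem cos_le_quartic {x : ℝ} (hx : 0 ≤ x) : cos x ≤ 1 - x ^ 2 / 2 + x ^ 4 / 24 := by
  refine le_of_hasDerivAt_le (g := fun x => 1 - x ^ 2 / 2 + x ^ 4 / 24)
    (g' := fun x => -(x - x ^ 3 / 6)) hasDerivAt_cos (fun x => ?_) (by simp)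
    (fun x h => neg_le_neg (sub_cube_le_sin h)) hx
  refine ((((hasDerivAt_pow 2 x).div_const 2).const_sub 1).add
    ((hasDerivAt_pow 4 x).div_const 24)).congr_deriv ?_
  push_cast; ring

theorem sin_le_quintic {x : ℝ} (hx : 0 ≤ x) : sin x ≤ x - x ^ 3 / 6 + x ^ 5 / 120 := by
  refine le_of_hasDerivAt_le (g := fun x => x - x ^ 3 / 6 + x ^ 5 / 120)
    (g' := fun x => 1 - x ^ 2 / 2 + x ^ 4 / 24) hasDerivAt_sin (fun x => ?_) (by simp)
    (fun x h => cos_le_quartic h) hx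
  refine (((hasDerivAt_id x).sub ((hasDerivAt_pow 3 x).div_const 6)).add
    ((hasDerivAt_pow 5 x).div_const 120)).congr_deriv ?_
  push_cast; ring

theorem sextic_le_cos {x : ℝ} (hx : 0 ≤ x) :
    1 - x ^ 2 / 2 + x ^ 4 / 24 - x ^ 6 / 720 ≤ cos x := by
  refine le_of_hasDerivAt_le (f := fun x => 1 - x ^ 2 / 2 + x ^ 4 / 24 - x ^ 6 / 720)
    (f' := fun x => -(x - x ^ 3 / 6 + x ^ 5 / 120)) (fun x => ?_) hasDerivAt_cos (by simp)
    (fun x h => neg_le_neg (sin_le_quintic h)) hx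
  refine (((((hasDerivAt_pow 2 x).div_const 2).const_sub 1).add
    ((hasDerivAt_pow 4 x).div_const 24)).sub ((hasDerivAt_pow 6 x).div_const 720)).congr_deriv ?_
  push_cast; ring

theorem pi_sq_bounds : 9.8696 < π ^ 2 ∧ π ^ 2 < 9.8697 := by
  have h1 := pi_gt_d6
  have h2 := pi_lt_d6
  constructor <;> nlinarith

/-- Two factors of the product formula bound the cosine from below. -/
theorem mul_le_cos_pi_mul {y : ℝ} (h0 : 0 ≤ y) (h1 : y ≤ 1) :
    (1 - y ^ 2) * (1 - y ^ 2 / 4) ≤ cos (π / 2 * y) := by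
  obtain ⟨p1, p2⟩ := pi_sq_bounds
  -- Near the zero y = 1 the Taylor polynomial at 0 loses relative accuracy, so there the function
  -- is expanded about the zero instead.
  rcases le_or_gt y (97 / 100) with h | h
  · refine le_trans ?_ (sextic_le_cos (by positivity))
    set Y := y ^ 2
    set k := π ^ 2 / 4 with hk
    have e : 1 - (π / 2 * y) ^ 2 / 2 + (π / 2 * y) ^ 4 / 24 - (π / 2 * y) ^ 6 / 720 =
        1 - k * Y / 2 + k ^ 2 * Y ^ 2 / 24 - k ^ 3 * Y ^ 3 / 720 := by
      simp only [k, Y]; ring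
    rw [e]
    have hY0 : 0 ≤ Y := sq_nonneg y
    have hY1 : Y ≤ 0.941 := by simp only [Y]; nlinarith
    have k1 : 2.4674 ≤ k := by rw [hk]; linarith
    have k2 : k ≤ 2.46743 := by rw [hk]; linarith
    have k3 : 6 ≤ k ^ 2 := by nlinarith
    have k4 : k ^ 3 ≤ 15.03 := by
      have : k ^ 2 ≤ 6.0883 := by nlinarith
      nlinarith
    have : 0 ≤ (5 / 4 - k / 2) + (k ^ 2 / 24 - 1 / 4) * Y - k ^ 3 / 720 * Y ^ 2 := by
      have h3 : k ^ 3 / 720 * Y ^ 2 ≤ 0.0209 * Y ^ 2 := by gcongr; linarith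
      have h4 : Y ^ 2 ≤ 0.941 * Y := by nlinarith
      have h5 : 0.0036 * Y ≤ (k ^ 2 / 24 - 1 / 4) * Y := by gcongr; nlinarith
      nlinarith
    nlinarith [mul_nonneg hY0 this]
  · set e := 1 - y with he
    have hy : cos (π / 2 * y) = sin (π / 2 * e) := by
      rw [← cos_pi_div_two_sub]; congr 1; rw [he]; ring
    have hs := sub_cube_le_sin (x := π / 2 * e) (by rw [he]; have := pi_pos; nlinarith)
    rw [hy]
    refine le_trans ?_ hs
    have he0 : 0 ≤ e := by linarith
    have he1 : e ≤ 3 / 100 := by linarith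
    have h3 : (π / 2 * e) ^ 3 = e * (π / 2) * (π ^ 2 / 4 * e ^ 2) := by ring
    have h4 : π ^ 2 / 4 * e ^ 2 ≤ 0.01 := by nlinarith
    have h5 : 1.57 * e ≤ π / 2 * e := by
      have := pi_gt_d2
      nlinarith
    rw [h3, show y = 1 - e by rw [he]; ring]
    have h6 : e * (π / 2) * (π ^ 2 / 4 * e ^ 2) ≤ e * (π / 2) * 0.01 := by
      have := pi_pos; gcongr
    have h7 : (1 - (1 - e) ^ 2) * (1 - (1 - e) ^ 2 / 4) = e * ((2 - e) * (1 - (1 - e) ^ 2 / 4)) := by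
      ring
    have h8 : (2 - e) * (1 - (1 - e) ^ 2 / 4) ≤ 1.56 := by nlinarith
    rw [h7]
    nlinarith

/-- Here 1 - cos(πy/2) = 2 sin²(πy/4), and the concave sine lies above its chord on [0, π/4]. -/
theorem cos_pi_mul_le {y : ℝ} (h0 : 0 ≤ y) (h1 : y ≤ 1) : cos (π / 2 * y) ≤ 1 - y ^ 2 := by
  have m0 : (0 : ℝ) ∈ Icc 0 π := ⟨le_rfl, pi_pos.le⟩
  have m1 : π / 4 ∈ Icc 0 π := ⟨by positivity, by linarith [pi_pos]⟩
  have hc := strictConcaveOn_sin_Icc.concaveOn.2 m0 m1 (sub_nonneg.2 h1) h0 (sub_add_cancel 1 y)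
  simp only [smul_eq_mul, sin_zero, mul_zero, zero_add, sin_pi_div_four] at hc
  have e : cos (π / 2 * y) = 1 - 2 * sin (y * (π / 4)) ^ 2 := by
    rw [show π / 2 * y = 2 * (y * (π / 4)) by ring, cos_two_mul, cos_sq']; ring
  have h2 : (y * (√2 / 2)) ^ 2 ≤ sin (y * (π / 4)) ^ 2 := by gcongr
  have h3 : (y * (√2 / 2)) ^ 2 = y ^ 2 / 2 := by
    rw [mul_pow, div_pow, sq_sqrt (by norm_num)]; ring
  rw [e]; linarith

/-! ### Proofs of `LineBound`: central, direct and crossing lines -/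

theorem sq_le_sinh_sq (x : ℝ) : x ^ 2 ≤ sinh x ^ 2 := by
  rw [← sq_abs x, ← sq_abs (sinh x), abs_sinh]
  have := self_le_sinh_iff.2 (abs_nonneg x)
  gcongr

/-- Reduction of `LineBound` to a polynomial inequality after the scaling
`p = t √(1 + t²) X`, `q = t √(1 + t²) c`. -/
theorem lineBound_of_scaled {t c W q : ℝ} (ht : 0 < t) (hq : q = t * √(1 + t ^ 2) * c)
    (hW : 1 + t ^ 2 ≤ W ^ 2)
    (h : ∀ p Y : ℝ, 0 ≤ Y → Y ^ 2 * (1 + t ^ 2) = p ^ 2 + t ^ 2 →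
      (1 + t ^ 2) * p ^ 2 + t ^ 2 ≤ (W ^ 2 - (1 + t ^ 2)) * (p ^ 2 + t ^ 2) *
        (2.4674 * (p - q) ^ 2 / ((1 + t ^ 2) * t ^ 2)) +
        W ^ 2 * (p ^ 2 + t ^ 2) * cos (π / 2 * Y) ^ 2) :
    LineBound t c W := by
  intro X
  set w := 1 + t ^ 2 with hw
  have hwp : 0 < w := by positivity
  set r := √w
  have hr : r ^ 2 = w := sq_sqrt hwp.le
  set C := 1 / w + X ^ 2 with hC
  have hCp : 0 < C := by positivity
  have hX := h (t * r * X) (t * √C) (by positivity) (by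
    rw [mul_pow, sq_sqrt hCp.le, hC, mul_pow, mul_pow, hr]
    field_simp; ring)
  have e1 : (t * r * X) ^ 2 + t ^ 2 = t ^ 2 * w * C := by
    rw [hC, mul_pow, mul_pow, hr]; field_simp; ring
  have e2 : w * (t * r * X) ^ 2 + t ^ 2 = t ^ 2 * w * (C + t ^ 2 * X ^ 2) := by
    rw [hC, mul_pow, mul_pow, hr, hw]; field_simp; ring
  have e3 : 2.4674 * (t * r * X - q) ^ 2 / (w * t ^ 2) = 2.4674 * (X - c) ^ 2 := by
    rw [hq, show t * r * X - t * r * c = t * r * (X - c) by ring, mul_pow, mul_pow, hr]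
    field_simp
  rw [e1, e2, e3] at hX
  have hS : 2.4674 * (X - c) ^ 2 ≤ sinh (π / 2 * (X - c)) ^ 2 := by
    refine le_trans ?_ (sq_le_sinh_sq _)
    rw [mul_pow]
    have := pi_sq_bounds.1
    gcongr
    linarith
  set S := sinh (π / 2 * (X - c)) ^ 2
  rw [cosh_sq]
  have h1 : t ^ 2 * w * (C + t ^ 2 * X ^ 2) ≤ t ^ 2 * w *
      ((W ^ 2 - w) * C * S + W ^ 2 * C * cos (π / 2 * (t * √C)) ^ 2) := by
    refine hX.trans ?_
    have h0 : 0 ≤ W ^ 2 - w := by linarith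
    calc _ = t ^ 2 * w * ((W ^ 2 - w) * C * (2.4674 * (X - c) ^ 2) +
        W ^ 2 * C * cos (π / 2 * (t * √C)) ^ 2) := by ring
      _ ≤ _ := by gcongr
  have h2 := le_of_mul_le_mul_left h1 (by positivity)
  -- After cosh² = sinh² + 1, the share w of W² absorbs the sinh² term on the left; W² - w and the
  -- cosine are left to dominate the 1.
  have h3 : (C + t ^ 2 * X ^ 2) * S ≤ w * C * S := by
    have : C + t ^ 2 * X ^ 2 ≤ w * C := by
      have : w * C = C + t ^ 2 * X ^ 2 + t ^ 2 / w := by rw [hC, hw]; ring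
      rw [this]
      have : 0 ≤ t ^ 2 / w := by positivity
      linarith
    exact mul_le_mul_of_nonneg_right this (sq_nonneg _)
  calc _ = (C + t ^ 2 * X ^ 2) * S + (C + t ^ 2 * X ^ 2) := by ring
    _ ≤ w * C * S + ((W ^ 2 - w) * C * S + W ^ 2 * C * cos (π / 2 * (t * √C)) ^ 2) :=
      add_le_add h3 h2
    _ = _ := by ring

/-- For |p| ≥ 1 the quadratic lower bound of sinh² suffices. For |p| < 1 also Y < 1, and the cosine
is bounded below through 1 - Y² = (1 - p²)/w; the square of 1/w is what W² = w³ has to pay for. -/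
theorem lineBound_center {t : ℝ} (ht : 0 < t) : LineBound t 0 (√(1 + t ^ 2) ^ 3) := by
  set s := t ^ 2 with hs
  have hsp : 0 < s := by positivity
  set w := 1 + s with hw
  have hW : (√w ^ 3) ^ 2 = w ^ 3 := by
    rw [← pow_mul, mul_comm, pow_mul, sq_sqrt (by positivity)]
  refine lineBound_of_scaled (q := 0) ht (by simp) ?_ ?_
  · rw [← hs, ← hw, hW]; nlinarith [sq_nonneg s, pow_pos hsp 3]
  intro p Y hY0 hY
  rw [← hs, ← hw] at hY
  rw [← hs, ← hw, hW, sub_zero]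
  set P := p ^ 2
  have hP : 0 ≤ P := sq_nonneg p
  have e1 : (w ^ 3 - w) * (P + s) * (2.4674 * P / (w * s)) = (P + s) * (2.4674 * P * (w + 1)) := by
    have hwp : w ≠ 0 := by positivity
    rw [show w ^ 3 - w = w * s * (w + 1) by rw [hw]; ring]
    field_simp
  rw [e1]
  rcases le_or_gt 1 P with h1 | h1
  · have : 0 ≤ w ^ 3 * (P + s) * cos (π / 2 * Y) ^ 2 := by positivity
    have h2 : P * w + s ≤ (P + s) * (2.4674 * P * (w + 1)) := by
      have : w ≤ 2.4674 * P * (w + 1) := by nlinarith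
      nlinarith
    linarith
  · have hwp : 0 < w := by positivity
    have hY2 : Y ^ 2 = (P + s) / w := by rw [eq_div_iff hwp.ne', hY]
    have hY1 : Y ≤ 1 := by
      have : Y ^ 2 ≤ 1 := by rw [hY2, div_le_one hwp]; linarith
      nlinarith
    have hc := mul_le_cos_pi_mul hY0 hY1
    set G := 1 - Y ^ 2 / 4
    have h1Y : 1 - Y ^ 2 = (1 - P) / w := by rw [hY2, hw]; field_simp; ring
    have hG : 0 ≤ G := by simp only [G]; nlinarith
    have hc2 : ((1 - P) / w * G) ^ 2 ≤ cos (π / 2 * Y) ^ 2 := by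
      rw [h1Y] at hc
      have : 0 ≤ (1 - P) / w * G := mul_nonneg (div_nonneg (by linarith) hwp.le) hG
      gcongr
    have hg : 1 - 2 * P - Y ^ 2 / 2 ≤ (1 - P) ^ 2 * G ^ 2 := by
      have a1 : 1 - Y ^ 2 / 2 ≤ G ^ 2 := by simp only [G]; nlinarith [sq_nonneg (Y ^ 2)]
      have a2 : 1 - 2 * P ≤ (1 - P) ^ 2 := by nlinarith
      have a3 : (1 - P) ^ 2 ≤ 1 := by nlinarith
      have a4 : (1 - P) ^ 2 * (1 - Y ^ 2 / 2) ≤ (1 - P) ^ 2 * G ^ 2 := by gcongr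
      nlinarith [sq_nonneg Y]
    calc w * P + s ≤ (P + s) * (2.4674 * P * (w + 1)) +
          w * (P + s) * (1 - 2 * P - Y ^ 2 / 2) := by
          have : w * Y ^ 2 = P + s := by linarith
          have e : w * (P + s) * (1 - 2 * P - Y ^ 2 / 2) =
            (P + s) * (w * (1 - 2 * P)) - (P + s) * (w * Y ^ 2) / 2 := by ring
          rw [e, this, hw]
          nlinarith [mul_nonneg hP hsp.le, mul_nonneg (mul_nonneg hP hP) hsp.le,
            mul_nonneg (mul_nonneg hP hsp.le) hsp.le, mul_nonneg hP hP, sq_nonneg (P - s)]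
      _ ≤ (P + s) * (2.4674 * P * (w + 1)) + w * (P + s) * ((1 - P) ^ 2 * G ^ 2) := by gcongr
      _ = (P + s) * (2.4674 * P * (w + 1)) + w ^ 3 * (P + s) * ((1 - P) / w * G) ^ 2 := by
          field_simp
      _ ≤ _ := by gcongr

/-- The coefficients are 4 · 2.4674 and 4 · (3/4)². The two squares vanish at p = q and p = ±1, and
q ≤ 0.48 keeps these points apart. -/
theorem direct_poly {p q : ℝ} (hq0 : 0 ≤ q) (hq : q ≤ 0.48) :
    1 ≤ 9.8696 * (p - q) ^ 2 + 9 / 4 * (1 - p ^ 2) ^ 2 := by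
  rcases le_or_gt p 0 with h | h
  · nlinarith [sq_nonneg (p ^ 2), mul_nonneg (neg_nonneg.2 h) hq0]
  rcases le_or_gt p 0.48 with h2 | h2
  · have : p ^ 2 ≤ 0.2304 := by nlinarith
    nlinarith [sq_nonneg (p - q)]
  · have h3 : (p - 0.48) ^ 2 ≤ (p - q) ^ 2 := by
      apply pow_le_pow_left₀ <;> linarith
    have : 1 ≤ 9.8696 * (p - 0.48) ^ 2 + 9 / 4 * (1 - p ^ 2) ^ 2 := by
      nlinarith [sq_nonneg (p ^ 2 - 0.4), sq_nonneg (p - 0.64), sq_nonneg (p ^ 2 + 0.2 * p - 0.53),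
        mul_pos h (sub_pos.2 h2)]
    linarith

/-- The line meets the first pole exactly when t√(1+t²)c = 1, so 0.48 means that the pole is well
above it. The price is a factor 2 against the central case. -/
theorem lineBound_direct {t c : ℝ} (ht : 0 < t) (hc : 0 ≤ c) (hq : t * √(1 + t ^ 2) * c ≤ 0.48) :
    LineBound t c (2 * √(1 + t ^ 2) ^ 3) := by
  have hq0 : 0 ≤ t * √(1 + t ^ 2) * c := by positivity
  set q := t * √(1 + t ^ 2) * c with hqd
  set s := t ^ 2 with hs
  have hsp : 0 < s := by positivity
  set w := 1 + s with hw
  have hW : (2 * √w ^ 3) ^ 2 = 4 * w ^ 3 := by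
    rw [mul_pow, ← pow_mul, mul_comm 3, pow_mul, sq_sqrt (by positivity)]; norm_num
  refine lineBound_of_scaled ht hqd ?_ ?_
  · rw [← hs, ← hw, hW]; nlinarith [sq_nonneg s, pow_pos hsp 3]
  intro p Y hY0 hY
  rw [← hs, ← hw] at hY
  rw [← hs, ← hw, hW]
  set P := p ^ 2 with hPd
  have hP : 0 ≤ P := sq_nonneg p
  have hwp : 0 < w := by positivity
  have hmain := direct_poly (p := p) hq0 hq
  rw [← hPd] at hmain
  set Q := (p - q) ^ 2 with hQd
  have hQ : 0 ≤ Q := sq_nonneg _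
  have h1 : w * (P + s) * (9.8696 * Q) ≤
      (4 * w ^ 3 - w) * (P + s) * (2.4674 * Q / (w * s)) := by
    have e : w * (P + s) * (9.8696 * Q) = (4 * w * (w * s)) * (P + s) * (2.4674 * Q / (w * s)) := by
      field_simp; ring
    rw [e]
    gcongr
    nlinarith
  have h3 : w * P + s ≤ w * (P + s) := by nlinarith
  rcases le_or_gt 1 P with h2 | h2
  · have hQ1 : 1 ≤ 9.8696 * Q := by
      rw [hQd]
      have h4 : 1 ≤ |p| := by
        by_contra h
        rw [not_le] at h
        have : p ^ 2 < 1 := by rw [← sq_abs]; nlinarith [abs_nonneg p]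
        linarith
      have h5 : 0.52 ≤ |p - q| := by
        have := abs_sub_abs_le_abs_sub p q
        rw [abs_of_nonneg hq0] at this
        linarith
      rw [← sq_abs]
      nlinarith
    have : 0 ≤ 4 * w ^ 3 * (P + s) * cos (π / 2 * Y) ^ 2 := by positivity
    have h6 : w * (P + s) * 1 ≤ w * (P + s) * (9.8696 * Q) := by gcongr
    linarith
  · have hY2 : Y ^ 2 = (P + s) / w := by rw [eq_div_iff hwp.ne', hY]
    have hY1 : Y ^ 2 ≤ 1 := by rw [hY2, div_le_one hwp]; linarith
    have hc := mul_le_cos_pi_mul hY0 (by nlinarith)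
    have h1Y : 1 - Y ^ 2 = (1 - P) / w := by rw [hY2, hw]; field_simp; ring
    have h4 : 0 ≤ (1 - P) / w := div_nonneg (by linarith) hwp.le
    have hc1 : 3 / 4 * ((1 - P) / w) ≤ cos (π / 2 * Y) := by
      rw [← h1Y] at h4 ⊢; nlinarith
    have hc2 : (3 / 4 * ((1 - P) / w)) ^ 2 ≤ cos (π / 2 * Y) ^ 2 := by gcongr
    have h5 : w * (P + s) * (9 / 4 * (1 - P) ^ 2) ≤ 4 * w ^ 3 * (P + s) * cos (π / 2 * Y) ^ 2 := by
      calc _ = 4 * w ^ 3 * (P + s) * (3 / 4 * ((1 - P) / w)) ^ 2 := by field_simp; ring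
        _ ≤ _ := by gcongr
    have h6 : w * (P + s) * 1 ≤ w * (P + s) * (9.8696 * Q + 9 / 4 * (1 - P) ^ 2) := by gcongr
    linarith

theorem one_sub_sq_le_cos_sq (y : ℝ) : 1 - (π / 2 * (y - 2)) ^ 2 ≤ cos (π / 2 * y) ^ 2 := by
  have h : cos (π / 2 * y) = -cos (π / 2 * (y - 2)) := by
    rw [show π / 2 * y = π / 2 * (y - 2) + π by ring, cos_add_pi]
  rw [h, neg_sq, cos_sq']
  have := sin_sq_le_sq (x := π / 2 * (y - 2))
  linarith

/-- X ↦ √(k + X²) is 1-Lipschitz, so the image of the line under sinh has slope at most t. -/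
theorem sqrt_line_sub_le {t c X : ℝ} (ht : 0 ≤ t) :
    |t * √(1 / (1 + t ^ 2) + X ^ 2) - t * √(1 / (1 + t ^ 2) + c ^ 2)| ≤ t * |X - c| := by
  rw [← mul_sub, abs_mul, abs_of_nonneg ht]
  refine mul_le_mul_of_nonneg_left ?_ ht
  set k := 1 / (1 + t ^ 2)
  have hk : 0 < k := by positivity
  set A := √(k + X ^ 2)
  set C := √(k + c ^ 2)
  have hA : A ^ 2 = k + X ^ 2 := sq_sqrt (by positivity)
  have hC : C ^ 2 = k + c ^ 2 := sq_sqrt (by positivity)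
  have hA0 : 0 ≤ A := sqrt_nonneg _
  have hC0 : 0 ≤ C := sqrt_nonneg _
  refine sq_le_sq.1 ?_
  have h1 : k + X * c ≤ A * C := by
    refine le_of_abs_le (abs_le_of_sq_le_sq ?_ (by positivity))
    rw [mul_pow, hA, hC]
    nlinarith [sq_nonneg (X - c)]
  nlinarith

/-- The pointwise line bound where `Y` is at most as far from `2` as the slope allows. -/
theorem lineBound_at_of_abs_le {t c X : ℝ}
    (h : |t * √(1 / (1 + t ^ 2) + X ^ 2) - 2| ≤ t * |X - c|) :
    (1 / (1 + t ^ 2) + X ^ 2 + t ^ 2 * X ^ 2) * cosh (π / 2 * (X - c)) ^ 2 ≤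
    (1 + t ^ 2) ^ 2 * (1 / (1 + t ^ 2) + X ^ 2) *
      (sinh (π / 2 * (X - c)) ^ 2 + cos (π / 2 * (t * √(1 / (1 + t ^ 2) + X ^ 2))) ^ 2) := by
  set Y := t * √(1 / (1 + t ^ 2) + X ^ 2)
  have hc := one_sub_sq_le_cos_sq Y
  have hS := sq_le_sinh_sq (π / 2 * (X - c))
  set S := sinh (π / 2 * (X - c)) ^ 2
  set k := cos (π / 2 * Y) ^ 2
  set w := 1 + t ^ 2 with hw
  have hw0 : 0 < w := by positivity
  set C := 1 / w + X ^ 2 with hC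
  have hC0 : 0 < C := by positivity
  have hk0 : 0 ≤ k := sq_nonneg _
  have hY : (Y - 2) ^ 2 ≤ t ^ 2 * (X - c) ^ 2 := by
    rw [← sq_abs (Y - 2), ← sq_abs (X - c), ← mul_pow]
    gcongr
  have h1 : 1 ≤ t ^ 2 * S + k := by
    have e : (π / 2 * (Y - 2)) ^ 2 ≤ t ^ 2 * (π / 2 * (X - c)) ^ 2 := by
      rw [mul_pow, mul_pow]
      have := sq_nonneg (π / 2)
      nlinarith
    nlinarith [sq_nonneg t]
  have h2 : C + t ^ 2 * X ^ 2 ≤ w * C := by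
    have : w * C = C + t ^ 2 * X ^ 2 + t ^ 2 / w := by rw [hC, hw]; field_simp; ring
    rw [this]
    have : 0 ≤ t ^ 2 / w := by positivity
    linarith
  rw [cosh_sq]
  have hS0 : 0 ≤ S := sq_nonneg _
  calc (C + t ^ 2 * X ^ 2) * (S + 1) ≤ w * C * (S + 1) := by gcongr
    _ ≤ w * C * (S + (t ^ 2 * S + k)) := by gcongr
    _ = w * C * (w * S + 1 * k) := by rw [hw]; ring
    _ ≤ w * C * (w * S + w * k) := by
        gcongr
        rw [hw]; nlinarith [sq_nonneg t]
    _ = _ := by ring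

/-- The image of the line under sinh passes over the abscissa c at height 2, midway between c + i
and c + 3i, where the cosine squared is 1. Moving away from X = c, the loss in the cosine is bounded
by the slope and made up by t² sinh². -/
theorem lineBound_cross {t c : ℝ} (ht : 0 ≤ t) (h : t * √(1 / (1 + t ^ 2) + c ^ 2) = 2) :
    LineBound t c (1 + t ^ 2) := by
  intro X
  refine lineBound_at_of_abs_le ?_
  rw [← h]
  exact sqrt_line_sub_le ht

theorem cross_poly_far (p : ℝ) :
    p ^ 2 + 1 ≤ 2.4674 * (p - 3.162) ^ 2 + (p ^ 2 - 1) ^ 2 / 4 := by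
  nlinarith [sq_nonneg (p ^ 2 - 4.8), sq_nonneg (p - 2.19)]

theorem cross_poly_near {p : ℝ} (hp : 1 ≤ p) : p ^ 2 + 0.8 ≤
    (p ^ 2 + 4) / 5 * (2.4674 * (p - 2.773) ^ 2) +
      (p ^ 2 + 4) * (p ^ 2 - 1) ^ 2 / (1.8 * p ^ 2 + 18.45) := by
  have h1 : 2.02 * p ^ 2 - 5.33 ≤ (p ^ 2 + 4) * (p ^ 2 - 1) ^ 2 / (1.8 * p ^ 2 + 18.45) := by
    rw [le_div_iff₀ (by positivity)]
    nlinarith [sq_nonneg (p ^ 2 - 4), mul_nonneg (sq_nonneg p) (sq_nonneg (p ^ 2 - 4))]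
  nlinarith [sq_nonneg (p ^ 2 - 2.773 * p + 1.2), sq_nonneg (p - 2.16)]

/-- The bound (Y+1)² ≤ 1.8 Y² + 2.25, an equality at Y = 5/4, removes the odd power of Y; inserting
5Y² ≥ P + 4 gives the denominator. -/
theorem cross_frac_le {P Y R : ℝ} (hP : 0 ≤ P) (hY : 0 ≤ Y) (hV : P + 4 ≤ 5 * Y ^ 2) (hR : 0 ≤ R) :
    (P + 4) * R / (1.8 * P + 18.45) ≤ Y ^ 2 * (R / (Y + 1) ^ 2) := by
  have h8 : (Y + 1) ^ 2 ≤ 1.8 * Y ^ 2 + 2.25 := by nlinarith [sq_nonneg (Y - 1.25)]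
  have h7 : (P + 4) * (Y + 1) ^ 2 ≤ Y ^ 2 * (1.8 * P + 18.45) := by
    have := mul_le_mul_of_nonneg_left h8 (by linarith : 0 ≤ P + 4)
    linarith
  rw [mul_div_assoc', div_le_div_iff₀ (by positivity) (by positivity)]
  have := mul_le_mul_of_nonneg_right h7 hR
  linarith

/-- The scaled abscissa q increases with s: q² ≥ 400/52 from s = 16/9 on and q² ≥ 10 from s = 4 on,
whence 2.773 and 3.162. For s < 4 the smaller q is compensated by Y² ≥ (P+4)/5 and s/(1+s) ≤ 4/5. -/
theorem cross_scaled {s p q Y : ℝ} (hs : 16 / 9 ≤ s) (hq0 : 0 ≤ q)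
    (hq : q ^ 2 * (s + 4) = 16 * (1 + s)) (hY0 : 0 ≤ Y)
    (hY : Y ^ 2 * (1 + s) = p ^ 2 + s) :
    (1 + s) * p ^ 2 + s ≤ (p ^ 2 + s) * (2.4674 * (p - q) ^ 2 +
      (p ^ 2 - 1) ^ 2 / (Y + 1) ^ 2) := by
  have hq1 : 2.773 ≤ q := by
    by_contra! h
    have : q ^ 2 < 7.69 := by nlinarith
    nlinarith
  set P := p ^ 2 with hPd
  have hP : 0 ≤ P := sq_nonneg p
  have hD0 : 0 ≤ (P - 1) ^ 2 / (Y + 1) ^ 2 := by positivity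
  rcases le_or_gt P 1 with h1 | h1
  · have hp1 : p ≤ 1 := by nlinarith
    have h2 : 3 ≤ (p - q) ^ 2 := by nlinarith
    nlinarith
  have hw : 0 < 1 + s := by linarith
  have hV : Y ^ 2 = (P + s) / (1 + s) := by rw [eq_div_iff hw.ne', hY]
  have hY1 : 1 ≤ Y ^ 2 := by rw [hV, one_le_div hw]; linarith
  have hY1' : 1 ≤ Y := by nlinarith
  have hfrac : (P - 1) ^ 2 / 4 ≤ Y ^ 2 * ((P - 1) ^ 2 / (Y + 1) ^ 2) := by
    rw [mul_div_assoc', div_le_div_iff₀ (by norm_num) (by positivity)]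
    have : (Y + 1) ^ 2 ≤ 4 * Y ^ 2 := by nlinarith
    nlinarith [sq_nonneg (P - 1)]
  suffices h : P + s / (1 + s) ≤ Y ^ 2 * (2.4674 * (p - q) ^ 2) +
      Y ^ 2 * ((P - 1) ^ 2 / (Y + 1) ^ 2) by
    have e : (1 + s) * P + s = (1 + s) * (P + s / (1 + s)) := by field_simp
    rw [e, ← hY]
    calc _ ≤ (1 + s) * (Y ^ 2 * (2.4674 * (p - q) ^ 2) +
      Y ^ 2 * ((P - 1) ^ 2 / (Y + 1) ^ 2)) := by gcongr
      _ = _ := by ring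
  have hs1 : s / (1 + s) ≤ 1 := by rw [div_le_one hw]; linarith
  have hQ0 : 0 ≤ Y ^ 2 * (2.4674 * (p - q) ^ 2) := by positivity
  rcases le_or_gt 6.5 P with h2 | h2
  · have : P + 1 ≤ (P - 1) ^ 2 / 4 := by nlinarith
    linarith
  have hp : p ≤ 2.55 := by nlinarith
  rcases le_or_gt 4 s with h3 | h3
  · have hq2 : 3.162 ≤ q := by
      by_contra! h
      have : q ^ 2 < 9.999 := by nlinarith
      nlinarith
    have h4 : (p - 3.162) ^ 2 ≤ (p - q) ^ 2 := by
      have := mul_nonneg (sub_nonneg.2 hq2) (by linarith : 0 ≤ q + 3.162 - 2 * p)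
      linarith
    have h5 : 1 * (2.4674 * (p - 3.162) ^ 2) ≤ Y ^ 2 * (2.4674 * (p - q) ^ 2) := by gcongr
    have := cross_poly_far p
    rw [← hPd] at this
    linarith
  · have h4 : (p - 2.773) ^ 2 ≤ (p - q) ^ 2 := by
      have := mul_nonneg (sub_nonneg.2 hq1) (by linarith : 0 ≤ q + 2.773 - 2 * p)
      linarith
    have hV0 : (P + 4) / 5 ≤ Y ^ 2 := by
      rw [hV, div_le_div_iff₀ (by norm_num) hw]; nlinarith
    have h5 : (P + 4) / 5 * (2.4674 * (p - 2.773) ^ 2) ≤ Y ^ 2 * (2.4674 * (p - q) ^ 2) := by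
      gcongr
    have h6 : (P + 4) * (P - 1) ^ 2 / (1.8 * P + 18.45) ≤ Y ^ 2 * ((P - 1) ^ 2 / (Y + 1) ^ 2) := by
      exact cross_frac_le hP hY0 (by linarith) (sq_nonneg _)
    have h7 : s / (1 + s) ≤ 0.8 := by rw [div_le_iff₀ hw]; linarith
    have hp1 : 1 ≤ p ∨ 1 ≤ -p := le_abs.1 ((one_le_sq_iff_one_le_abs p).1 h1.le)
    rcases hp1 with h8 | h8
    · have := cross_poly_near h8
      rw [← hPd] at this
      linarith
    · have h9 : 3 ^ 2 ≤ (q - p) ^ 2 := pow_le_pow_left₀ (by norm_num) (by linarith) 2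
      have h10 : 1 * (2.4674 * 3 ^ 2) ≤ Y ^ 2 * (2.4674 * (q - p) ^ 2) := by gcongr
      have h11 : (q - p) ^ 2 = (p - q) ^ 2 := by ring
      rw [h11] at h10
      have := sq_nonneg (P - 1)
      linarith

/-- Jordan's inequality sin θ ≥ 2θ/π, on either side of the zero Y = 1. -/
theorem abs_sub_one_le_abs_cos {Y : ℝ} (h0 : 0 ≤ Y) (h2 : Y ≤ 2) :
    (Y - 1) ^ 2 ≤ cos (π / 2 * Y) ^ 2 := by
  have key : ∀ y : ℝ, 0 ≤ y → y ≤ 1 → y ≤ sin (π / 2 * y) := by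
    intro y h3 h4
    have := mul_le_sin (x := π / 2 * y) (by positivity) (by nlinarith [pi_pos])
    have e : 2 / π * (π / 2 * y) = y := by field_simp
    rwa [e] at this
  rcases le_or_gt Y 1 with h | h
  · have := key (1 - Y) (by linarith) (by linarith)
    rw [show π / 2 * (1 - Y) = π / 2 - π / 2 * Y by ring, sin_pi_div_two_sub] at this
    nlinarith
  · have := key (Y - 1) (by linarith) (by linarith)
    rw [show π / 2 * (Y - 1) = π / 2 * Y - π / 2 by ring, sin_sub_pi_div_two] at this
    nlinarith

/-- The line with twice the tangent of the pole passes over c at height at most 2. Where Y > 2, the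
excess Y - 2 is at most the rise from X = c and the slope argument applies. Where Y ≤ 2, Jordan's
inequality leads to `cross_scaled`. Compared with the line at height exactly 2, this gives a smaller
W for poles that are not close. -/
theorem lineBound_double {T c : ℝ} (hT : 2 / 3 ≤ T) (hc0 : 0 ≤ c)
    (hc : c ^ 2 * (T ^ 2 * (1 + T ^ 2)) = 1) : LineBound (2 * T) c (1 + (2 * T) ^ 2) := by
  have ht : 0 < 2 * T := by linarith
  set t := 2 * T
  set s := t ^ 2 with hsd
  have hs : 16 / 9 ≤ s := by simp only [s, t]; nlinarith
  have hcs : c ^ 2 * (s * (4 + s)) = 16 := by simp only [s, t]; nlinarith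
  set w := 1 + s with hw
  have hw0 : 0 < w := by linarith
  intro X
  set C := 1 / w + X ^ 2 with hC
  have hCp : 0 < C := by positivity
  rcases le_or_gt (t * √C) 2 with h2 | h2
  · set r := √w
    have hr : r ^ 2 = w := sq_sqrt hw0.le
    have hY0 : 0 ≤ t * √C := by positivity
    set Y := t * √C
    have hY : Y ^ 2 = s * C := by simp only [Y]; rw [mul_pow, sq_sqrt hCp.le]
    set p := t * r * X with hp
    set q := t * r * c with hq
    have e1 : Y ^ 2 * w = p ^ 2 + s := by
      rw [hY, hC, hp, mul_pow, mul_pow, hr]; field_simp; ring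
    have hqs : q ^ 2 * (s + 4) = 16 * (1 + s) := by
      rw [hq, mul_pow, mul_pow, hr, ← hsd, ← hw]; linear_combination w * hcs
    have h3 := cross_scaled (p := p) hs (by positivity) hqs hY0 e1
    have hcos := abs_sub_one_le_abs_cos hY0 h2
    have hfr : (p ^ 2 - 1) ^ 2 / (Y + 1) ^ 2 = w ^ 2 * (Y - 1) ^ 2 := by
      rw [div_eq_iff (by positivity)]
      have : p ^ 2 - 1 = w * (Y ^ 2 - 1) := by linear_combination -e1 + hw
      rw [this]; ring
    rw [hfr] at h3
    have hS : 2.4674 * (X - c) ^ 2 ≤ sinh (π / 2 * (X - c)) ^ 2 := by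
      refine le_trans ?_ (sq_le_sinh_sq _)
      rw [mul_pow]
      have := pi_sq_bounds.1
      gcongr
      linarith
    set S := sinh (π / 2 * (X - c)) ^ 2
    rw [cosh_sq]
    have e2 : (p - q) ^ 2 = s * w * (X - c) ^ 2 := by
      rw [hp, hq, show t * r * X - t * r * c = t * r * (X - c) by ring, mul_pow, mul_pow, hr]
    have e3 : w * p ^ 2 + s = s * w * (C + s * X ^ 2) := by
      rw [hC, hp, mul_pow, mul_pow, hr, hw]; field_simp; ring
    have e4 : p ^ 2 + s = s * w * C := by rw [← e1, hY]; ring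
    rw [← hw, e3, e4, e2] at h3
    have h4 : C + s * X ^ 2 ≤ w * C * s * S + w ^ 2 * C * cos (π / 2 * Y) ^ 2 := by
      refine le_of_mul_le_mul_left (h3.trans ?_) (by positivity : 0 < s * w)
      calc _ = s * w * (w * C * s * (2.4674 * (X - c) ^ 2) + w ^ 2 * C * (Y - 1) ^ 2) := by ring
        _ ≤ _ := by gcongr
    have h5 : (C + s * X ^ 2) * S ≤ w * C * S := by
      have : C + s * X ^ 2 ≤ w * C := by
        have : w * C = C + s * X ^ 2 + s / w := by rw [hC, hw]; field_simp; ring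
        rw [this]
        have : 0 ≤ s / w := by positivity
        linarith
      exact mul_le_mul_of_nonneg_right this (sq_nonneg _)
    calc _ = (C + s * X ^ 2) * S + (C + s * X ^ 2) := by ring
      _ ≤ w * C * S + (w * C * s * S + w ^ 2 * C * cos (π / 2 * Y) ^ 2) := add_le_add h5 h4
      _ = _ := by rw [hw]; ring
  · have hlip := sqrt_line_sub_le (t := t) (c := c) (X := X) ht.le
    rw [← hsd, ← hw, ← hC] at hlip
    have hYc : t * √(1 / w + c ^ 2) ≤ 2 := by
      have h3 : (t * √(1 / w + c ^ 2)) ^ 2 ≤ 2 ^ 2 := by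
        rw [mul_pow, sq_sqrt (by positivity), ← hsd]
        have e : s * c ^ 2 = 16 / (4 + s) := by
          rw [eq_div_iff (by positivity)]; linear_combination hcs
        rw [mul_add, e, mul_one_div, div_add_div _ _ hw0.ne' (by positivity),
          div_le_iff₀ (by positivity), hw]
        nlinarith
      exact (sq_le_sq₀ (by positivity) (by norm_num)).1 h3
    have := lineBound_at_of_abs_le (t := t) (c := c) (X := X) (by
      rw [← hsd, ← hw, ← hC, abs_of_pos (by linarith)]
      have := le_abs_self (t * √C - t * √(1 / w + c ^ 2))
      linarith)
    simpa only [← hsd, ← hw, ← hC] using this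

/-! ### Location of the poles -/

theorem eq_of_cDen_eq_zero {c : ℝ} {z : ℂ} (hz : cDen c z = 0) :
    sinh z.re * cos z.im = c ∧ ∃ n : ℤ, cosh z.re * sin z.im = 2 * n + 1 := by
  have h1 : Complex.exp (π * (Complex.sinh z - c)) = Complex.exp (π * Complex.I) := by
    rw [Complex.exp_pi_mul_I]
    unfold cDen at hz
    linear_combination hz
  obtain ⟨n, hn⟩ := Complex.exp_eq_exp_iff_exists_int.1 h1
  have h2 : Complex.sinh z = (c : ℂ) + ((2 * n + 1 : ℝ) : ℂ) * Complex.I := by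
    have hpi : (π : ℂ) ≠ 0 := by exact_mod_cast pi_ne_zero
    refine mul_left_cancel₀ hpi ?_
    push_cast
    linear_combination hn
  have h3 := sinh_line z.re z.im
  rw [Complex.re_add_im, h2] at h3
  have hre := congrArg Complex.re h3
  have him := congrArg Complex.im h3
  simp only [Complex.add_re, Complex.ofReal_re, Complex.re_ofReal_mul, Complex.I_re, mul_zero,
    add_zero] at hre
  simp only [Complex.add_im, Complex.ofReal_im, Complex.im_ofReal_mul, Complex.I_im, mul_one,
    zero_add] at him
  exact ⟨hre.symm, n, him.symm⟩

/-- Squared height of the image of the line `Im z = arctan u` at the abscissa `c`. -/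
def poleFn (c u : ℝ) : ℝ := u ^ 2 / (1 + u ^ 2) + c ^ 2 * u ^ 2

theorem poleFn_strictMono (c : ℝ) : StrictMonoOn (poleFn c) (Ici 0) := by
  intro a ha b hb hab
  have ha0 : 0 ≤ a := ha
  have h1 : a ^ 2 < b ^ 2 := by gcongr
  unfold poleFn
  refine add_lt_add_of_lt_of_le ?_ (by gcongr)
  rw [div_lt_div_iff₀ (by positivity) (by positivity)]
  linarith

/-- At a pole of height arctan u the function `poleFn c` takes the square of an odd integer. As it
is increasing, the value 1 singles out the first pole, and every other pole in the upper strip needs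
a value of at least 9. -/
theorem poleFn_of_cDen_eq_zero {c t : ℝ} {z : ℂ} (h0 : 0 ≤ z.im) (ht : z.im ≤ arctan t)
    (hz : cDen c z = 0) : ∃ u n : ℝ, 0 < u ∧ u ≤ t ∧ z.im = arctan u ∧ poleFn c u = n ^ 2 ∧
      sinh z.re = c * √(1 + u ^ 2) ∧ (n = 1 ∨ 3 ≤ n) := by
  obtain ⟨h1, k, h2⟩ := eq_of_cDen_eq_zero hz
  have hlt : z.im < π / 2 := ht.trans_lt (arctan_lt_pi_div_two t)
  have hcos : 0 < cos z.im := cos_pos_of_mem_Ioo ⟨by linarith [pi_pos], hlt⟩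
  have him : z.im = arctan (tan z.im) := (arctan_tan (by linarith [pi_pos]) hlt).symm
  set u := tan z.im with hu
  have hu0 : 0 ≤ u := tan_nonneg_of_nonneg_of_le_pi_div_two h0 hlt.le
  have hut : u ≤ t := by rw [him] at ht; exact arctan_strictMono.le_iff_le.1 ht
  have hcu : cos z.im ^ 2 = 1 / (1 + u ^ 2) := by rw [him]; exact cos_sq_arctan' u
  have hsu : sin z.im = u * cos z.im := by rw [hu, tan_mul_cos hcos.ne']
  have hinv : cos z.im = 1 / √(1 + u ^ 2) := by rw [him]; exact cos_arctan u
  have hs : sinh z.re = c * √(1 + u ^ 2) := by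
    rw [← h1, hinv]
    have : √(1 + u ^ 2) ≠ 0 := by positivity
    field_simp
  have hpf : poleFn c u = (2 * k + 1 : ℝ) ^ 2 := by
    rw [← h2, mul_pow, cosh_sq, hs, hsu, mul_pow, mul_pow, sq_sqrt (by positivity), hcu]
    unfold poleFn
    field_simp
    ring
  have hk : 0 ≤ k := by
    have h3 : 0 ≤ cosh z.re * sin z.im := by
      rw [hsu]; have := cosh_pos z.re; positivity
    rw [h2] at h3
    by_contra! hk
    have : (k : ℝ) ≤ -1 := by exact_mod_cast Int.le_sub_one_of_lt hk
    linarith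
  refine ⟨u, 2 * k + 1, hu0.lt_of_ne ?_, hut, him, hpf, hs, ?_⟩
  · intro h
    have : poleFn c u = 0 := by unfold poleFn; rw [← h]; simp
    rw [hpf] at this
    have h4 : (0 : ℝ) ≤ k := by exact_mod_cast hk
    nlinarith
  · rcases hk.eq_or_lt with h | h
    · left; rw [← h]; simp
    · right
      have : (1 : ℝ) ≤ k := by exact_mod_cast h
      linarith

theorem cDen_ne_zero_of_poleFn_lt {c t : ℝ} (ht : 0 ≤ t) (h : poleFn c t < 1) (z : ℂ)
    (h0 : 0 ≤ z.im) (h1 : z.im ≤ arctan t) : cDen c z ≠ 0 := by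
  intro hz
  obtain ⟨u, n, hu, hut, -, hp, -, hn⟩ := poleFn_of_cDen_eq_zero h0 h1 hz
  have := (poleFn_strictMono c).monotoneOn hu.le ht hut
  rcases hn with rfl | hn <;> nlinarith

theorem sinh_pole {c T : ℝ} (hT : 0 < T) (h : poleFn c T = 1) :
    Complex.sinh (arsinh (c * √(1 + T ^ 2)) + arctan T * Complex.I) = c + Complex.I := by
  rw [sinh_line, sinh_arsinh]
  have hs : √(1 + T ^ 2) ≠ 0 := by positivity
  have e1 : c * √(1 + T ^ 2) * cos (arctan T) = c := by
    rw [cos_arctan]; field_simp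
  have e2 : cosh (arsinh (c * √(1 + T ^ 2))) * sin (arctan T) = 1 := by
    have hp : 0 ≤ cosh (arsinh (c * √(1 + T ^ 2))) * sin (arctan T) := by
      rw [sin_arctan]; have := cosh_pos (arsinh (c * √(1 + T ^ 2))); positivity
    rw [← sq_eq_sq₀ hp zero_le_one, one_pow]
    refine Eq.trans ?_ h
    rw [mul_pow, cosh_sq, sinh_arsinh, sin_arctan_eq,
      mul_pow, mul_pow, cos_sq_arctan', sq_sqrt (by positivity)]
    unfold poleFn
    field_simp
    ring
  rw [e1, e2, Complex.ofReal_one, one_mul]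

theorem cDen_ne_zero_of_ne_pole {c t T : ℝ} (hT : 0 < T) (h : poleFn c T = 1) (ht : 0 ≤ t)
    (h9 : poleFn c t < 9) (z : ℂ) (h0 : 0 ≤ z.im) (h1 : z.im ≤ arctan t)
    (hne : z ≠ arsinh (c * √(1 + T ^ 2)) + arctan T * Complex.I) : cDen c z ≠ 0 := by
  intro hz
  obtain ⟨u, n, hu, hut, him, hp, hs, hn⟩ := poleFn_of_cDen_eq_zero h0 h1 hz
  have hm := (poleFn_strictMono c).monotoneOn hu.le ht hut
  rcases hn with rfl | hn
  · have : u = T := (poleFn_strictMono c).injOn hu.le hT.le (by rw [hp, h, one_pow])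
    subst this
    apply hne
    rw [← hs, arsinh_sinh, ← him, Complex.re_add_im]
  · nlinarith

/-! ### Decay bounds obtained from each line -/

section Bounds

variable {α c L : ℝ}

theorem norm_oscInt_zero_le (h0 : 0 < α) (h1 : α < 1) (hL : 0 ≤ L) {t : ℝ} (ht : 0 < t) :
    ‖oscInt α 0 L‖ ≤ √(1 + t ^ 2) ^ 3 / 2 * exp (-(L * arctan t)) * ∫ v, logi α v :=
  norm_oscInt_le_of_lineBound h0 h1 ht.le hL (by positivity) (lineBound_center ht)
    (cDen_ne_zero_of_poleFn_lt ht.le (by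
      unfold poleFn
      rw [zero_pow two_ne_zero, zero_mul, add_zero, div_lt_one (by positivity)]
      linarith))

theorem norm_oscInt_le_direct (h0 : 0 < α) (h1 : α < 1) (hL : 0 ≤ L) {t : ℝ} (ht : 0 < t)
    (hc : 0 ≤ c) (hq : t * √(1 + t ^ 2) * c ≤ 0.48) :
    ‖oscInt α c L‖ ≤ √(1 + t ^ 2) ^ 3 * exp (-(L * arctan t)) * ∫ v, logi α v := by
  have := norm_oscInt_le_of_lineBound h0 h1 ht.le hL (by positivity) (lineBound_direct ht hc hq)
    (cDen_ne_zero_of_poleFn_lt ht.le (by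
      unfold poleFn
      have h2 : (t * √(1 + t ^ 2) * c) ^ 2 ≤ 0.48 ^ 2 := by gcongr
      rw [mul_pow, mul_pow, sq_sqrt (by positivity)] at h2
      rw [← lt_sub_iff_add_lt, div_lt_iff₀ (by positivity)]
      linarith))
  rwa [mul_div_cancel_left₀ _ (two_ne_zero' ℝ)] at this

theorem poleFn_eq_one {T : ℝ} (h : c ^ 2 * (T ^ 2 * (1 + T ^ 2)) = 1) : poleFn c T = 1 := by
  unfold poleFn
  have : 1 + T ^ 2 ≠ 0 := by positivity
  field_simp
  linear_combination h

theorem poleFn_two_mul_le {T : ℝ} (h : c ^ 2 * (T ^ 2 * (1 + T ^ 2)) = 1) :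
    poleFn c (2 * T) ≤ 4 := by
  have e : c ^ 2 * (2 * T) ^ 2 = 4 / (1 + T ^ 2) := by
    rw [eq_div_iff (by positivity)]; linear_combination 4 * h
  unfold poleFn
  rw [e, div_add_div _ _ (by positivity) (by positivity), div_le_iff₀ (by positivity)]
  nlinarith [sq_nonneg T, sq_nonneg (T ^ 2)]

theorem norm_oscInt_le_pole_of_lineBound (h0 : 0 < α) (h1 : α < 1) (hL : 0 ≤ L) {t T W : ℝ}
    (hT : 0 < T) (h : c ^ 2 * (T ^ 2 * (1 + T ^ 2)) = 1) (hTt : T < t) (h9 : poleFn c t < 9)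
    (hW : 0 ≤ W) (hLB : LineBound t c W) :
    ‖oscInt α c L‖ ≤ π * exp (-(L * arctan T)) +
      W / 2 * exp (-(L * arctan t)) * ∫ v, logi α v :=
  norm_oscInt_le_of_cross h0 h1 hL hW hLB (arctan_pos.2 hT)
    (arctan_strictMono hTt) (sinh_pole hT (poleFn_eq_one h))
    (cDen_ne_zero_of_ne_pole hT (poleFn_eq_one h) (hT.trans hTt).le h9)

/-- Crossing the first pole, for all distances of the pole. -/
theorem norm_oscInt_le_pole (h0 : 0 < α) (h1 : α < 1) (hL : 0 ≤ L) {T : ℝ}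
    (hT : 0 < T) (h : c ^ 2 * (T ^ 2 * (1 + T ^ 2)) = 1) :
    ‖oscInt α c L‖ ≤ π * exp (-(L * arctan T)) +
      (1 + 2 * T ^ 2) ^ 2 / 2 * exp (-(L * arctan (2 * T))) * ∫ v, logi α v := by
  have hcont : ContinuousOn (poleFn c) (Icc (2 * T) (2 * T * √(1 + T ^ 2))) := by
    unfold poleFn
    refine ContinuousOn.add (ContinuousOn.div (by fun_prop) (by fun_prop) ?_) (by fun_prop)
    intro x _; positivity
  have hsq : (2 * T * √(1 + T ^ 2)) ^ 2 = 4 * (T ^ 2 * (1 + T ^ 2)) := by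
    rw [mul_pow, sq_sqrt (by positivity)]; ring
  have hle : 2 * T ≤ 2 * T * √(1 + T ^ 2) :=
    le_mul_of_one_le_right (by positivity) (one_le_sqrt.2 (by nlinarith [sq_nonneg T]))
  -- The squared height over c is at most 4 at 2T and at least 4 at 2T√(1+T²). The lower end gives
  -- the exponent, the upper end gives 1 + t² ≤ (1 + 2T²)².
  obtain ⟨t, ⟨ht1, ht2⟩, ht⟩ := intermediate_value_Icc hle hcont ⟨poleFn_two_mul_le h, by
    unfold poleFn
    rw [hsq]
    have : 0 ≤ 4 * (T ^ 2 * (1 + T ^ 2)) / (1 + 4 * (T ^ 2 * (1 + T ^ 2))) := by positivity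
    linarith⟩
  have htp : 0 < t := by linarith
  have hLB : LineBound t c (1 + t ^ 2) := by
    refine lineBound_cross htp.le ?_
    rw [← sq_eq_sq₀ (by positivity) (by norm_num), mul_pow, sq_sqrt (by positivity)]
    unfold poleFn at ht
    linear_combination ht
  refine (norm_oscInt_le_pole_of_lineBound h0 h1 hL hT h (by linarith) (by linarith)
    (by positivity) hLB).trans ?_
  have hI := integral_logi_nonneg α
  have hW : 1 + t ^ 2 ≤ (1 + 2 * T ^ 2) ^ 2 := by
    have : t ^ 2 ≤ (2 * T * √(1 + T ^ 2)) ^ 2 := by gcongr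
    rw [hsq] at this
    linarith
  have harc := arctan_strictMono.monotone ht1
  gcongr

/-- Crossing the first pole when it is not close to the real axis. -/
theorem norm_oscInt_le_pole' (h0 : 0 < α) (h1 : α < 1) (hL : 0 ≤ L) {T : ℝ}
    (hT : 2 / 3 ≤ T) (hc : 0 ≤ c) (h : c ^ 2 * (T ^ 2 * (1 + T ^ 2)) = 1) :
    ‖oscInt α c L‖ ≤ π * exp (-(L * arctan T)) +
      (1 + 4 * T ^ 2) / 2 * exp (-(L * arctan (2 * T))) * ∫ v, logi α v := by
  have := norm_oscInt_le_pole_of_lineBound (α := α) (L := L) h0 h1 hL (by linarith) h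
    (by linarith : T < 2 * T) ((poleFn_two_mul_le h).trans_lt (by norm_num)) (by positivity)
    (lineBound_double hT hc h)
  rwa [show (2 * T) ^ 2 = 4 * T ^ 2 by ring] at this

end Bounds

/-! ### Bounds for arctan, for exponentials and for the target `kap` -/

/-- For this and the next two Padé approximants, the difference of derivatives, over a common
denominator, is a positive multiple of x⁴, x⁶ and x⁸ with the sign required. -/
theorem pade_le_arctan {u : ℝ} (hu : 0 ≤ u) : 3 * u / (3 + u ^ 2) ≤ arctan u := by
  refine le_of_hasDerivAt_le (f := fun u => 3 * u / (3 + u ^ 2))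
    (f' := fun u => 3 * (3 - u ^ 2) / (3 + u ^ 2) ^ 2) (fun x => ?_) (fun x => hasDerivAt_arctan x)
    (by simp) (fun x _ => ?_) hu
  · have h0 : 3 + x ^ 2 ≠ 0 := by positivity
    refine (((hasDerivAt_id x).const_mul 3).div ((hasDerivAt_pow 2 x).const_add 3) h0).congr_deriv ?_
    simp only [id]; push_cast; ring
  · rw [div_le_div_iff₀ (by positivity) (by positivity)]
    nlinarith [pow_nonneg (sq_nonneg x) 2]

theorem arctan_le_pade {u : ℝ} (hu : 0 ≤ u) :
    arctan u ≤ u * (15 + 4 * u ^ 2) / (15 + 9 * u ^ 2) := by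
  refine le_of_hasDerivAt_le (g := fun u => u * (15 + 4 * u ^ 2) / (15 + 9 * u ^ 2))
    (g' := fun u => ((15 + 12 * u ^ 2) * (15 + 9 * u ^ 2) - (15 * u + 4 * u ^ 3) * (18 * u)) /
      (15 + 9 * u ^ 2) ^ 2) (fun x => hasDerivAt_arctan x) (fun x => ?_)
    (by simp) (fun x _ => ?_) hu
  · have h0 : 15 + 9 * x ^ 2 ≠ 0 := by positivity
    refine (((hasDerivAt_id x).mul (((hasDerivAt_pow 2 x).const_mul 4).const_add 15)).div
      (((hasDerivAt_pow 2 x).const_mul 9).const_add 15) h0).congr_deriv ?_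
    simp only [id, Pi.mul_apply]; push_cast; ring
  · rw [div_le_div_iff₀ (by positivity) (by positivity)]
    nlinarith [pow_nonneg (sq_nonneg x) 3]

theorem pade_le_arctan' {u : ℝ} (hu : 0 ≤ u) :
    u * (105 + 55 * u ^ 2) / (105 + 90 * u ^ 2 + 9 * u ^ 4) ≤ arctan u := by
  refine le_of_hasDerivAt_le (f := fun u => u * (105 + 55 * u ^ 2) / (105 + 90 * u ^ 2 + 9 * u ^ 4))
    (f' := fun u => ((105 + 165 * u ^ 2) * (105 + 90 * u ^ 2 + 9 * u ^ 4) -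
      (105 * u + 55 * u ^ 3) * (180 * u + 36 * u ^ 3)) / (105 + 90 * u ^ 2 + 9 * u ^ 4) ^ 2)
    (fun x => ?_) (fun x => hasDerivAt_arctan x)
    (by simp) (fun x _ => ?_) hu
  · have h0 : 105 + 90 * x ^ 2 + 9 * x ^ 4 ≠ 0 := by positivity
    refine (((hasDerivAt_id x).mul (((hasDerivAt_pow 2 x).const_mul 55).const_add 105)).div
      ((((hasDerivAt_pow 2 x).const_mul 90).const_add 105).add ((hasDerivAt_pow 4 x).const_mul 9))
      h0).congr_deriv ?_
    simp only [id, Pi.mul_apply, Pi.add_apply]; push_cast; ring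
  · rw [div_le_div_iff₀ (by positivity) (by positivity)]
    nlinarith [pow_nonneg (sq_nonneg x) 4]

theorem exp_neg_le_of_one_le {a r : ℝ} (ha : 0 ≤ a)
    (h : 1 ≤ r * (1 + a + a ^ 2 / 2 + a ^ 3 / 6 + a ^ 4 / 24 + a ^ 5 / 120)) : exp (-a) ≤ r := by
  have h1 := sum_le_exp_of_nonneg ha 6
  norm_num [Finset.sum_range_succ, Nat.factorial] at h1
  have h2 : 0 < 1 + a + a ^ 2 / 2 + a ^ 3 / 6 + a ^ 4 / 24 + a ^ 5 / 120 := by positivity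
  have hr : 0 ≤ r := by
    by_contra! hr
    nlinarith
  rw [exp_neg, inv_le_iff_one_le_mul₀ (exp_pos a)]
  exact h.trans (mul_le_mul_of_nonneg_left h1 hr)

theorem exp_six_fifths_le : exp (6 / 5) ≤ 3.33 := by
  refine le_of_pow_le_pow_left₀ (n := 5) (by norm_num) (by norm_num) ?_
  rw [← exp_nat_mul]
  have h : ((5 : ℕ) : ℝ) * (6 / 5) = (6 : ℕ) * 1 := by norm_num
  rw [h, exp_nat_mul]
  calc exp 1 ^ 6 ≤ 2.7182818286 ^ 6 := by
        gcongr
        exact exp_one_lt_d9.le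
    _ ≤ _ := by norm_num

theorem hasDerivAt_logMod (a u : ℝ) :
    HasDerivAt (fun u => log (1 + u ^ 2) - a * arctan u) ((2 * u - a) / (1 + u ^ 2)) u := by
  have h0 : 1 + u ^ 2 ≠ 0 := by positivity
  refine ((((hasDerivAt_pow 2 u).const_add 1).log h0).sub
    ((hasDerivAt_arctan u).const_mul a)).congr_deriv ?_
  push_cast; field_simp

theorem logMod_mono {a u v : ℝ} (hu : a ≤ 2 * u) (huv : u ≤ v) :
    log (1 + u ^ 2) - a * arctan u ≤ log (1 + v ^ 2) - a * arctan v := by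
  have hm : MonotoneOn (fun u => log (1 + u ^ 2) - a * arctan u) (Ici (a / 2)) := by
    refine monotoneOn_of_deriv_nonneg (convex_Ici _)
      (fun x _ => (hasDerivAt_logMod a x).continuousAt.continuousWithinAt)
      (fun x _ => (hasDerivAt_logMod a x).differentiableAt.differentiableWithinAt) fun x hx => ?_
    rw [interior_Ici, mem_Ioi] at hx
    rw [(hasDerivAt_logMod a x).deriv]
    exact div_nonneg (by linarith) (by positivity)
  exact hm (by rw [mem_Ici]; linarith) (by rw [mem_Ici]; linarith) huv

theorem logMod_anti {a u v : ℝ} (hv : 2 * v ≤ a) (huv : u ≤ v) :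
    log (1 + v ^ 2) - a * arctan v ≤ log (1 + u ^ 2) - a * arctan u := by
  have hm : AntitoneOn (fun u => log (1 + u ^ 2) - a * arctan u) (Iic (a / 2)) := by
    refine antitoneOn_of_deriv_nonpos (convex_Iic _)
      (fun x _ => (hasDerivAt_logMod a x).continuousAt.continuousWithinAt)
      (fun x _ => (hasDerivAt_logMod a x).differentiableAt.differentiableWithinAt) fun x hx => ?_
    rw [interior_Iic, mem_Iio] at hx
    rw [(hasDerivAt_logMod a x).deriv]
    exact div_nonpos_of_nonpos_of_nonneg (by linarith) (by positivity)
  exact hm (by rw [mem_Iic]; linarith) (by rw [mem_Iic]; linarith) huv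

/-- `K(d) e^{-Ld}` for `d = arctan t` and `K(d) = 1 / cos³ d`. -/
def kap (L t : ℝ) : ℝ := √(1 + t ^ 2) ^ 3 * exp (-(L * arctan t))

theorem kap_pos (L t : ℝ) : 0 < kap L t := by unfold kap; positivity

theorem kap_eq (L t : ℝ) :
    kap L t = exp (3 / 2 * (log (1 + t ^ 2) - 2 * L / 3 * arctan t)) := by
  have h1 : √(1 + t ^ 2) = exp (1 / 2 * log (1 + t ^ 2)) := by
    rw [one_div_mul_eq_div, ← log_sqrt (by positivity), exp_log (by positivity)]
  unfold kap
  rw [h1, ← exp_nat_mul, ← exp_add]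
  congr 1
  push_cast; ring

theorem kap_anti {L t u : ℝ} (hu : 3 * u ≤ L) (htu : t ≤ u) : kap L u ≤ kap L t := by
  rw [kap_eq, kap_eq]
  have := logMod_anti (a := 2 * L / 3) (by linarith) htu
  gcongr

theorem kap_mono {L t u : ℝ} (hu : L ≤ 3 * t) (htu : t ≤ u) : kap L t ≤ kap L u := by
  rw [kap_eq, kap_eq]
  have := logMod_mono (a := 2 * L / 3) (by linarith) htu
  gcongr

/-- The derivative of log `kap L` has the sign of 3t - L, so on t ≤ T the minimum is at min(L/3, T).
The main bound has to be proved only there. -/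
theorem kap_min_le (L : ℝ) {t T : ℝ} (htT : t ≤ T) : kap L (min (L / 3) T) ≤ kap L t := by
  rcases le_total t (L / 3) with h | h
  · exact kap_anti (by linarith [min_le_left (L / 3) T]) (le_min h htT)
  · rw [min_eq_left (h.trans htT)]
    exact kap_mono (by linarith) h

theorem kap_le_of_le {L L' t : ℝ} (ht : 0 ≤ t) (h : L ≤ L') : kap L' t ≤ kap L t := by
  unfold kap
  have := arctan_nonneg.2 ht
  gcongr

/-- The tangent at w = m² of the convex function w^(3/2). In its uses m is a decimal near √w. -/
theorem tangent_le_sqrt_cube {m w : ℝ} (hm : 0 ≤ m) (hw : 0 ≤ w) :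
    3 / 2 * m * w - m ^ 3 / 2 ≤ √w ^ 3 := by
  have h := sq_sqrt hw
  have h2 := sqrt_nonneg w
  set r := √w
  rw [← h]
  nlinarith [mul_nonneg (sq_nonneg (r - m)) (by positivity : 0 ≤ r + m / 2)]

/-- The worst case is L = 2, t = 2/3, with value about 0.535. -/
theorem half_le_kap {L t : ℝ} (ht : 0 ≤ t) (hL : L ≤ 2) : 1 / 2 ≤ kap L t := by
  refine le_trans ?_ (kap_le_of_le ht hL)
  have h0 : kap 2 (2 / 3) ≤ kap 2 t := by
    rcases le_total t (2 / 3) with h | h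
    · exact kap_anti (by norm_num) h
    · exact kap_mono (by norm_num) h
  refine le_trans ?_ h0
  have h1 : arctan (2 / 3) ≤ 3 / 5 :=
    (arctan_le_pade (by norm_num)).trans (by norm_num)
  have h2 := tangent_le_sqrt_cube (m := 6 / 5) (w := 1 + (2 / 3) ^ 2) (by norm_num) (by norm_num)
  have h3 : 1 / 3.33 ≤ exp (-(2 * arctan (2 / 3))) := by
    rw [exp_neg, ← one_div]
    refine one_div_le_one_div_of_le (exp_pos _) (le_trans ?_ exp_six_fifths_le)
    exact exp_le_exp.2 (by linarith)
  unfold kap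
  calc (1 / 2 : ℝ) ≤ (3 / 2 * (6 / 5) * (1 + (2 / 3) ^ 2) - (6 / 5) ^ 3 / 2) * (1 / 3.33) := by
        norm_num
    _ ≤ _ := by gcongr

/-- The worst case is L = 3, t = 1, with value about 0.268. -/
theorem quarter_le_kap {L t : ℝ} (ht : 0 ≤ t) (hL : L ≤ 3) : 1 / 4 ≤ kap L t := by
  refine le_trans ?_ (kap_le_of_le ht hL)
  have h0 : kap 3 1 ≤ kap 3 t := by
    rcases le_total t 1 with h | h
    · exact kap_anti (by norm_num) h
    · exact kap_mono (by norm_num) h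
  refine le_trans ?_ h0
  have h2 := tangent_le_sqrt_cube (m := 7 / 5) (w := 1 + 1 ^ 2) (by norm_num) (by norm_num)
  have h3 : 1 / 3.33 ^ 2 ≤ exp (-(3 * arctan 1)) := by
    rw [exp_neg, ← one_div]
    refine one_div_le_one_div_of_le (exp_pos _) ?_
    calc exp (3 * arctan 1) ≤ exp ((2 : ℕ) * (6 / 5)) := by
          refine exp_le_exp.2 ?_
          rw [arctan_one]
          have := pi_lt_d2
          norm_num
          linarith
      _ = exp (6 / 5) ^ 2 := exp_nat_mul _ _
      _ ≤ _ := by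
          have := exp_six_fifths_le
          gcongr
  unfold kap
  calc (1 / 4 : ℝ) ≤ (3 / 2 * (7 / 5) * (1 + 1 ^ 2) - (7 / 5) ^ 3 / 2) * (1 / 3.33 ^ 2) := by
        norm_num
    _ ≤ _ := by gcongr

/-! ### Eliminating α, and comparing decay at T and 2T -/

/-- Multiplied by q = α(1-α), the claim follows from one that is convex in q on [0, 1/4], once the
exponential is replaced by its chord 1 - 4q + 4q e^(-πc/4). Only the ends matter: q = 0 is A ≤ K,
and q = 1/4 is the last hypothesis. -/
theorem conv_bound {α c K A I e₀ : ℝ} (h0 : 0 < α) (h1 : α < 1) (hc : 0 ≤ c) (hA0 : 0 ≤ A)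
    (hK : 0 ≤ K) (hI : I ≤ 1 / (α * (1 - α)) - 2 / 3) (he : exp (-(π / 4 * c)) ≤ e₀)
    (hAK : A ≤ K) (h : π / 4 + 5 / 12 * (A + K * e₀) ≤ K) :
    π + I / 2 * (A + K * exp (-(α * (π * c)))) ≤ 1 / (α * (1 - α)) * K := by
  set q := α * (1 - α) with hq
  have hq0 : 0 < q := mul_pos h0 (by linarith)
  have hq4 : q ≤ 1 / 4 := by nlinarith [sq_nonneg (2 * α - 1)]
  have hqα : q ≤ α := by nlinarith
  set e := exp (-(π / 4 * c)) with hed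
  have he1 : e ≤ 1 := exp_le_one_iff.2 (by have := pi_pos; nlinarith [mul_nonneg pi_pos.le hc])
  have hE : exp (-(α * (π * c))) ≤ 1 - 4 * q + 4 * q * e := by
    have hcv := convexOn_exp.2 (mem_univ 0) (mem_univ (-(π / 4 * c)))
      (by linarith : 0 ≤ 1 - 4 * q) (by linarith : 0 ≤ 4 * q) (by ring)
    simp only [smul_eq_mul, mul_zero, zero_add, exp_zero, mul_one] at hcv
    refine le_trans (exp_le_exp.2 ?_) hcv
    have : q * (π * c) ≤ α * (π * c) :=
      mul_le_mul_of_nonneg_right hqα (mul_nonneg pi_pos.le hc)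
    linarith
  set x := exp (-(α * (π * c)))
  have hx : 0 < x := exp_pos _
  have h2 : π + I / 2 * (A + K * x) ≤ π + (1 / q - 2 / 3) / 2 * (A + K * x) := by gcongr
  refine h2.trans ?_
  have h3 : q * (π + (1 / q - 2 / 3) / 2 * (A + K * x)) = π * q + (1 - 2 / 3 * q) / 2 * (A + K * x) := by
    field_simp
  have h4 : q * (1 / q * K) = K := by field_simp
  refine le_of_mul_le_mul_left ?_ hq0
  rw [h3, h4]
  have h5 : (1 - 2 / 3 * q) / 2 * (A + K * x) ≤
      (1 - 2 / 3 * q) / 2 * (A + K * (1 - 4 * q + 4 * q * e)) := by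
    have : 0 ≤ (1 - 2 / 3 * q) / 2 := by linarith
    gcongr
  have h6 : π / 4 + 5 / 12 * (A + K * e) ≤ K := by
    have : K * e ≤ K * e₀ := by gcongr
    linarith
  have h7 : 0 ≤ q * (1 / 4 - q) * (K * (1 - e)) :=
    mul_nonneg (mul_nonneg hq0.le (by linarith)) (mul_nonneg hK (by linarith))
  have h8 : 4 * q * (π / 4 + 5 / 12 * (A + K * e)) ≤ 4 * q * K := by gcongr
  have h9 : (1 - 4 * q) * (A + K) ≤ (1 - 4 * q) * (2 * K) := by
    have : 0 ≤ 1 - 4 * q := by linarith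
    gcongr
    linarith
  linarith

theorem conv_bound' {α K A I : ℝ} (h0 : 0 < α) (h1 : α < 1) (hA0 : 0 ≤ A)
    (hI : I ≤ 1 / (α * (1 - α)) - 2 / 3)
    (hAK : A ≤ 2 * K) (h : π / 4 + 5 / 12 * A ≤ K) :
    π + I / 2 * A ≤ 1 / (α * (1 - α)) * K := by
  set q := α * (1 - α) with hq
  have hq0 : 0 < q := mul_pos h0 (by linarith)
  have hq4 : q ≤ 1 / 4 := by nlinarith [sq_nonneg (2 * α - 1)]
  have h2 : π + I / 2 * A ≤ π + (1 / q - 2 / 3) / 2 * A := by gcongr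
  refine h2.trans ?_
  have h3 : q * (π + (1 / q - 2 / 3) / 2 * A) = π * q + (1 - 2 / 3 * q) / 2 * A := by
    field_simp
  have h4 : q * (1 / q * K) = K := by field_simp
  refine le_of_mul_le_mul_left ?_ hq0
  rw [h3, h4]
  have h8 : 4 * q * (π / 4 + 5 / 12 * A) ≤ 4 * q * K := by gcongr
  have h9 : (1 - 4 * q) * A ≤ (1 - 4 * q) * (2 * K) := by
    have : 0 ≤ 1 - 4 * q := by linarith
    gcongr
  linarith

theorem arctan_sub_arctan {u v : ℝ} (hu : 0 ≤ u) (hv : 0 ≤ v) :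
    arctan v - arctan u = arctan ((v - u) / (1 + u * v)) := by
  have h := arctan_add (x := v) (y := -u) (by nlinarith [mul_nonneg hu hv])
  rw [arctan_neg] at h
  rw [sub_eq_add_neg, h]
  congr 1
  rw [mul_neg, sub_neg_eq_add, ← sub_eq_add_neg, mul_comm v u]

theorem le_arctan_sub_arctan {u v r : ℝ} (hu : 0 ≤ u) (hv : 0 ≤ v) (hr : 0 ≤ r)
    (h : r * (1 + u * v) ≤ v - u) : 3 * r / (3 + r ^ 2) ≤ arctan v - arctan u := by
  rw [arctan_sub_arctan hu hv]
  refine (pade_le_arctan hr).trans (arctan_strictMono.monotone ?_)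
  rw [le_div_iff₀ (by positivity)]
  exact h

/-- Equivalently 4 arctan T ≤ 5 (arctan 2T - arctan T): the smallness of e^(-L arctan T) passes, to
the power 4/5, to the gap between pole and new line, uniformly in L. -/
theorem nine_arctan_le {T : ℝ} (h0 : 0 ≤ T) (h : T ≤ 0.35) :
    9 * arctan T ≤ 5 * arctan (2 * T) := by
  have h1 := arctan_le_pade h0
  have h2 := pade_le_arctan' (u := 2 * T) (by positivity)
  have h3 : 9 * (T * (15 + 4 * T ^ 2) / (15 + 9 * T ^ 2)) ≤
      5 * (2 * T * (105 + 55 * (2 * T) ^ 2) / (105 + 90 * (2 * T) ^ 2 + 9 * (2 * T) ^ 4)) := by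
    have e1 : 9 * (T * (15 + 4 * T ^ 2) / (15 + 9 * T ^ 2)) =
      T * (9 * (15 + 4 * T ^ 2) / (15 + 9 * T ^ 2)) := by ring
    have e2 : 5 * (2 * T * (105 + 55 * (2 * T) ^ 2) / (105 + 90 * (2 * T) ^ 2 + 9 * (2 * T) ^ 4)) =
      T * (10 * (105 + 220 * T ^ 2) / (105 + 360 * T ^ 2 + 144 * (T ^ 2) ^ 2)) := by ring
    rw [e1, e2]
    refine mul_le_mul_of_nonneg_left ?_ h0
    have hS : T ^ 2 ≤ 0.1225 := by nlinarith
    have hS0 := sq_nonneg T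
    set S := T ^ 2
    rw [div_le_div_iff₀ (by positivity) (by positivity)]
    have h4 : S ^ 2 ≤ 0.1225 * S := by nlinarith
    have h5 : S ^ 3 ≤ 0.1225 * S ^ 2 := by nlinarith [sq_nonneg S]
    nlinarith
  linarith

theorem five_arctan_le {T : ℝ} (h0 : 0 ≤ T) (h : T ≤ 0.5) :
    5 * arctan T ≤ 3 * arctan (2 * T) := by
  have h1 := arctan_le_pade h0
  have h2 := pade_le_arctan' (u := 2 * T) (by positivity)
  have h3 : 5 * (T * (15 + 4 * T ^ 2) / (15 + 9 * T ^ 2)) ≤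
      3 * (2 * T * (105 + 55 * (2 * T) ^ 2) / (105 + 90 * (2 * T) ^ 2 + 9 * (2 * T) ^ 4)) := by
    have e1 : 5 * (T * (15 + 4 * T ^ 2) / (15 + 9 * T ^ 2)) =
      T * (5 * (15 + 4 * T ^ 2) / (15 + 9 * T ^ 2)) := by ring
    have e2 : 3 * (2 * T * (105 + 55 * (2 * T) ^ 2) / (105 + 90 * (2 * T) ^ 2 + 9 * (2 * T) ^ 4)) =
      T * (6 * (105 + 220 * T ^ 2) / (105 + 360 * T ^ 2 + 144 * (T ^ 2) ^ 2)) := by ring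
    rw [e1, e2]
    refine mul_le_mul_of_nonneg_left ?_ h0
    have hS : T ^ 2 ≤ 0.25 := by nlinarith
    have hS0 := sq_nonneg T
    set S := T ^ 2
    rw [div_le_div_iff₀ (by positivity) (by positivity)]
    have h4 : S ^ 2 ≤ 0.25 * S := by nlinarith
    have h5 : S ^ 3 ≤ 0.25 * S ^ 2 := by nlinarith [sq_nonneg S]
    nlinarith
  linarith

theorem four_le_inv_mul {α : ℝ} (h0 : 0 < α) (h1 : α < 1) : 4 ≤ 1 / (α * (1 - α)) := by
  rw [le_div_iff₀ (mul_pos h0 (by linarith))]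
  nlinarith [sq_nonneg (2 * α - 1)]

theorem one_le_sqrt_cube (t : ℝ) : 1 ≤ √(1 + t ^ 2) ^ 3 :=
  one_le_pow₀ (one_le_sqrt.2 (by nlinarith [sq_nonneg t]))

/-- Normal form of a bound that crosses the pole. -/
theorem cross_le {J L W I A t T : ℝ} (hL : 0 ≤ L) (hI : 0 ≤ I) (htT : t ≤ T)
    (hJ : J ≤ π * exp (-(L * arctan T)) + W / 2 * exp (-(L * arctan (2 * T))) * I)
    (hA : W * exp (-(L * (arctan (2 * T) - arctan t))) ≤ A) :
    J ≤ exp (-(L * arctan t)) * (π + I / 2 * A) := by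
  have h1 : exp (-(L * arctan T)) ≤ exp (-(L * arctan t)) := by
    have := arctan_strictMono.monotone htT
    gcongr
  have h2 : exp (-(L * arctan (2 * T))) =
      exp (-(L * arctan t)) * exp (-(L * (arctan (2 * T) - arctan t))) := by
    rw [← exp_add]; congr 1; ring
  have hp := exp_pos (-(L * arctan t))
  rw [h2] at hJ
  set E := exp (-(L * arctan t))
  set z := exp (-(L * (arctan (2 * T) - arctan t)))
  calc J ≤ π * exp (-(L * arctan T)) + W / 2 * (E * z) * I := hJ
    _ ≤ π * E + W / 2 * (E * z) * I := by gcongr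
    _ = E * (π + I / 2 * (W * z)) := by ring
    _ ≤ _ := by gcongr

/-- If the trivial bound I/2 fails to suffice, the residue factor x is below (B - 2/3)/(2B), hence
the gap factor z ≤ x^(4/5) is small as well. The witness g bounds (I/2)z; the requirement π + g ≤ B
is tight at B = 4, so B is split at 4.2. -/
theorem small_pole_numeric {B I K W S x z : ℝ} (hB : 4 ≤ B) (hI : I ≤ B - 2 / 3) (hI0 : 0 ≤ I)
    (hK : 1 + 3 / 2 * S ≤ K) (hW : W = (1 + 2 * S) ^ 2) (hS0 : 0 ≤ S) (hS : S ≤ 0.1225)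
    (hx : 0 < x) (hz : 0 < z) (hzx : z ^ 5 ≤ x ^ 4) (hlt : B * K * x < I / 2) :
    π + I / 2 * (W * z) ≤ B * K := by
  have hW1 : W ≤ 1 + 4.49 * S := by rw [hW]; nlinarith
  have hBx : B * x < (B - 2 / 3) / 2 := by
    have : B * 1 * x ≤ B * K * x := by gcongr; linarith
    linarith
  suffices h : ∃ g, I / 2 * z ≤ g ∧ 0 ≤ g ∧ 3.1416 + g ≤ B ∧ g ≤ 0.334 * B by
    obtain ⟨g, h1, h2, h3, h4⟩ := h
    have hp := pi_lt_d4
    have e : I / 2 * (W * z) = W * (I / 2 * z) := by ring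
    have h5 : W * (I / 2 * z) ≤ (1 + 4.49 * S) * g := by gcongr
    have h6 : B * (1 + 3 / 2 * S) ≤ B * K := by gcongr
    have h7 : S * (4.49 * g) ≤ S * (3 / 2 * B) :=
      mul_le_mul_of_nonneg_left (by linarith) hS0
    linarith
  rcases le_total 4.2 B with h | h
  · have hx2 : x ≤ 1 / 2 := by nlinarith
    have hz2 : z ≤ 0.575 := by
      refine le_of_pow_le_pow_left₀ (n := 5) (by norm_num) (by norm_num) (hzx.trans ?_)
      calc x ^ 4 ≤ (1 / 2) ^ 4 := by gcongr
        _ ≤ _ := by norm_num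
    refine ⟨(B - 2 / 3) / 2 * 0.575, mul_le_mul (by linarith) hz2 hz.le (by linarith), by linarith, by linarith, by linarith⟩
  · have hx2 : x ≤ 0.4207 := by nlinarith
    have hz2 : z ≤ 0.501 := by
      refine le_of_pow_le_pow_left₀ (n := 5) (by norm_num) (by norm_num) (hzx.trans ?_)
      calc x ^ 4 ≤ 0.4207 ^ 4 := by gcongr
        _ ≤ _ := by norm_num
    refine ⟨(B - 2 / 3) / 2 * 0.501, mul_le_mul (by linarith) hz2 hz.le (by linarith), by linarith, by linarith, by linarith⟩

theorem exp_gap_pow_five_le {L T : ℝ} (hL : 0 ≤ L) (h0 : 0 ≤ T) (h : T ≤ 0.35) :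
    exp (-(L * (arctan (2 * T) - arctan T))) ^ 5 ≤ exp (-(L * arctan T)) ^ 4 := by
  rw [← exp_nat_mul, ← exp_nat_mul, exp_le_exp]
  have := mul_le_mul_of_nonneg_left (nine_arctan_le h0 h) hL
  push_cast
  linarith

/-! ### The main bound for near, middle and far poles -/

section MainBound

variable {α c L T : ℝ}

theorem norm_oscInt_le_kap_of_small (h0 : 0 < α) (h1 : α < 1) (hL : 0 ≤ L) (hT0 : 0 < T)
    (hT : T ≤ 0.35) (h : c ^ 2 * (T ^ 2 * (1 + T ^ 2)) = 1) :
    ‖oscInt α c L‖ ≤ 1 / (α * (1 - α)) * kap L T := by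
  have hp := norm_oscInt_le h0 h1 c L
  have hI := integral_logi_le h0 h1
  have hI0 := integral_logi_nonneg α
  have hB := four_le_inv_mul h0 h1
  have hJ := cross_le (t := T) hL hI0 le_rfl (norm_oscInt_le_pole h0 h1 hL hT0 h) le_rfl
  unfold kap
  set B := 1 / (α * (1 - α))
  set I := ∫ v, logi α v
  set x := exp (-(L * arctan T))
  have hx : 0 < x := exp_pos _
  rcases le_or_gt (I / 2) (B * √(1 + T ^ 2) ^ 3 * x) with h2 | h2
  · exact hp.trans (h2.trans (by rw [mul_assoc]))
  · have hK := tangent_le_sqrt_cube (m := 1) (w := 1 + T ^ 2) zero_le_one (by positivity)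
    have := small_pole_numeric hB hI hI0 (by linarith) rfl (sq_nonneg T) (by nlinarith) hx
      (exp_pos _) (exp_gap_pow_five_le hL hT0.le hT) h2
    calc _ ≤ _ := hJ
      _ ≤ x * (B * √(1 + T ^ 2) ^ 3) := by gcongr
      _ = _ := by ring

theorem norm_oscInt_le_kap_of_medium (h0 : 0 < α) (h1 : α < 1) (hL : 2 ≤ L)
    (hT0 : 0.35 ≤ T) (hT : T ≤ 2 / 3) (h : c ^ 2 * (T ^ 2 * (1 + T ^ 2)) = 1) :
    ‖oscInt α c L‖ ≤ 1 / (α * (1 - α)) * kap L T := by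
  have hTp : 0 < T := by linarith
  have hI := integral_logi_le h0 h1
  have hI0 := integral_logi_nonneg α
  have hz : exp (-(L * (arctan (2 * T) - arctan T))) ≤ 0.58 := by
    -- The tangent of the gap is T/(1 + 2T²), at least 0.281 on this range, with its minimum at T =
    -- 0.35.
    have h2 : 0.2735 ≤ arctan (2 * T) - arctan T := by
      refine le_trans (by norm_num)
        (le_arctan_sub_arctan (r := 0.281) hTp.le (by positivity) (by norm_num) ?_)
      nlinarith
    have h3 : exp (-(L * (arctan (2 * T) - arctan T))) ≤ exp (-0.547) := by
      rw [exp_le_exp]; nlinarith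
    exact h3.trans (exp_neg_le_of_one_le (by norm_num) (by norm_num))
  have hJ := cross_le (L := L) (t := T) (A := 0.58 * (1 + 2 * T ^ 2) ^ 2) (by linarith) hI0 le_rfl
    (norm_oscInt_le_pole h0 h1 (by linarith) hTp h) (by rw [mul_comm]; gcongr)
  refine hJ.trans ?_
  have hK := tangent_le_sqrt_cube (m := 1.118) (w := 1 + T ^ 2) (by norm_num) (by positivity)
  have hS1 : 0.1225 ≤ T ^ 2 := by nlinarith
  have hS2 : T ^ 2 ≤ 4 / 9 := by nlinarith
  set S := T ^ 2
  have hS3 : S ^ 2 ≤ 0.567 * S - 0.0544 := by nlinarith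
  have hpi := pi_lt_d4
  have := conv_bound' (K := √(1 + S) ^ 3) h0 h1 (by positivity : 0 ≤ 0.58 * (1 + 2 * S) ^ 2) hI
    (by nlinarith) (by nlinarith)
  unfold kap
  calc _ ≤ exp (-(L * arctan T)) * (1 / (α * (1 - α)) * √(1 + S) ^ 3) := by gcongr
    _ = _ := by ring

theorem sq_add_one_mul_exp_mono {a u v : ℝ} (hu : a ≤ 2 * u) (huv : u ≤ v) :
    (1 + u ^ 2) * exp (-(a * arctan u)) ≤ (1 + v ^ 2) * exp (-(a * arctan v)) := by
  have e : ∀ u : ℝ, (1 + u ^ 2) * exp (-(a * arctan u)) = exp (log (1 + u ^ 2) - a * arctan u) := by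
    intro u
    rw [sub_eq_add_neg, exp_add, exp_log (by positivity)]
  rw [e, e, exp_le_exp]
  exact logMod_mono hu huv

theorem cross_factor_mono {L t T T' : ℝ} (hL : 3 * t ≤ L) (ht : 0 ≤ t) (htT : t ≤ T)
    (hTT : T ≤ T') : (1 + 4 * T ^ 2) * exp (-(L * (arctan (2 * T) - arctan t))) ≤
      (1 + 4 * T' ^ 2) * exp (-(3 * t * (arctan (2 * T') - arctan t))) := by
  have h1 := sq_add_one_mul_exp_mono (a := 3 * t) (u := 2 * T) (v := 2 * T') (by linarith)
    (by linarith)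
  have e : ∀ T, (1 + 4 * T ^ 2) * exp (-(3 * t * (arctan (2 * T) - arctan t))) =
      exp (3 * t * arctan t) * ((1 + (2 * T) ^ 2) * exp (-(3 * t * arctan (2 * T)))) := by
    intro T
    rw [mul_left_comm, ← exp_add]
    congr 1
    · ring
    · congr 1; ring
  calc _ ≤ (1 + 4 * T ^ 2) * exp (-(3 * t * (arctan (2 * T) - arctan t))) := by
        have : 0 ≤ arctan (2 * T) - arctan t :=
          sub_nonneg.2 (arctan_strictMono.monotone (by linarith))
        gcongr
    _ ≤ _ := by
        rw [e, e]
        gcongr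

/-- If the scaled pole condition q ≤ 0.48 holds, the direct line suffices: its factor 2 is
affordable because I ≤ 1/(α(1-α)). Otherwise T ≤ 1.7t, and the contour is moved to the line of
tangent 2T. -/
theorem norm_oscInt_le_kap_of_large (h0 : 0 < α) (h1 : α < 1) {t : ℝ} (hL : 3 * t ≤ L)
    (ht : 2 / 3 ≤ t) (htT : t ≤ T) (hc : 0 ≤ c) (h : c ^ 2 * (T ^ 2 * (1 + T ^ 2)) = 1) :
    ‖oscInt α c L‖ ≤ 1 / (α * (1 - α)) * kap L t := by
  have hI := integral_logi_le h0 h1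
  have hI0 := integral_logi_nonneg α
  have ht0 : 0 < t := by linarith
  rcases le_or_gt (t * √(1 + t ^ 2) * c) 0.48 with hq | hq
  · refine (norm_oscInt_le_direct h0 h1 (by linarith) ht0 hc hq).trans ?_
    rw [mul_comm]
    have := kap_pos L t
    unfold kap at *
    gcongr
    linarith
  have hT : T ≤ 1.7 * t := by
    by_contra! hT
    have h2 : 0.48 ^ 2 < (t * √(1 + t ^ 2) * c) ^ 2 := by gcongr
    rw [mul_pow, mul_pow, sq_sqrt (by positivity)] at h2
    have h3 : (1.7 * t) ^ 2 * (1 + (1.7 * t) ^ 2) ≤ T ^ 2 * (1 + T ^ 2) := by gcongr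
    have h4 : c ^ 2 * ((1.7 * t) ^ 2 * (1 + (1.7 * t) ^ 2)) ≤ 1 :=
      (mul_le_mul_of_nonneg_left h3 (sq_nonneg c)).trans h.le
    have h5 : 4 / 9 ≤ t ^ 2 := by nlinarith
    have h6 : t ^ 2 * (1 + t ^ 2) ≤ 0.48 ^ 2 * ((1.7 * t) ^ 2 * (1 + (1.7 * t) ^ 2)) := by
      nlinarith
    have h7 : c ^ 2 * (t ^ 2 * (1 + t ^ 2)) ≤
      c ^ 2 * (0.48 ^ 2 * ((1.7 * t) ^ 2 * (1 + (1.7 * t) ^ 2))) := by gcongr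
    linarith
  have hA : (1 + 4 * T ^ 2) * exp (-(L * (arctan (2 * T) - arctan t))) ≤
      0.334 * (1 + 11.56 * t ^ 2) := by
    refine (cross_factor_mono hL ht0.le htT hT).trans ?_
    have h2 : 1.1 ≤ 3 * t * (arctan (2 * (1.7 * t)) - arctan t) := by
      set r := 2.4 * t / (1 + 3.4 * t ^ 2) with hr
      have hr0 : 0 ≤ r := by positivity
      have h3 := le_arctan_sub_arctan (u := t) (v := 2 * (1.7 * t)) (r := r) ht0.le (by positivity)
        hr0 (by rw [hr]; apply le_of_eq; field_simp; ring)
      have hr1 : r ≤ 0.64 := by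
        rw [hr, div_le_iff₀ (by positivity)]; nlinarith
      have htr : 0.42 ≤ t * r := by
        rw [hr, mul_div_assoc', le_div_iff₀ (by positivity)]; nlinarith
      have h5 : 0.879 * r ≤ 3 * r / (3 + r ^ 2) := by
        rw [le_div_iff₀ (by positivity)]
        have : r ^ 2 ≤ 0.4096 := by nlinarith
        nlinarith
      nlinarith
    rw [mul_comm]
    have h3 : exp (-(3 * t * (arctan (2 * (1.7 * t)) - arctan t))) ≤ 0.334 :=
      (exp_le_exp.2 (neg_le_neg h2)).trans (exp_neg_le_of_one_le (by norm_num) (by norm_num))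
    have e : 1 + 4 * (1.7 * t) ^ 2 = 1 + 11.56 * t ^ 2 := by ring
    rw [e]
    gcongr
  have hJ := cross_le (by linarith) hI0 htT
    (norm_oscInt_le_pole' h0 h1 (by linarith) (ht.trans htT) hc h) hA
  refine hJ.trans ?_
  have hK := tangent_le_sqrt_cube (m := 1.3) (w := 1 + t ^ 2) (by norm_num) (by positivity)
  have hS1 : 4 / 9 ≤ t ^ 2 := by nlinarith
  have hpi := pi_lt_d4
  have := conv_bound' (K := √(1 + t ^ 2) ^ 3) h0 h1
    (by positivity : 0 ≤ 0.334 * (1 + 11.56 * t ^ 2)) hI (by linarith) (by linarith)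
  unfold kap
  calc _ ≤ exp (-(L * arctan t)) * (1 / (α * (1 - α)) * √(1 + t ^ 2) ^ 3) := by gcongr
    _ = _ := by ring

/-- The main bound for the oscillatory integrals: exponential decay up to the first pole, with a
constant that does not blow up at the pole. -/
theorem norm_oscInt_le_kap (h0 : 0 < α) (h1 : α < 1) (hL : 0 ≤ L) (hc : 0 ≤ c) {t : ℝ} (ht : 0 < t)
    (hT : c = 0 ∨ ∃ T, t ≤ T ∧ c ^ 2 * (T ^ 2 * (1 + T ^ 2)) = 1) :
    ‖oscInt α c L‖ ≤ 1 / (α * (1 - α)) * kap L t := by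
  have hI := integral_logi_le h0 h1
  have hI0 := integral_logi_nonneg α
  have hB := four_le_inv_mul h0 h1
  have hk := kap_pos L t
  rcases le_or_gt L 2 with hL2 | hL2
  · have := half_le_kap ht.le hL2
    have hp := norm_oscInt_le h0 h1 c L
    nlinarith
  rcases hT with rfl | ⟨T, htT, h⟩
  · refine (norm_oscInt_zero_le h0 h1 hL ht).trans ?_
    have e : √(1 + t ^ 2) ^ 3 / 2 * exp (-(L * arctan t)) * ∫ v, logi α v =
      (∫ v, logi α v) / 2 * kap L t := by unfold kap; ring
    rw [e]
    exact mul_le_mul_of_nonneg_right (by linarith) hk.le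
  have hT0 : 0 < T := ht.trans_le htT
  have hmin := kap_min_le L htT
  have hB0 : 0 ≤ 1 / (α * (1 - α)) := by linarith
  refine le_trans ?_ (mul_le_mul_of_nonneg_left hmin hB0)
  rcases le_or_gt T (2 / 3) with h2 | h2
  · rw [min_eq_right (by linarith)]
    rcases le_or_gt T 0.35 with h3 | h3
    · exact norm_oscInt_le_kap_of_small h0 h1 hL hT0 h3 h
    · exact norm_oscInt_le_kap_of_medium h0 h1 hL2.le h3.le h2 h
  · exact norm_oscInt_le_kap_of_large h0 h1 (by linarith [min_le_left (L / 3) T])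
      (le_min (by linarith) h2.le) (min_le_right _ _) hc h

end MainBound

/-! ### The sharper bound, leaving room for the c = 0 integral -/

/-- A nearer pole means a larger c. At T₁ = 0.35, 0.5, 2/3, 1 the value 1/(T₁√(1+T₁²)) rounds down
to the 2.69, 1.788, 1.247, 0.707 used below, which bound e^(-πc/4). -/
theorem le_of_pole_le {c T c₁ T₁ : ℝ} (hc : 0 ≤ c) (hT : 0 ≤ T)
    (h : c ^ 2 * (T ^ 2 * (1 + T ^ 2)) = 1)
    (hTT : T ≤ T₁) (h1 : c₁ ^ 2 * (T₁ ^ 2 * (1 + T₁ ^ 2)) ≤ 1) : c₁ ≤ c := by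
  by_contra! hlt
  have hTp : T ≠ 0 := by rintro rfl; simp at h
  have hT0 : 0 < T := hT.lt_of_ne' hTp
  have h2 : T ^ 2 * (1 + T ^ 2) ≤ T₁ ^ 2 * (1 + T₁ ^ 2) := by gcongr
  have h3 : c ^ 2 < c₁ ^ 2 := by gcongr
  have h4 : 0 < T ^ 2 * (1 + T ^ 2) := by positivity
  have h5 : c ^ 2 * (T ^ 2 * (1 + T ^ 2)) < c₁ ^ 2 * (T ^ 2 * (1 + T ^ 2)) := by gcongr
  have h6 : c₁ ^ 2 * (T ^ 2 * (1 + T ^ 2)) ≤ c₁ ^ 2 * (T₁ ^ 2 * (1 + T₁ ^ 2)) := by gcongr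
  linarith

theorem exp_neg_pi_mul_le {c c₁ r : ℝ} (hc : c₁ ≤ c) (h0 : 0 ≤ c₁)
    (h : exp (-(0.785 * c₁)) ≤ r) : exp (-(π / 4 * c)) ≤ r := by
  refine le_trans (exp_le_exp.2 (neg_le_neg ?_)) h
  have := pi_gt_d2
  exact mul_le_mul (by linarith) hc h0 (by linarith)

theorem add_le_of_cross {α c J L W A t u T e₀ : ℝ} (h0 : 0 < α) (h1 : α < 1) (hc : 0 ≤ c)
    (hL : 0 ≤ L) (huT : u ≤ T)
    (hJ : J ≤ π * exp (-(L * arctan T)) +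
      W / 2 * exp (-(L * arctan (2 * T))) * ∫ v, logi α v)
    (hA0 : 0 ≤ A) (hA : W * exp (-(L * (arctan (2 * T) - arctan u))) ≤ A)
    (hk : kap L u ≤ kap L t) (he : exp (-(π / 4 * c)) ≤ e₀) (hAK : A ≤ √(1 + u ^ 2) ^ 3)
    (h : π / 4 + 5 / 12 * (A + √(1 + u ^ 2) ^ 3 * e₀) ≤ √(1 + u ^ 2) ^ 3) :
    J + exp (-(α * (π * c))) * ((∫ v, logi α v) / 2 * kap L t) ≤
      1 / (α * (1 - α)) * kap L t := by
  have hI := integral_logi_le h0 h1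
  have hI0 := integral_logi_nonneg α
  have hJ2 := cross_le hL hI0 huT hJ hA
  have hB := four_le_inv_mul h0 h1
  have hcv := conv_bound h0 h1 hc hA0 (by positivity) hI he hAK h
  set B := 1 / (α * (1 - α))
  set I := ∫ v, logi α v
  have he1 : exp (-(α * (π * c))) ≤ 1 := exp_le_one_iff.2 (by
    have : 0 ≤ α * (π * c) := by positivity
    linarith)
  set e := exp (-(α * (π * c)))
  have hep : 0 < e := exp_pos _
  have hIe : I / 2 * e ≤ B := by
    have : I / 2 * e ≤ I / 2 * 1 := by gcongr
    linarith
  have h3 : J ≤ (B - I / 2 * e) * kap L u := by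
    unfold kap
    calc J ≤ _ := hJ2
      _ ≤ exp (-(L * arctan u)) * (B * √(1 + u ^ 2) ^ 3 - I / 2 * (√(1 + u ^ 2) ^ 3 * e)) := by
          gcongr
          linarith
      _ = _ := by ring
  have h4 : (B - I / 2 * e) * kap L u ≤ (B - I / 2 * e) * kap L t := by
    have : 0 ≤ B - I / 2 * e := by linarith
    gcongr
  linarith

/-- The hypothesis forces `kap L t` < 1/4, which `quarter_le_kap` rules out for L < 3. -/
theorem three_le_of_big {L t : ℝ} (ht : 0 ≤ t)
    (h : 4 * √(1 + t ^ 2) ^ 3 + 1 ≤ exp (L * arctan t)) : 3 ≤ L := by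
  by_contra! hL
  have h1 := quarter_le_kap ht hL.le
  unfold kap at h1
  rw [exp_neg, ← div_eq_mul_inv, le_div_iff₀ (exp_pos _)] at h1
  linarith

theorem exp_gap_le_of_third {L T : ℝ} (hL : 3 ≤ L) (hT : 1 / 2 ≤ T) (hT1 : T ≤ 1) :
    exp (-(L * (arctan (2 * T) - arctan T))) ≤ 0.3815 := by
  have h2 : 9 / 28 ≤ arctan (2 * T) - arctan T := by
    refine le_trans (by norm_num)
      (le_arctan_sub_arctan (r := 1 / 3) (by linarith : 0 ≤ T) (by linarith) (by norm_num) ?_)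
    nlinarith
  have h3 : exp (-(L * (arctan (2 * T) - arctan T))) ≤ exp (-(27 / 28)) := by
    rw [exp_le_exp]; nlinarith
  exact h3.trans (exp_neg_le_of_one_le (by norm_num) (by norm_num))

theorem exp_gap_pow_three_le {L T : ℝ} (hL : 0 ≤ L) (h0 : 0 ≤ T) (h : T ≤ 0.5) :
    exp (-(L * (arctan (2 * T) - arctan T))) ^ 3 ≤ exp (-(L * arctan T)) ^ 2 := by
  rw [← exp_nat_mul, ← exp_nat_mul, exp_le_exp]
  have := mul_le_mul_of_nonneg_left (five_arctan_le h0 h) hL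
  push_cast
  linarith

section SecondBound

variable {α c L t T : ℝ}

theorem add_le_of_small (h0 : 0 < α) (h1 : α < 1) (hc : 0 ≤ c) (hL : 3 ≤ L) (ht : 0 < t)
    (htT : t ≤ T) (hT : T ≤ 0.5) (h : c ^ 2 * (T ^ 2 * (1 + T ^ 2)) = 1)
    (hx : exp (-(L * arctan T)) ≤ 1 / 5) :
    ‖oscInt α c L‖ + exp (-(α * (π * c))) * ((∫ v, logi α v) / 2 * kap L t) ≤
      1 / (α * (1 - α)) * kap L t := by
  have hT0 : 0 < T := ht.trans_le htT
  have hJ := norm_oscInt_le_pole h0 h1 (by linarith : 0 ≤ L) hT0 h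
  have hk : kap L T ≤ kap L t := kap_anti (by linarith) htT
  have hK := tangent_le_sqrt_cube (m := 1) (w := 1 + T ^ 2) (by norm_num) (by positivity)
  have hpi := pi_lt_d4
  have hxp := exp_pos (-(L * arctan T))
  have hS0 := sq_nonneg T
  rcases le_or_gt T 0.35 with h2 | h2
  · have hz := exp_gap_pow_five_le (by linarith : 0 ≤ L) hT0.le h2
    have hz2 : exp (-(L * (arctan (2 * T) - arctan T))) ≤ 0.277 := by
      refine le_of_pow_le_pow_left₀ (n := 5) (by norm_num) (by norm_num) (hz.trans ?_)
      calc _ ≤ (1 / 5 : ℝ) ^ 4 := by gcongr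
        _ ≤ _ := by norm_num
    have hS : T ^ 2 ≤ 0.1225 := by nlinarith
    refine add_le_of_cross (A := 0.277 * (1 + 2 * T ^ 2) ^ 2) (e₀ := 0.13) h0 h1 hc (by linarith)
      le_rfl hJ (by positivity) (by rw [mul_comm]; gcongr) hk
      (exp_neg_pi_mul_le (le_of_pole_le (c₁ := 2.69) hc hT0.le h h2 (by norm_num)) (by norm_num)
        (exp_neg_le_of_one_le (by norm_num) (by norm_num))) ?_ ?_ <;> nlinarith
  · have hz := exp_gap_pow_three_le (by linarith : 0 ≤ L) hT0.le hT
    have hz2 : exp (-(L * (arctan (2 * T) - arctan T))) ≤ 0.343 := by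
      refine le_of_pow_le_pow_left₀ (n := 3) (by norm_num) (by norm_num) (hz.trans ?_)
      calc _ ≤ (1 / 5 : ℝ) ^ 2 := by gcongr
        _ ≤ _ := by norm_num
    have hS1 : 0.1225 ≤ T ^ 2 := by nlinarith
    have hS : T ^ 2 ≤ 0.25 := by nlinarith
    refine add_le_of_cross (A := 0.343 * (1 + 2 * T ^ 2) ^ 2) (e₀ := 0.25) h0 h1 hc (by linarith)
      le_rfl hJ (by positivity) (by rw [mul_comm]; gcongr) hk
      (exp_neg_pi_mul_le (le_of_pole_le (c₁ := 1.788) hc hT0.le h hT (by norm_num)) (by norm_num)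
        (exp_neg_le_of_one_le (by norm_num) (by norm_num))) ?_ ?_ <;> nlinarith

theorem add_le_of_medium (h0 : 0 < α) (h1 : α < 1) (hc : 0 ≤ c) (hL : 3 ≤ L)
    (htT : t ≤ T) (hT0 : 0.5 ≤ T) (hT : T ≤ 1) (h : c ^ 2 * (T ^ 2 * (1 + T ^ 2)) = 1) :
    ‖oscInt α c L‖ + exp (-(α * (π * c))) * ((∫ v, logi α v) / 2 * kap L t) ≤
      1 / (α * (1 - α)) * kap L t := by
  have hTp : 0 < T := by linarith
  have hk : kap L T ≤ kap L t := kap_anti (by linarith) htT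
  have hpi := pi_lt_d4
  have hz := exp_gap_le_of_third hL (by linarith) hT
  have hS1 : 0.25 ≤ T ^ 2 := by nlinarith
  rcases le_or_gt T (2 / 3) with h2 | h2
  · have hJ := norm_oscInt_le_pole h0 h1 (by linarith : 0 ≤ L) hTp h
    have hK := tangent_le_sqrt_cube (m := 1.118) (w := 1 + T ^ 2) (by norm_num) (by positivity)
    have hS : T ^ 2 ≤ 4 / 9 := by nlinarith
    refine add_le_of_cross (A := 0.3815 * (1 + 2 * T ^ 2) ^ 2) (e₀ := 0.38) h0 h1 hc (by linarith)
      le_rfl hJ (by positivity) (by rw [mul_comm]; gcongr) hk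
      (exp_neg_pi_mul_le (le_of_pole_le (c₁ := 1.247) hc hTp.le h h2 (by norm_num)) (by norm_num)
        (exp_neg_le_of_one_le (by norm_num) (by norm_num))) ?_ ?_ <;> nlinarith
  · have hJ := norm_oscInt_le_pole' h0 h1 (by linarith : 0 ≤ L) h2.le hc h
    have hK := tangent_le_sqrt_cube (m := 1.2) (w := 1 + T ^ 2) (by norm_num) (by positivity)
    have hS : T ^ 2 ≤ 1 := by nlinarith
    have hS2 : 4 / 9 ≤ T ^ 2 := by nlinarith
    refine add_le_of_cross (A := 0.3815 * (1 + 4 * T ^ 2)) (e₀ := 0.58) h0 h1 hc (by linarith)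
      le_rfl hJ (by positivity) (by rw [mul_comm]; gcongr) hk
      (exp_neg_pi_mul_le (le_of_pole_le (c₁ := 0.707) hc hTp.le h hT (by norm_num)) (by norm_num)
        (exp_neg_le_of_one_le (by norm_num) (by norm_num))) ?_ ?_ <;> linarith

/-- By monotonicity T may be replaced by 3/2, where 1 + 4T² = 10. Then m is a lower bound for the
tangent (3-u)/(1+3u) of the gap, and a for the exponent. -/
theorem cross_factor_le {u : ℝ} (hL : 3 * u ≤ L) (hu : 1 ≤ u) (huT : u ≤ T) (hT : T ≤ 3 / 2)
    {m a A : ℝ} (hm : m * (1 + 3 * u) ≤ 3 - u) (hm0 : 0 ≤ m)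
    (ha : a * (3 + m ^ 2) ≤ 9 * (u * m)) (hA : exp (-a) ≤ A / 10) :
    (1 + 4 * T ^ 2) * exp (-(L * (arctan (2 * T) - arctan u))) ≤ A := by
  refine (cross_factor_mono hL (by linarith) huT hT).trans ?_
  have h3 := le_arctan_sub_arctan (u := u) (v := 2 * (3 / 2)) (r := m) (by linarith) (by norm_num)
    hm0 (by linarith)
  have h4 : a ≤ 3 * u * (arctan (2 * (3 / 2)) - arctan u) := by
    have h5 : a ≤ 3 * u * (3 * m / (3 + m ^ 2)) := by
      rw [mul_div_assoc', le_div_iff₀ (by positivity)]; linarith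
    refine h5.trans ?_
    gcongr
  have h5 := (exp_le_exp.2 (neg_le_neg h4)).trans hA
  have e : (1 + 4 * (3 / 2 : ℝ) ^ 2) = 10 := by norm_num
  rw [e]
  linarith

theorem add_le_of_large (h0 : 0 < α) (h1 : α < 1) (hc : 3 / 8 ≤ c) (hL : 3 ≤ L)
    (htT : t ≤ T) (hT0 : 1 ≤ T) (hT : T ≤ 3 / 2) (h : c ^ 2 * (T ^ 2 * (1 + T ^ 2)) = 1) :
    ‖oscInt α c L‖ + exp (-(α * (π * c))) * ((∫ v, logi α v) / 2 * kap L t) ≤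
      1 / (α * (1 - α)) * kap L t := by
  have hk := kap_min_le L htT
  have hLu : 3 * min (L / 3) T ≤ L := by linarith [min_le_left (L / 3) T]
  have hu1 : 1 ≤ min (L / 3) T := le_min (by linarith) hT0
  have huT : min (L / 3) T ≤ T := min_le_right _ _
  set u := min (L / 3) T
  have hJ := norm_oscInt_le_pole' h0 h1 (by linarith : 0 ≤ L) (by linarith) (by linarith) h
  have hpi := pi_lt_d4
  have hd : 0 < 1 + 3 * u := by linarith
  have hm : (3 - u) / (1 + 3 * u) * (1 + 3 * u) ≤ 3 - u := by rw [div_mul_cancel₀ _ hd.ne']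
  have hm0 : 0 ≤ (3 - u) / (1 + 3 * u) := div_nonneg (by linarith) hd.le
  have he : exp (-(π / 4 * c)) ≤ 0.748 := exp_neg_pi_mul_le hc (by norm_num)
    (exp_neg_le_of_one_le (by norm_num) (by norm_num))
  rcases le_or_gt u 1.1 with h2 | h2
  · have hm1 : (3 - u) / (1 + 3 * u) ≤ 0.5 := by rw [div_le_iff₀ hd]; linarith
    have hm2 : 0.486 ≤ u * ((3 - u) / (1 + 3 * u)) := by
      rw [mul_div_assoc', le_div_iff₀ hd]; nlinarith
    have hA := cross_factor_le (L := L) (a := 1.345) (A := 2.628) hLu hu1 huT hT hm hm0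
      (by nlinarith) (exp_neg_le_of_one_le (by norm_num) (by norm_num))
    have hK := tangent_le_sqrt_cube (m := 1.414) (w := 1 + u ^ 2) (by norm_num) (by positivity)
    have hS : 1 ≤ u ^ 2 := by nlinarith
    exact add_le_of_cross h0 h1 (by linarith) (by linarith) huT hJ (by norm_num) hA hk he
      (by linarith) (by linarith)
  · have hm1 : (3 - u) / (1 + 3 * u) ≤ 0.442 := by rw [div_le_iff₀ hd]; linarith
    have hm2 : 0.409 ≤ u * ((3 - u) / (1 + 3 * u)) := by
      rw [mul_div_assoc', le_div_iff₀ hd]; nlinarith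
    have hA := cross_factor_le (L := L) (a := 1.15) (A := 3.175) hLu hu1 huT hT hm hm0
      (by nlinarith) (exp_neg_le_of_one_le (by norm_num) (by norm_num))
    have hK := tangent_le_sqrt_cube (m := 1.48) (w := 1 + u ^ 2) (by norm_num) (by positivity)
    have hS : 1.21 ≤ u ^ 2 := by nlinarith
    exact add_le_of_cross h0 h1 (by linarith) (by linarith) huT hJ (by norm_num) hA hk he
      (by linarith) (by linarith)

/-- A strengthening of `norm_oscInt_le_kap` for large frequencies. -/
theorem norm_oscInt_add_le_kap (h0 : 0 < α) (h1 : α < 1) (hL0 : 0 ≤ L) (hc : 3 / 8 ≤ c) (ht : 0 < t)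
    (htT : t ≤ T) (h : c ^ 2 * (T ^ 2 * (1 + T ^ 2)) = 1)
    (hbig : 4 * √(1 + t ^ 2) ^ 3 + 1 ≤ exp (L * arctan t)) :
    ‖oscInt α c L‖ + exp (-(α * (π * c))) * ‖oscInt α 0 L‖ ≤ 1 / (α * (1 - α)) * kap L t := by
  have hL := three_le_of_big ht.le hbig
  have hJ0 : ‖oscInt α 0 L‖ ≤ (∫ v, logi α v) / 2 * kap L t := by
    refine (norm_oscInt_zero_le h0 h1 hL0 ht).trans (le_of_eq ?_)
    unfold kap; ring
  have hc0 : 0 ≤ c := by linarith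
  -- This is what c ≥ 3/8 provides: (3/8)² (3/2)² (1 + (3/2)²) already exceeds 1.
  have hT : T ≤ 3 / 2 := by
    by_contra! hT
    have h2 : (3 / 2 : ℝ) ^ 2 * (1 + (3 / 2) ^ 2) ≤ T ^ 2 * (1 + T ^ 2) := by gcongr
    have h3 : (3 / 8 : ℝ) ^ 2 * ((3 / 2) ^ 2 * (1 + (3 / 2) ^ 2)) ≤ c ^ 2 * (T ^ 2 * (1 + T ^ 2)) := by
      gcongr
    norm_num at h3
    linarith
  suffices hs : ‖oscInt α c L‖ + exp (-(α * (π * c))) * ((∫ v, logi α v) / 2 * kap L t) ≤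
      1 / (α * (1 - α)) * kap L t by
    refine le_trans ?_ hs
    gcongr
  rcases le_or_gt T 0.5 with h2 | h2
  · refine add_le_of_small h0 h1 hc0 hL ht htT h2 h ?_
    have h3 : 5 ≤ exp (L * arctan T) := by
      have h4 : exp (L * arctan t) ≤ exp (L * arctan T) := by
        have := arctan_strictMono.monotone htT
        gcongr
      have := one_le_sqrt_cube t
      linarith
    rw [exp_neg, ← one_div]
    exact one_div_le_one_div_of_le (by norm_num) h3
  · rcases le_or_gt T 1 with h3 | h3
    · exact add_le_of_medium h0 h1 hc0 hL htT h2.le h3 h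
    · exact add_le_of_large h0 h1 hc hL htT h3.le hT h

end SecondBound

/-! ### Poisson summation -/

theorem oscInt_neg (α c L : ℝ) : oscInt α c (-L) = starRingEnd ℂ (oscInt α c L) := by
  unfold oscInt
  rw [← integral_conj]
  congr 1
  ext x
  rw [map_mul, Complex.conj_ofReal, ← Complex.exp_conj]
  congr 2
  simp

theorem norm_oscInt_neg (α c L : ℝ) : ‖oscInt α c (-L)‖ = ‖oscInt α c L‖ := by
  rw [oscInt_neg, RCLike.norm_conj]

theorem exists_nInt_decay {α : ℝ} (h0 : 0 < α) (h1 : α < 1) (c : ℝ) :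
    ∃ C R : ℝ, ∀ x : ℝ, R ≤ |x| → nInt α c x ≤ C * exp (-|x|) := by
  obtain ⟨C, R, h⟩ := exists_decay h0 h1 c (L := 0) (d := 0) le_rfl (by positivity)
  refine ⟨C, R, fun x hx => ?_⟩
  have := h x 0 hx le_rfl le_rfl
  rwa [Complex.ofReal_zero, zero_mul, add_zero, cNum_div_cDen_real, norm_mul, norm_exp_I_mul,
    mul_one, Complex.norm_real, Real.norm_of_nonneg (nInt_pos _ _ _).le] at this

theorem isBigO_nInt_comp {α : ℝ} (h0 : 0 < α) (h1 : α < 1) (c : ℝ) {h : ℝ} (hh : 0 < h) :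
    (fun x : ℝ => nInt α c (x * h)) =O[cocompact ℝ] fun x : ℝ => |x| ^ (-2 : ℝ) := by
  obtain ⟨C, R, hC⟩ := exists_nInt_decay h0 h1 c
  refine Asymptotics.IsBigO.of_bound (|C| * (2 / h ^ 2)) ?_
  have hx1 := (tendsto_norm_cocompact_atTop (E := ℝ)).eventually_ge_atTop (R / h)
  have hx2 := (tendsto_norm_cocompact_atTop (E := ℝ)).eventually_gt_atTop 0
  filter_upwards [hx1, hx2] with x h2 h3
  rw [Real.norm_eq_abs] at h2 h3
  have h4 : |x * h| = |x| * h := by rw [abs_mul, abs_of_pos hh]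
  have h5 := hC (x * h) (by rw [h4]; rwa [div_le_iff₀ hh] at h2)
  rw [h4] at h5
  rw [Real.norm_of_nonneg (nInt_pos _ _ _).le, Real.norm_of_nonneg (by positivity),
    rpow_neg h3.le, rpow_two]
  have h6 := sq_mul_exp_neg_le hh h3
  have h7 : exp (-(|x| * h)) ≤ 2 / h ^ 2 * (|x| ^ 2)⁻¹ := by
    rw [mul_comm |x| h]
    calc exp (-(h * |x|)) = |x|⁻¹ * (|x| * exp (-(h * |x|))) := by field_simp
      _ ≤ |x|⁻¹ * (2 / h ^ 2 * |x|⁻¹) := by gcongr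
      _ = _ := by ring
  calc nInt α c (x * h) ≤ C * exp (-(|x| * h)) := h5
    _ ≤ |C| * exp (-(|x| * h)) := by gcongr; exact le_abs_self C
    _ ≤ |C| * (2 / h ^ 2 * (|x| ^ 2)⁻¹) := by gcongr
    _ = _ := by ring

theorem summable_nInt {α : ℝ} (h0 : 0 < α) (h1 : α < 1) (c : ℝ) {h : ℝ} (hh : 0 < h) :
    Summable fun l : ℤ => nInt α c (l * h) :=
  summable_of_isBigO (Real.summable_abs_int_rpow one_lt_two)
    ((isBigO_nInt_comp h0 h1 c hh).comp_tendsto Int.tendsto_coe_cofinite)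

open FourierTransform in
theorem fourier_nInt_comp (α c : ℝ) {h : ℝ} (hh : 0 < h) (w : ℝ) :
    𝓕 (fun x : ℝ => (nInt α c (x * h) : ℂ)) w = (h : ℂ)⁻¹ * oscInt α c (-(2 * π * w / h)) := by
  rw [Real.fourier_real_eq_integral_exp_smul]
  have e := Measure.integral_comp_mul_right (fun y : ℝ => (nInt α c y : ℂ) *
    Complex.exp (((-(2 * π * w / h) : ℝ) : ℂ) * Complex.I * y)) h
  rw [abs_of_pos (inv_pos.2 hh)] at e
  unfold oscInt
  rw [← Complex.ofReal_inv, ← Complex.real_smul, ← e]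
  congr 1
  ext x
  rw [smul_eq_mul, mul_comm]
  congr 2
  have : (h : ℂ) ≠ 0 := by exact_mod_cast hh.ne'
  push_cast
  field_simp

/-- The error of the trapezoidal rule, by Poisson summation. -/
theorem abs_trapezoid_sub_le {α c h : ℝ} (h0 : 0 < α) (h1 : α < 1) (hh : 0 < h)
    (hs : Summable fun k : ℕ => ‖oscInt α c (2 * π * (k + 1) / h)‖) :
    |h * ∑' l : ℤ, nInt α c (l * h) - (∫ v, logi α v) / 2| ≤
      2 * ∑' k : ℕ, ‖oscInt α c (2 * π * (k + 1) / h)‖ := by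
  set F : ℤ → ℂ := fun n => (h : ℂ)⁻¹ * oscInt α c (-(2 * π * n / h)) with hF
  set a : ℕ → ℝ := fun k => ‖oscInt α c (2 * π * (k + 1) / h)‖ with ha
  have hn1 : ∀ k : ℕ, ‖F (k + 1)‖ = h⁻¹ * a k := by
    intro k
    simp only [hF, ha]
    rw [norm_mul, norm_oscInt_neg, norm_inv, Complex.norm_real, Real.norm_of_nonneg hh.le]
    push_cast; rfl
  have hn2 : ∀ k : ℕ, ‖F (-(k + 1))‖ = h⁻¹ * a k := by
    intro k
    simp only [hF, ha]
    rw [norm_mul, norm_inv, Complex.norm_real, Real.norm_of_nonneg hh.le]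
    congr 3
    push_cast; ring
  have s0 : Summable fun k => h⁻¹ * a k := hs.mul_left _
  have s1 : Summable fun k : ℕ => ‖F (k + 1)‖ := by simp only [hn1]; exact s0
  have s2 : Summable fun k : ℕ => ‖F (-(k + 1))‖ := by simp only [hn2]; exact s0
  -- The frequency n = 0 gives the integral; the others are paired as ±(k+1), with equal moduli by
  -- conjugation.
  have hsum := HasSum.of_add_one_of_neg_add_one (f := F) s1.of_norm.hasSum s2.of_norm.hasSum
  have hP := Real.tsum_eq_tsum_fourier_of_rpow_decay_of_summable
    (f := fun x : ℝ => (nInt α c (x * h) : ℂ))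
    (Complex.continuous_ofReal.comp ((continuous_nInt α c).comp (by fun_prop)))
    one_lt_two ((Asymptotics.isBigO_of_le _ fun x => by
      rw [Complex.norm_real]).trans (isBigO_nInt_comp h0 h1 c hh))
    (by simp only [fourier_nInt_comp α c hh]; exact hsum.summable) 0
  simp only [fourier_nInt_comp α c hh, zero_add] at hP
  have e1 : ∀ n : ℤ, (h : ℂ)⁻¹ * oscInt α c (-(2 * π * (n : ℝ) / h)) *
      fourier n ((0 : ℝ) : UnitAddCircle) = F n := by
    intro n
    rw [QuotientAddGroup.mk_zero, fourier_eval_zero, mul_one]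
  simp only [e1] at hP
  rw [hsum.tsum_eq] at hP
  have e0 : F 0 = (h : ℂ)⁻¹ * (((∫ v, logi α v) / 2 : ℝ) : ℂ) := by
    simp only [hF]
    congr 1
    rw [← (integrable_nInt h0 h1 c).2, ← integral_complex_ofReal]
    unfold oscInt
    simp
  rw [← Complex.ofReal_tsum, e0] at hP
  have hh0 : (h : ℂ) ≠ 0 := by exact_mod_cast hh.ne'
  have key : ((h * ∑' l : ℤ, nInt α c (l * h) - (∫ v, logi α v) / 2 : ℝ) : ℂ) =
      h * (∑' k : ℕ, F (k + 1) + ∑' k : ℕ, F (-(k + 1))) := by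
    rw [Complex.ofReal_sub, Complex.ofReal_mul, hP]
    field_simp
    ring
  have b1 : ‖∑' k : ℕ, F (k + 1)‖ ≤ h⁻¹ * ∑' k, a k := by
    refine (norm_tsum_le_tsum_norm s1).trans (le_of_eq ?_)
    simp only [hn1]
    exact tsum_mul_left
  have b2 : ‖∑' k : ℕ, F (-(k + 1))‖ ≤ h⁻¹ * ∑' k, a k := by
    refine (norm_tsum_le_tsum_norm s2).trans (le_of_eq ?_)
    simp only [hn2]
    exact tsum_mul_left
  rw [← Real.norm_eq_abs, ← Complex.norm_real, key, norm_mul, Complex.norm_real,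
    Real.norm_of_nonneg hh.le]
  calc _ ≤ h * (h⁻¹ * ∑' k, a k + h⁻¹ * ∑' k, a k) := by
        gcongr
        exact (norm_add_le _ _).trans (add_le_add b1 b2)
    _ = _ := by field_simp; ring

/-! ### Unimodal functions and truncation -/

/-- Unimodality, in the form in which it is used: on one side of every point the function is
monotone towards its mode. -/
def Unimodal (f : ℝ → ℝ) : Prop := ∀ a, MonotoneOn f (Iic a) ∨ AntitoneOn f (Ici a)

theorem Unimodal.comp_monotone {f g : ℝ → ℝ} (hf : Unimodal f) (hg : Monotone g) :
    Unimodal fun x => f (g x) := fun a =>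
  (hf (g a)).imp (fun h _ hx _ hy hxy => h (hg hx) (hg hy) (hg hxy))
    fun h _ hx _ hy hxy => h (hg hx) (hg hy) (hg hxy)

theorem Unimodal.monotone_comp {f g : ℝ → ℝ} (hf : Unimodal f) (hg : Monotone g) :
    Unimodal fun x => g (f x) := fun a =>
  (hf a).imp (fun h _ hx _ hy hxy => hg (h hx hy hxy)) fun h _ hx _ hy hxy => hg (h hx hy hxy)

theorem unimodal_of_hasDerivAt {H D : ℝ → ℝ} (hH : ∀ s, HasDerivAt H (-D s) s) (hD : Monotone D) :
    Unimodal H := by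
  intro a
  rcases le_total (D a) 0 with h | h
  · left
    refine monotoneOn_of_deriv_nonneg (convex_Iic a)
      (fun x _ => (hH x).continuousAt.continuousWithinAt)
      (fun x _ => (hH x).differentiableAt.differentiableWithinAt) fun x hx => ?_
    rw [interior_Iic] at hx
    rw [(hH x).deriv]
    have := hD (le_of_lt hx)
    linarith
  · right
    refine antitoneOn_of_deriv_nonpos (convex_Ici a)
      (fun x _ => (hH x).continuousAt.continuousWithinAt)
      (fun x _ => (hH x).differentiableAt.differentiableWithinAt) fun x hx => ?_
    rw [interior_Ici] at hx
    rw [(hH x).deriv]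
    have := hD (le_of_lt hx)
    linarith

theorem sum_Icc_neg_eq_sum_range (f : ℝ → ℝ) (M N : ℕ) :
    ∑ l ∈ Finset.Icc (-(M : ℤ)) N, f l = ∑ i ∈ Finset.range (M + N + 1), f (-(M : ℝ) + i) := by
  rw [Int.Icc_eq_finset_map, Finset.sum_map]
  have : ((N : ℤ) + 1 - -(M : ℤ)).toNat = M + N + 1 := by omega
  rw [this]
  refine Finset.sum_congr rfl fun i _ => ?_
  simp

/-- If f increases up to N, or decreases from -M on, the integral over [-M, N] is at most a
one-sided Riemann sum; M+N+1 nodes for M+N intervals leave one nonnegative term over. Otherwise f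
increases up to -M and decreases from N on, so the omitted terms are at most the tail integrals. -/
theorem sub_sum_le_of_unimodal {f : ℝ → ℝ} (hf0 : ∀ x, 0 ≤ f x) (hfi : Integrable f)
    (hu : Unimodal f) (M N : ℕ) (hs : Summable fun l : ℤ => f l) :
    (∫ x, f x) - ∑ l ∈ Finset.Icc (-(M : ℤ)) N, f l ≤
      (∫ x in Ioi (M : ℝ), f (-x)) + (∫ x in Ioi (N : ℝ), f x) +
        max 0 ((∫ x, f x) - ∑' l : ℤ, f l) := by
  have hmn : -(M : ℝ) ≤ N := by
    have := Nat.cast_nonneg (α := ℝ) M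
    have := Nat.cast_nonneg (α := ℝ) N
    linarith
  rw [integral_comp_neg_Ioi]
  have hsplit : ∫ x, f x = (∫ x in Iic (-(M : ℝ)), f x) + (∫ x in (-(M : ℝ))..N, f x) +
      ∫ x in Ioi (N : ℝ), f x := by
    rw [← intervalIntegral.integral_Iic_add_Ioi (b := -(M : ℝ)) hfi.integrableOn hfi.integrableOn,
      add_assoc]
    congr 1
    rw [← intervalIntegral.integral_Iic_sub_Iic hfi.integrableOn hfi.integrableOn]
    have h1 := intervalIntegral.integral_Iic_add_Ioi (b := -(M : ℝ)) (f := f) (μ := volume)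
      hfi.integrableOn hfi.integrableOn
    have h2 := intervalIntegral.integral_Iic_add_Ioi (b := (N : ℝ)) (f := f) (μ := volume)
      hfi.integrableOn hfi.integrableOn
    linarith
  have hN : (N : ℝ) = -(M : ℝ) + ((M + N : ℕ) : ℝ) := by push_cast; ring
  have hm0 := le_max_left 0 ((∫ x, f x) - ∑' l : ℤ, f l)
  rw [sum_Icc_neg_eq_sum_range]
  rcases hu N with hinc | hdec
  · have h1 : ∫ x in (-(M : ℝ))..N, f x ≤ ∑ i ∈ Finset.range (M + N), f (-(M : ℝ) + (i + 1 : ℕ)) := by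
      rw [hN]
      exact MonotoneOn.integral_le_sum (hinc.mono fun x hx => by rw [← hN] at hx; exact hx.2)
    rw [Finset.sum_range_succ']
    have := hf0 (-(M : ℝ) + (0 : ℕ))
    linarith
  rcases hu (-(M : ℝ)) with hinc | hdec'
  swap
  · have h1 : ∫ x in (-(M : ℝ))..N, f x ≤ ∑ i ∈ Finset.range (M + N), f (-(M : ℝ) + i) := by
      rw [hN]
      exact AntitoneOn.integral_le_sum (hdec'.mono fun x hx => hx.1)
    rw [Finset.sum_range_succ]
    have := hf0 (-(M : ℝ) + (M + N : ℕ))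
    linarith
  have key : ∑' l : ℤ, f l ≤ (∫ x in Iic (-(M : ℝ)), f x) +
      ∑ i ∈ Finset.range (M + N + 1), f (-(M : ℝ) + i) + ∫ x in Ioi (N : ℝ), f x := by
    refine hs.tsum_le_of_sum_le fun s => ?_
    obtain ⟨n, hn⟩ : ∃ n : ℕ, ∀ l ∈ s, l.natAbs ≤ n := ⟨s.sup Int.natAbs, fun l hl => Finset.le_sup hl⟩
    have hsub : s ⊆ Finset.Icc (-((n + M : ℕ) : ℤ)) ((N + n : ℕ) : ℤ) := by
      intro l hl
      have := hn l hl
      rw [Finset.mem_Icc]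
      omega
    refine (Finset.sum_le_sum_of_subset_of_nonneg hsub fun l _ _ => hf0 l).trans ?_
    rw [sum_Icc_neg_eq_sum_range, show n + M + (N + n) + 1 = n + ((M + N + 1) + n) by ring,
      Finset.sum_range_add, Finset.sum_range_add, ← add_assoc]
    have e1 : ∑ i ∈ Finset.range n, f (-((n + M : ℕ) : ℝ) + i) ≤ ∫ x in Iic (-(M : ℝ)), f x := by
      have hM : -(M : ℝ) = -((n + M : ℕ) : ℝ) + n := by push_cast; ring
      refine (MonotoneOn.sum_le_integral (hinc.mono fun x hx => ?_)).trans ?_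
      · rw [← hM] at hx; exact hx.2
      · rw [← hM, intervalIntegral.integral_of_le (by push_cast; linarith [Nat.cast_nonneg (α := ℝ) n])]
        exact setIntegral_mono_set hfi.integrableOn (Eventually.of_forall hf0)
          (Ioc_subset_Iic_self.eventuallyLE)
    have e2 : ∑ i ∈ Finset.range n, f (-((n + M : ℕ) : ℝ) + ((n + (M + N + 1 + i) : ℕ) : ℝ)) ≤
        ∫ x in Ioi (N : ℝ), f x := by
      have e : ∀ i : ℕ, -((n + M : ℕ) : ℝ) + ((n + (M + N + 1 + i) : ℕ) : ℝ) = N + (i + 1 : ℕ) := by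
        intro i; push_cast; ring
      simp only [e]
      refine (AntitoneOn.sum_le_integral (hdec.mono fun x hx => hx.1)).trans ?_
      rw [intervalIntegral.integral_of_le (by linarith [Nat.cast_nonneg (α := ℝ) n])]
      exact setIntegral_mono_set hfi.integrableOn (Eventually.of_forall hf0)
        (Ioc_subset_Ioi_self.eventuallyLE)
    have e3 : ∑ i ∈ Finset.range (M + N + 1), f (-((n + M : ℕ) : ℝ) + ((n + i : ℕ) : ℝ)) =
        ∑ i ∈ Finset.range (M + N + 1), f (-(M : ℝ) + i) := by
      refine Finset.sum_congr rfl fun i _ => ?_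
      congr 1; push_cast; ring
    rw [e3]
    linarith
  have := le_max_right 0 ((∫ x, f x) - ∑' l : ℤ, f l)
  linarith

theorem sub_truncTrapezoid_le_of_unimodal {f : ℝ → ℝ} (hf0 : ∀ x, 0 ≤ f x) (hfi : Integrable f)
    (hu : Unimodal f) (M N : ℕ) {h : ℝ} (hh : 0 < h) (hs : Summable fun l : ℤ => f (l * h)) :
    (∫ x, f x) - truncTrapezoid M N h f ≤
      (∫ x in Ioi (M * h), f (-x)) + (∫ x in Ioi (N * h), f x) +
        max 0 ((∫ x, f x) - h * ∑' l : ℤ, f (l * h)) := by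
  have key := sub_sum_le_of_unimodal (f := fun x => f (x * h)) (fun x => hf0 _)
    (hfi.comp_mul_right' hh.ne') (hu.comp_monotone fun x y hxy => by gcongr) M N hs
  have e0 := Measure.integral_comp_mul_right f h
  have e1 := integral_comp_mul_right_Ioi (fun x => f (-x)) M hh
  have e2 := integral_comp_mul_right_Ioi f N hh
  simp only [smul_eq_mul, abs_of_pos (inv_pos.2 hh), ← neg_mul] at e0 e1 e2
  rw [e0, e1, e2] at key
  have key2 := mul_le_mul_of_nonneg_left key hh.le
  rw [mul_sub, mul_add, mul_add, mul_max_of_nonneg _ _ hh.le, mul_sub, mul_zero] at key2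
  simp only [mul_inv_cancel_left₀ hh.ne'] at key2
  exact key2

theorem truncTrapezoid_le {f : ℝ → ℝ} (hf0 : ∀ x, 0 ≤ f x) (M N : ℕ) {h : ℝ} (hh : 0 < h)
    (hs : Summable fun l : ℤ => f (l * h)) :
    truncTrapezoid M N h f ≤ h * ∑' l : ℤ, f (l * h) :=
  mul_le_mul_of_nonneg_left (hs.sum_le_tsum _ fun _ _ => hf0 _) hh.le

/-! ### Tail integrals -/

theorem nInt_neg (α c x : ℝ) : nInt α c (-x) = nInt (1 - α) (-c) x := by
  unfold nInt
  rw [cosh_neg, sinh_neg, ← logi_neg]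
  congr 2
  ring

/-- Dropping the 1 in the denominator of `logi` leaves an exact derivative. -/
theorem integral_Ioi_nInt_le {α : ℝ} (h0 : 0 < α) (h1 : α < 1) (c b : ℝ) :
    ∫ x in Ioi b, nInt α c x ≤ exp (-((1 - α) * (π * (sinh b - c)))) / (2 * (1 - α)) := by
  have ha : 0 < 1 - α := by linarith
  set g : ℝ → ℝ := fun x => -(exp (-((1 - α) * (π * (sinh x - c)))) / (2 * (1 - α)))
  set g' : ℝ → ℝ := fun x => π / 2 * cosh x * exp (-((1 - α) * (π * (sinh x - c))))
  have hg : ∀ x, HasDerivAt g (g' x) x := by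
    intro x
    refine ((((((((hasDerivAt_sinh x).sub_const c).const_mul π).const_mul (1 - α)).neg).exp).div_const
      (2 * (1 - α))).neg).congr_deriv ?_
    simp only [g', Pi.neg_apply]
    field_simp
  have hpos : ∀ x, 0 ≤ g' x := fun x => by
    have := cosh_pos x
    simp only [g']; positivity
  have hlim : Tendsto g atTop (𝓝 0) := by
    have h2 : Tendsto (fun x => (1 - α) * (π * (sinh x - c))) atTop atTop := by
      refine Tendsto.const_mul_atTop ha (Tendsto.const_mul_atTop pi_pos ?_)
      refine tendsto_atTop_add_const_right _ _ ?_
      exact tendsto_atTop_mono' _ ((eventually_ge_atTop 0).mono fun x hx => self_le_sinh_iff.2 hx)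
        tendsto_id
    have := ((tendsto_exp_neg_atTop_nhds_zero.comp h2).div_const (2 * (1 - α))).neg
    simpa using this
  have hI := integrableOn_Ioi_deriv_of_nonneg' (a := b) (fun x _ => hg x) (fun x _ => hpos x) hlim
  have hE := integral_Ioi_of_hasDerivAt_of_nonneg' (a := b) (fun x _ => hg x)
    (fun x _ => hpos x) hlim
  calc _ ≤ ∫ x in Ioi b, g' x := by
        refine setIntegral_mono_on (integrable_nInt h0 h1 c).1.integrableOn hI measurableSet_Ioi
          fun x _ => ?_
        simp only [nInt, g']
        have := cosh_pos x
        gcongr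
        unfold logi
        rw [div_le_iff₀ (by positivity), mul_add, mul_one, ← exp_add]
        have e : -((1 - α) * (π * (sinh x - c))) + π * (sinh x - c) = α * (π * (sinh x - c)) := by
          ring
        rw [e]
        have := exp_pos (-((1 - α) * (π * (sinh x - c))))
        linarith
    _ = _ := by rw [hE]; simp only [g]; ring

/-- The tail of the normalized integrand, with `sinh` replaced by its exponential lower bound. -/
theorem integral_Ioi_nInt_le_exp {α : ℝ} (h0 : 0 < α) (h1 : α < 1) (c : ℝ) {b : ℝ} (hb : 0 ≤ b) :
    ∫ x in Ioi b, nInt α c x ≤ exp ((1 - α) * (π * c)) / (2 * (1 - α)) *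
      exp ((1 - α) * π / 2) * exp (-((1 - α) * π / 2) * exp b) := by
  refine (integral_Ioi_nInt_le h0 h1 c b).trans ?_
  have ha : 0 < 1 - α := by linarith
  rw [div_mul_eq_mul_div, div_mul_eq_mul_div, ← exp_add, ← exp_add]
  have h2 := sinh_abs_ge b
  rw [abs_of_nonneg hb] at h2
  have h3 := mul_le_mul_of_nonneg_left h2 (mul_pos ha pi_pos).le
  gcongr
  linarith

/-! ### Unimodality of the integrand and of the remainder -/

theorem exp_fifth_bounds : exp (1 / 5) ≤ 1.2215 ∧ exp (-(1 / 5)) ≤ 0.8188 := by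
  refine ⟨?_, exp_neg_le_of_one_le (by norm_num) (by norm_num)⟩
  refine le_of_pow_le_pow_left₀ (n := 5) (by norm_num) (by norm_num) ?_
  rw [← exp_nat_mul]
  have h : ((5 : ℕ) : ℝ) * (1 / 5) = 1 := by norm_num
  rw [h]
  exact exp_one_lt_d9.le.trans (by norm_num)

theorem cosh_fifth_le (n : ℕ) {r : ℝ} (h : 1.2215 ^ n + 0.8188 ^ n ≤ 2 * r) :
    cosh (n * (1 / 5)) ≤ r := by
  obtain ⟨h1, h2⟩ := exp_fifth_bounds
  rw [cosh_eq, ← mul_neg, exp_nat_mul, exp_nat_mul]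
  have h3 : exp (1 / 5) ^ n ≤ 1.2215 ^ n := by gcongr
  have h4 : exp (-(1 / 5)) ^ n ≤ 0.8188 ^ n := by gcongr
  linarith

theorem convexOn_cosh : ConvexOn ℝ univ cosh := by
  have h1 : ConvexOn ℝ univ fun x : ℝ => exp (-x) := by
    have := convexOn_exp.comp_linearMap (-LinearMap.id : ℝ →ₗ[ℝ] ℝ)
    exact this
  have h2 := (convexOn_exp.add h1).smul (by norm_num : (0 : ℝ) ≤ 1 / 2)
  refine h2.congr fun x _ => ?_
  simp only [Pi.add_apply, smul_eq_mul, cosh_eq]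
  ring

theorem cosh_le_chord {x y z A B : ℝ} (hxy : x < y) (hz1 : x ≤ z) (hz2 : z ≤ y)
    (hA : cosh x ≤ A) (hB : cosh y ≤ B) : (y - x) * cosh z ≤ (y - z) * A + (z - x) * B := by
  have h := convexOn_cosh.2 (mem_univ x) (mem_univ y)
    (div_nonneg (sub_nonneg.2 hz2) (sub_pos.2 hxy).le)
    (div_nonneg (sub_nonneg.2 hz1) (sub_pos.2 hxy).le)
    (by have := (sub_pos.2 hxy).ne'; field_simp; ring)
  have hne := (sub_pos.2 hxy).ne'
  have e : (y - z) / (y - x) * x + (z - x) / (y - x) * y = z := by field_simp; ring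
  simp only [smul_eq_mul] at h
  rw [e] at h
  have h2 := mul_le_mul_of_nonneg_left h (sub_pos.2 hxy).le
  have e2 : (y - x) * ((y - z) / (y - x) * cosh x + (z - x) / (y - x) * cosh y) =
      (y - z) * cosh x + (z - x) * cosh y := by field_simp
  rw [e2] at h2
  have h3 := mul_le_mul_of_nonneg_left hA (sub_nonneg.2 hz2)
  have h4 := mul_le_mul_of_nonneg_left hB (sub_nonneg.2 hz1)
  linarith

/-- The numerical reason for 3/8. The argument of cosh stays below 2.2; the convex cosh is bounded
by its chords between 0.6, 1, 1.4, 1.8, 2.2, and by a constant below 0.6. Each v is such a chord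
with π replaced by a decimal bound. -/
theorem one_sub_sq_mul_cosh_le {a : ℝ} (h0 : 0 ≤ a) (h1 : a ≤ 1) :
    (1 - a ^ 2) * cosh (π / 2 * (a + 3 / 8)) ^ 2 ≤ π ^ 2 / 4 * (1 + a ^ 2) ^ 2 := by
  have p1 := pi_gt_d4
  have p2 := pi_lt_d4
  obtain ⟨q, -⟩ := pi_sq_bounds
  suffices h : ∃ v, cosh (π / 2 * (a + 3 / 8)) ≤ v ∧ (1 - a ^ 2) * v ^ 2 ≤ 2.4674 * (1 + a ^ 2) ^ 2 by
    obtain ⟨v, hv1, hv2⟩ := h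
    have hc := cosh_pos (π / 2 * (a + 3 / 8))
    have ha : 0 ≤ 1 - a ^ 2 := by nlinarith
    calc _ ≤ (1 - a ^ 2) * v ^ 2 := by gcongr
      _ ≤ _ := hv2
      _ ≤ _ := by gcongr; linarith
  have hz0 : 0 ≤ π / 2 * (a + 3 / 8) := by positivity
  have hz1 : π / 2 * (a + 3 / 8) ≤ 1.5708 * (a + 3 / 8) := by gcongr; linarith
  have hz2 : 1.57075 * (a + 3 / 8) ≤ π / 2 * (a + 3 / 8) := by gcongr; linarith
  set z := π / 2 * (a + 3 / 8)
  have c3 : cosh 0.6 ≤ 1.19 := by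
    have := cosh_fifth_le 3 (r := 1.19) (by norm_num); norm_num at this ⊢; exact this
  have c5 : cosh 1 ≤ 1.5445 := by
    have := cosh_fifth_le 5 (r := 1.5445) (by norm_num); norm_num at this ⊢; exact this
  have c7 : cosh 1.4 ≤ 2.155 := by
    have := cosh_fifth_le 7 (r := 2.155) (by norm_num); norm_num at this ⊢; exact this
  have c9 : cosh 1.8 ≤ 3.115 := by
    have := cosh_fifth_le 9 (r := 3.115) (by norm_num); norm_num at this ⊢; exact this
  have c11 : cosh 2.2 ≤ 4.59 := by
    have := cosh_fifth_le 11 (r := 4.59) (by norm_num); norm_num at this ⊢; exact this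
  rcases le_or_gt z 0.6 with h | h
  · refine ⟨1.19, (cosh_le_cosh.2 ?_).trans c3, by nlinarith [sq_nonneg a]⟩
    rw [abs_of_nonneg hz0, abs_of_nonneg (by norm_num)]; exact h
  rcases le_or_gt z 1 with h2 | h2
  · have := cosh_le_chord (by norm_num) h.le h2 c3 c5
    refine ⟨1.3924 * a + 1.1804, by linarith, ?_⟩
    have ha : a ≤ 0.262 := by linarith
    nlinarith [sq_nonneg a, mul_nonneg h0 h0, mul_nonneg (mul_nonneg h0 h0) h0]
  rcases le_or_gt z 1.4 with h3 | h3
  · have := cosh_le_chord (by norm_num) h2.le h3 c5 c7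
    refine ⟨2.3975 * a + 0.9174, by linarith, ?_⟩
    have ha : a ≤ 0.5163 := by linarith
    nlinarith [sq_nonneg a, sq_nonneg (a - 0.5), mul_nonneg (mul_nonneg h0 h0) h0, sq_nonneg (a ^ 2 + a)]
  rcases le_or_gt z 1.8 with h4 | h4
  · have := cosh_le_chord (by norm_num) h3.le h4 c7 c9
    refine ⟨3.77 * a + 0.2088, by linarith, ?_⟩
    have ha : a ≤ 0.771 := by linarith
    have ha2 : 0.516 ≤ a := by linarith
    nlinarith [sq_nonneg a, sq_nonneg (a - 0.6), sq_nonneg (a ^ 2 - 0.36), mul_nonneg (mul_nonneg h0 h0) h0]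
  · have := cosh_le_chord (by norm_num) h4.le (by linarith) c9 c11
    refine ⟨5.7924 * a - 1.3496, by linarith, ?_⟩
    have ha2 : 0.77 ≤ a := by linarith
    nlinarith [sq_nonneg a, sq_nonneg (a - 0.6), sq_nonneg (a ^ 2 - 0.36), mul_nonneg (mul_nonneg h0 h0) h0]

/-- The logistic function. -/
def logistic (v : ℝ) : ℝ := exp v / (1 + exp v)

theorem hasDerivAt_logistic (v : ℝ) : HasDerivAt logistic (1 / (4 * cosh (v / 2) ^ 2)) v := by
  have h0 : 1 + exp v ≠ 0 := by positivity
  refine ((hasDerivAt_exp v).div ((hasDerivAt_exp v).const_add 1) h0).congr_deriv ?_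
  have hc : cosh (v / 2) ≠ 0 := (cosh_pos _).ne'
  rw [one_add_exp_sq]
  have := exp_pos v
  field_simp
  ring

theorem monotone_logistic : Monotone logistic := by
  refine monotone_of_deriv_nonneg (fun v => (hasDerivAt_logistic v).differentiableAt) fun v => ?_
  rw [(hasDerivAt_logistic v).deriv]
  positivity

/-- Up to a constant this is minus the derivative of `logInt` in s = sinh x, so its monotonicity is
log-concavity in s. The factor cosh x opposes it only for |s| < 1, where |s - c| ≤ |s| + 3/8 reduces
the claim to `one_sub_sq_mul_cosh_le`. -/
theorem monotone_logistic_sub {c : ℝ} (hc0 : 0 ≤ c) (hc : c ≤ 3 / 8) :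
    Monotone fun s => π * (logistic (π * (s - c))) - s / (1 + s ^ 2) := by
  have hd : ∀ s : ℝ, HasDerivAt (fun s => π * (logistic (π * (s - c))) - s / (1 + s ^ 2))
      (π * (1 / (4 * cosh (π * (s - c) / 2) ^ 2) * π) - (1 - s ^ 2) / (1 + s ^ 2) ^ 2) s := by
    intro s
    have h0 : 1 + s ^ 2 ≠ 0 := by positivity
    have h1 := (((hasDerivAt_id s).sub_const c).const_mul π)
    have h2 := ((hasDerivAt_logistic (π * (s - c))).comp s h1).const_mul π
    refine (h2.sub ((hasDerivAt_id s).div ((hasDerivAt_pow 2 s).const_add 1) h0)).congr_deriv ?_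
    simp only [id]
    push_cast
    ring
  refine monotone_of_deriv_nonneg (fun s => (hd s).differentiableAt) fun s => ?_
  rw [(hd s).deriv, sub_nonneg]
  have hcp := cosh_pos (π * (s - c) / 2)
  have hpi := pi_pos
  rcases le_or_gt 1 (s ^ 2) with h | h
  · exact (div_nonpos_of_nonpos_of_nonneg (by linarith) (by positivity)).trans (by positivity)
  have ha1 : |s| ≤ 1 := by
    rw [← sq_abs] at h
    nlinarith [abs_nonneg s]
  have key := one_sub_sq_mul_cosh_le (abs_nonneg s) ha1
  rw [sq_abs] at key
  have hcosh : cosh (π * (s - c) / 2) ≤ cosh (π / 2 * (|s| + 3 / 8)) := by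
    refine cosh_le_cosh.2 ?_
    rw [abs_of_nonneg (by positivity : 0 ≤ π / 2 * (|s| + 3 / 8)), abs_div, abs_mul,
      abs_of_pos hpi, abs_of_pos (two_pos : (0 : ℝ) < 2)]
    have : |s - c| ≤ |s| + 3 / 8 := by
      refine (abs_sub s c).trans ?_
      rw [abs_of_nonneg hc0]
      gcongr
    calc _ ≤ π * (|s| + 3 / 8) / 2 := by gcongr
      _ = _ := by ring
  have h3 : (1 - s ^ 2) * cosh (π * (s - c) / 2) ^ 2 ≤ π ^ 2 / 4 * (1 + s ^ 2) ^ 2 := by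
    refine le_trans ?_ key
    have : 0 ≤ 1 - s ^ 2 := by linarith
    gcongr
  rw [div_le_iff₀ (by positivity)]
  have e : π * (1 / (4 * cosh (π * (s - c) / 2) ^ 2) * π) * (1 + s ^ 2) ^ 2 =
      π ^ 2 / 4 * (1 + s ^ 2) ^ 2 / cosh (π * (s - c) / 2) ^ 2 := by
    field_simp
  rw [e, le_div_iff₀ (by positivity)]
  exact h3

/-- Logarithm of the integrand as a function of `s = sinh x`, up to a constant. -/
def logInt (α c s : ℝ) : ℝ :=
  log (1 + s ^ 2) / 2 + α * (π * (s - c)) - log (1 + exp (π * (s - c)))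

theorem hasDerivAt_log_one_add_exp (c s : ℝ) :
    HasDerivAt (fun s => log (1 + exp (π * (s - c)))) (π * logistic (π * (s - c))) s := by
  have h0 : 1 + exp (π * (s - c)) ≠ 0 := by positivity
  refine ((((((hasDerivAt_id s).sub_const c).const_mul π).exp).const_add 1).log h0).congr_deriv ?_
  unfold logistic
  simp only [id]
  ring

theorem hasDerivAt_logInt (α c s : ℝ) :
    HasDerivAt (logInt α c) (-(π * logistic (π * (s - c)) - s / (1 + s ^ 2) - α * π)) s := by
  have h0 : 1 + s ^ 2 ≠ 0 := by positivity
  have h1 := ((hasDerivAt_pow 2 s).const_add 1).log h0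
  have h2 := ((((hasDerivAt_id s).sub_const c).const_mul π).const_mul α)
  refine (((h1.div_const 2).add h2).sub (hasDerivAt_log_one_add_exp c s)).congr_deriv ?_
  push_cast
  field_simp
  ring

theorem nInt_eq_exp_logInt (α c x : ℝ) : nInt α c x = π / 2 * exp (logInt α c (sinh x)) := by
  unfold nInt logInt logi
  rw [exp_sub, exp_add, exp_log (by positivity), ← log_sqrt (by positivity),
    exp_log (by positivity)]
  have : √(1 + sinh x ^ 2) = cosh x := by
    rw [add_comm, ← cosh_sq, sqrt_sq (cosh_pos x).le]
  rw [this]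
  ring

theorem unimodal_nInt {c : ℝ} (hc0 : 0 ≤ c) (hc : c ≤ 3 / 8) (α : ℝ) : Unimodal (nInt α c) := by
  have h := unimodal_of_hasDerivAt (hasDerivAt_logInt α c)
    fun x y hxy => sub_le_sub_right (monotone_logistic_sub hc0 hc hxy) _
  have h2 := (h.comp_monotone sinh_strictMono.monotone).monotone_comp
    (g := fun y => π / 2 * exp y) fun x y hxy => by
      have := pi_pos
      dsimp only
      gcongr
  have e : nInt α c = fun x => π / 2 * exp (logInt α c (sinh x)) := by
    ext x; exact nInt_eq_exp_logInt α c x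
  rwa [e]

/-- The part of the integrand left after removing its translate to `c = 0`. -/
def remInt (α c x : ℝ) : ℝ := nInt α c x - exp (-(α * (π * c))) * nInt α 0 x

/-- Over a common denominator the difference is (1 - e^(-πc)) `nInt α c` times the logistic function
of π sinh x: a product, hence accessible to logarithms. -/
theorem remInt_eq (α c x : ℝ) :
    remInt α c x = (1 - exp (-(π * c))) * (π / 2) *
      exp (logInt α c (sinh x) + (π * (sinh x - 0) - log (1 + exp (π * (sinh x - 0))))) := by
  have h1 := nInt_eq_exp_logInt α c x
  rw [exp_add, exp_sub, exp_log (by positivity)]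
  have e : (1 - exp (-(π * c))) * (π / 2) * (exp (logInt α c (sinh x)) *
      (exp (π * (sinh x - 0)) / (1 + exp (π * (sinh x - 0))))) =
      (1 - exp (-(π * c))) * (exp (π * (sinh x - 0)) / (1 + exp (π * (sinh x - 0)))) *
        nInt α c x := by rw [h1]; ring
  rw [e]
  unfold remInt nInt logi
  have e1 : exp (α * (π * (sinh x - c))) = exp (α * (π * (sinh x - 0))) * exp (-(α * (π * c))) := by
    rw [← exp_add]; congr 1; ring
  have e2 : exp (π * (sinh x - c)) = exp (π * (sinh x - 0)) * exp (-(π * c)) := by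
    rw [← exp_add]; congr 1; ring
  rw [e1, e2]
  have h3 := exp_pos (π * (sinh x - 0))
  have h4 := exp_pos (-(π * c))
  field_simp
  ring

/-- The additional logistic factor, centred at s = 0, offsets the factor cosh x as in the case c =
0, so the size of c no longer matters. -/
theorem unimodal_remInt {c : ℝ} (hc0 : 0 ≤ c) (α : ℝ) : Unimodal (remInt α c) := by
  have hd : ∀ s, HasDerivAt (fun s => logInt α c s + (π * (s - 0) - log (1 + exp (π * (s - 0)))))
      (-(π * logistic (π * (s - c)) + (π * logistic (π * (s - 0)) - s / (1 + s ^ 2)) -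
        (α + 1) * π)) s := by
    intro s
    refine ((hasDerivAt_logInt α c s).add ((((hasDerivAt_id s).sub_const 0).const_mul π).sub
      (hasDerivAt_log_one_add_exp 0 s))).congr_deriv ?_
    ring
  have h := unimodal_of_hasDerivAt hd fun x y hxy => by
    have h1 := monotone_logistic_sub le_rfl (by norm_num) hxy
    have h2 : logistic (π * (x - c)) ≤ logistic (π * (y - c)) :=
      monotone_logistic (by have := pi_pos; gcongr)
    have h3 := mul_le_mul_of_nonneg_left h2 pi_pos.le
    simp only at h1 ⊢
    linarith
  have hk : 0 ≤ (1 - exp (-(π * c))) * (π / 2) := by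
    have : exp (-(π * c)) ≤ 1 := exp_le_one_iff.2 (by
      have := mul_nonneg pi_pos.le hc0
      linarith)
    have := pi_pos
    exact mul_nonneg (by linarith) (by positivity)
  have h2 := (h.comp_monotone sinh_strictMono.monotone).monotone_comp
    (g := fun y => (1 - exp (-(π * c))) * (π / 2) * exp y) fun x y hxy => by
      dsimp only
      gcongr
  have e : remInt α c = fun x => (1 - exp (-(π * c))) * (π / 2) *
      exp (logInt α c (sinh x) + (π * (sinh x - 0) - log (1 + exp (π * (sinh x - 0))))) := by
    ext x; exact remInt_eq α c x
  rwa [e]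

theorem remInt_nonneg {c : ℝ} (hc0 : 0 ≤ c) (α x : ℝ) : 0 ≤ remInt α c x := by
  rw [remInt_eq]
  have : exp (-(π * c)) ≤ 1 := exp_le_one_iff.2 (by
    have := mul_nonneg pi_pos.le hc0
    linarith)
  have h2 : 0 ≤ 1 - exp (-(π * c)) := by linarith
  positivity

/-! ### Assembling the error of the truncated rule -/

theorem kap_grid (h t : ℝ) (k : ℕ) : kap (2 * π * (k + 1) / h) t =
    √(1 + t ^ 2) ^ 3 * exp (-(2 * (π * arctan t / h))) ^ (k + 1) := by
  unfold kap
  rw [← exp_nat_mul]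
  congr 2
  push_cast
  ring

theorem hasSum_kap_grid {h t : ℝ} (hh : 0 < h) (ht : 0 < t) :
    HasSum (fun k : ℕ => kap (2 * π * (k + 1) / h) t)
      (√(1 + t ^ 2) ^ 3 / (exp (2 * (π * arctan t / h)) - 1)) := by
  have ha : 0 < 2 * (π * arctan t / h) := by
    have := arctan_pos.2 ht
    have := pi_pos
    positivity
  set a := 2 * (π * arctan t / h)
  have hr1 : exp (-a) < 1 := by
    rw [← exp_zero]
    exact exp_lt_exp.2 (by linarith)
  have hs := ((hasSum_geometric_of_lt_one (exp_pos (-a)).le hr1).mul_left (exp (-a))).mul_left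
    (√(1 + t ^ 2) ^ 3)
  have e : (fun k : ℕ => kap (2 * π * (k + 1) / h) t) =
      fun k : ℕ => √(1 + t ^ 2) ^ 3 * (exp (-a) * exp (-a) ^ k) := by
    ext k
    rw [kap_grid, pow_succ' (exp _)]
  rw [e]
  have h1 : exp a - 1 ≠ 0 := by
    have := one_lt_exp_iff.2 ha
    exact (sub_pos.2 this).ne'
  have h2 : 1 - exp (-a) ≠ 0 := (sub_pos.2 hr1).ne'
  have h3 : exp (-a) * exp a = 1 := by rw [← exp_add]; simp
  have h4 : exp (-a) * (1 - exp (-a))⁻¹ = (exp a - 1)⁻¹ := by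
    rw [← div_eq_mul_inv, inv_eq_one_div, div_eq_div_iff h2 h1]
    linear_combination h3
  rw [div_eq_mul_inv, ← h4]
  exact hs

section Error

variable {α c h t : ℝ}

theorem summable_oscInt (h0 : 0 < α) (h1 : α < 1) (hc : 0 ≤ c) (hh : 0 < h) (ht : 0 < t)
    (hT : c = 0 ∨ ∃ T, t ≤ T ∧ c ^ 2 * (T ^ 2 * (1 + T ^ 2)) = 1) :
    Summable fun k : ℕ => ‖oscInt α c (2 * π * (k + 1) / h)‖ :=
  Summable.of_nonneg_of_le (fun _ => norm_nonneg _)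
    (fun k => norm_oscInt_le_kap h0 h1 (by have := pi_pos; positivity) hc ht hT)
    ((hasSum_kap_grid hh ht).summable.mul_left _)

theorem abs_trapezoid_sub_le_kap (h0 : 0 < α) (h1 : α < 1) (hc : 0 ≤ c) (hh : 0 < h) (ht : 0 < t)
    (hT : c = 0 ∨ ∃ T, t ≤ T ∧ c ^ 2 * (T ^ 2 * (1 + T ^ 2)) = 1) :
    |h * ∑' l : ℤ, nInt α c (l * h) - (∫ v, logi α v) / 2| ≤
      2 * (1 / (α * (1 - α)) * (√(1 + t ^ 2) ^ 3 / (exp (2 * (π * arctan t / h)) - 1))) := by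
  have hs := summable_oscInt h0 h1 hc hh ht hT
  refine (abs_trapezoid_sub_le h0 h1 hh hs).trans ?_
  have hk := hasSum_kap_grid hh ht
  rw [← hk.tsum_eq, ← tsum_mul_left (a := 1 / (α * (1 - α)))]
  refine mul_le_mul_of_nonneg_left (hs.tsum_le_tsum (fun k => ?_) (hk.summable.mul_left _))
    zero_le_two
  exact norm_oscInt_le_kap h0 h1 (by have := pi_pos; positivity) hc ht hT

theorem abs_add_abs_trapezoid_sub_le {T : ℝ} (h0 : 0 < α) (h1 : α < 1) (hc : 3 / 8 ≤ c)
    (hh : 0 < h) (ht : 0 < t) (htT : t ≤ T) (hT : c ^ 2 * (T ^ 2 * (1 + T ^ 2)) = 1)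
    (hbig : 4 * √(1 + t ^ 2) ^ 3 + 1 ≤ exp (2 * (π * arctan t / h))) :
    |h * ∑' l : ℤ, nInt α c (l * h) - (∫ v, logi α v) / 2| + exp (-(α * (π * c))) *
      |h * ∑' l : ℤ, nInt α 0 (l * h) - (∫ v, logi α v) / 2| ≤
      2 * (1 / (α * (1 - α)) * (√(1 + t ^ 2) ^ 3 / (exp (2 * (π * arctan t / h)) - 1))) := by
  have hs := summable_oscInt h0 h1 (by linarith) hh ht (Or.inr ⟨T, htT, hT⟩)
  have hs0 := summable_oscInt h0 h1 le_rfl hh ht (Or.inl rfl)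
  have e1 := abs_trapezoid_sub_le h0 h1 hh hs
  have e2 := mul_le_mul_of_nonneg_left (abs_trapezoid_sub_le h0 h1 hh hs0)
    (exp_pos (-(α * (π * c)))).le
  have hk := hasSum_kap_grid hh ht
  refine (add_le_add e1 e2).trans ?_
  rw [mul_left_comm, ← mul_add, ← tsum_mul_left, ← hs.tsum_add (hs0.mul_left _), ← hk.tsum_eq,
    ← tsum_mul_left (a := 1 / (α * (1 - α)))]
  refine mul_le_mul_of_nonneg_left ((hs.add (hs0.mul_left _)).tsum_le_tsum (fun k => ?_)
    (hk.summable.mul_left _)) zero_le_two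
  have hpi := pi_pos
  refine norm_oscInt_add_le_kap h0 h1 (by positivity) hc ht htT hT (hbig.trans ?_)
  refine exp_le_exp.2 ?_
  have ha := arctan_pos.2 ht
  have e : 2 * π * (k + 1) / h * arctan t = 2 * (π * arctan t / h) + k * (2 * (π * arctan t / h)) := by
    ring
  rw [e]
  have : 0 ≤ k * (2 * (π * arctan t / h)) := by positivity
  linarith

theorem integrable_nInt_neg (h0 : 0 < α) (h1 : α < 1) (c : ℝ) :
    Integrable fun x => nInt α c (-x) := (integrable_nInt h0 h1 c).1.comp_neg

theorem truncTrapezoid_nonneg {f : ℝ → ℝ} (hf : ∀ x, 0 ≤ f x) (M N : ℕ) (hh : 0 < h) :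
    0 ≤ truncTrapezoid M N h f :=
  mul_nonneg hh.le (Finset.sum_nonneg fun _ _ => hf _)

theorem sub_truncTrapezoid_nInt_le (h0 : 0 < α) (h1 : α < 1) (hc : 0 ≤ c) (hh : 0 < h) (ht : 0 < t)
    (hT : c = 0 ∨ ∃ T, t ≤ T ∧ c ^ 2 * (T ^ 2 * (1 + T ^ 2)) = 1) (M N : ℕ) :
    (∫ x, nInt α c x) - truncTrapezoid M N h (nInt α c) ≤
      (∫ x in Ioi (M * h), nInt α c (-x)) + (∫ x in Ioi (N * h), nInt α c x) +
      2 * (1 / (α * (1 - α)) * (√(1 + t ^ 2) ^ 3 / (exp (2 * (π * arctan t / h)) - 1))) := by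
  have hpos := fun x => (nInt_pos α c x).le
  obtain ⟨hi, hI⟩ := integrable_nInt h0 h1 c
  have hsum := summable_nInt h0 h1 c hh
  have htail1 : 0 ≤ ∫ x in Ioi (M * h), nInt α c (-x) := integral_nonneg fun x => hpos _
  have htail2 : 0 ≤ ∫ x in Ioi (N * h), nInt α c x := integral_nonneg fun x => hpos _
  have hE : 1 < exp (2 * (π * arctan t / h)) := by
    have := arctan_pos.2 ht
    have := pi_pos
    exact one_lt_exp_iff.2 (by positivity)
  -- In the second alternative the last term of the bound is at least 1/(2α(1-α)), hence at least
  -- the whole integral, and the sum is nonnegative.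
  rcases le_or_gt (4 * √(1 + t ^ 2) ^ 3 + 1) (exp (2 * (π * arctan t / h))) with hbig | hsmall
  swap
  · have h2 := integral_logi_le h0 h1
    have h3 := truncTrapezoid_nonneg hpos M N hh
    have hB := four_le_inv_mul h0 h1
    have h4 : 1 / 4 ≤ √(1 + t ^ 2) ^ 3 / (exp (2 * (π * arctan t / h)) - 1) := by
      rw [le_div_iff₀ (by linarith)]; linarith
    have h5 := mul_le_mul_of_nonneg_left h4 (by linarith : 0 ≤ 1 / (α * (1 - α)))
    rw [hI]
    linarith
  rcases le_or_gt c (3 / 8) with hc2 | hc2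
  · have h2 := abs_trapezoid_sub_le_kap h0 h1 hc hh ht hT
    have h3 := sub_truncTrapezoid_le_of_unimodal hpos hi (unimodal_nInt hc hc2 α) M N hh hsum
    refine h3.trans (add_le_add le_rfl (le_trans ?_ h2))
    rw [hI, abs_sub_comm]
    exact max_le (abs_nonneg _) (le_abs_self _)
  · obtain ⟨T, htT, hT⟩ : ∃ T, t ≤ T ∧ c ^ 2 * (T ^ 2 * (1 + T ^ 2)) = 1 :=
      hT.resolve_left (by linarith)
    have h2 := abs_add_abs_trapezoid_sub_le h0 h1 hc2.le hh ht htT hT hbig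
    obtain ⟨hi0, hI0⟩ := integrable_nInt h0 h1 0
    have hsum0 := summable_nInt h0 h1 0 hh
    set e := exp (-(α * (π * c)))
    have he : 0 < e := exp_pos _
    have hR : remInt α c = fun x => nInt α c x - e * nInt α 0 x := rfl
    have hiR : Integrable (remInt α c) := hi.sub (hi0.const_mul e)
    have hsumR : Summable fun l : ℤ => remInt α c (l * h) := hsum.sub (hsum0.mul_left e)
    have k1 := sub_truncTrapezoid_le_of_unimodal (fun x => (nInt_pos α 0 x).le) hi0
      (unimodal_nInt le_rfl (by norm_num) α) M N hh hsum0
    have k2 := sub_truncTrapezoid_le_of_unimodal (remInt_nonneg hc α) hiR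
      (unimodal_remInt hc α) M N hh hsumR
    have r1 : ∫ x, remInt α c x = (∫ x, nInt α c x) - e * ∫ x, nInt α 0 x := by
      rw [hR, integral_sub hi (hi0.const_mul e), integral_const_mul]
    have r2 : truncTrapezoid M N h (remInt α c) =
        truncTrapezoid M N h (nInt α c) - e * truncTrapezoid M N h (nInt α 0) := by
      unfold truncTrapezoid
      rw [mul_left_comm, ← mul_sub]
      congr 1
      rw [Finset.mul_sum, ← Finset.sum_sub_distrib]
      rfl
    have r3 : ∫ x in Ioi (M * h), remInt α c (-x) =
        (∫ x in Ioi (M * h), nInt α c (-x)) - e * ∫ x in Ioi (M * h), nInt α 0 (-x) := by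
      rw [hR, integral_sub (integrable_nInt_neg h0 h1 c).integrableOn
        ((integrable_nInt_neg h0 h1 0).const_mul e).integrableOn, integral_const_mul]
    have r4 : ∫ x in Ioi (N * h), remInt α c x =
        (∫ x in Ioi (N * h), nInt α c x) - e * ∫ x in Ioi (N * h), nInt α 0 x := by
      rw [hR, integral_sub hi.integrableOn (hi0.const_mul e).integrableOn, integral_const_mul]
    have r5 : ∑' l : ℤ, remInt α c (l * h) =
        ∑' l : ℤ, nInt α c (l * h) - e * ∑' l : ℤ, nInt α 0 (l * h) := by
      rw [← tsum_mul_left, ← hsum.tsum_sub (hsum0.mul_left e)]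
      rfl
    rw [r1, r2, r3, r4, r5, hI, hI0] at k2
    rw [hI0] at k1
    rw [hI]
    have k3 := mul_le_mul_of_nonneg_left k1 he.le
    set I := (∫ v, logi α v) / 2
    set A := ∑' l : ℤ, nInt α c (l * h)
    set A0 := ∑' l : ℤ, nInt α 0 (l * h)
    -- The tails of the two unimodal pieces add up to those of the integrand; only the positive
    -- parts of the two errors need to be recombined.
    have hmax : e * max 0 (I - h * A0) + max 0 (I - e * I - h * (A - e * A0)) ≤
        |h * A - I| + e * |h * A0 - I| := by
      rw [mul_max_of_nonneg _ _ he.le, mul_zero]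
      have a1 := neg_abs_le (h * A - I)
      have a2 := mul_le_mul_of_nonneg_left (neg_abs_le (h * A0 - I)) he.le
      have a3 := mul_le_mul_of_nonneg_left (le_abs_self (h * A0 - I)) he.le
      have a4 := abs_nonneg (h * A - I)
      have a5 := mul_nonneg he.le (abs_nonneg (h * A0 - I))
      rcases max_cases 0 (e * (I - h * A0)) with ⟨m1, _⟩ | ⟨m1, _⟩ <;>
      rcases max_cases 0 (I - e * I - h * (A - e * A0)) with ⟨m2, _⟩ | ⟨m2, _⟩ <;>
      rw [m1, m2] <;> linarith
    linarith

theorem abs_sub_truncTrapezoid_nInt_le_of_nonneg (h0 : 0 < α) (h1 : α < 1) (hc : 0 ≤ c)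
    (hh : 0 < h) (ht : 0 < t)
    (hT : c = 0 ∨ ∃ T, t ≤ T ∧ c ^ 2 * (T ^ 2 * (1 + T ^ 2)) = 1) (M N : ℕ) :
    |(∫ x, nInt α c x) - truncTrapezoid M N h (nInt α c)| ≤
      (∫ x in Ioi (M * h), nInt α c (-x)) + (∫ x in Ioi (N * h), nInt α c x) +
      2 * (1 / (α * (1 - α)) * (√(1 + t ^ 2) ^ 3 / (exp (2 * (π * arctan t / h)) - 1))) := by
  have hpos := fun x => (nInt_pos α c x).le
  refine abs_le'.2 ⟨sub_truncTrapezoid_nInt_le h0 h1 hc hh ht hT M N, ?_⟩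
  have h2 := (le_abs_self _).trans (abs_trapezoid_sub_le_kap h0 h1 hc hh ht hT)
  have h3 := truncTrapezoid_le hpos M N hh (summable_nInt h0 h1 c hh)
  have htail1 : 0 ≤ ∫ x in Ioi (M * h), nInt α c (-x) := integral_nonneg fun x => hpos _
  have htail2 : 0 ≤ ∫ x in Ioi (N * h), nInt α c x := integral_nonneg fun x => hpos _
  rw [(integrable_nInt h0 h1 c).2]
  linarith

theorem truncTrapezoid_comp_neg (f : ℝ → ℝ) (M N : ℕ) (h : ℝ) :
    truncTrapezoid M N h (fun x => f (-x)) = truncTrapezoid N M h f := by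
  unfold truncTrapezoid
  congr 1
  refine Finset.sum_nbij' (fun l => -l) (fun l => -l) ?_ ?_ ?_ ?_ ?_
  · intro l hl; rw [Finset.mem_Icc] at *; omega
  · intro l hl; rw [Finset.mem_Icc] at *; omega
  · intro l _; simp
  · intro l _; simp
  · intro l _; push_cast; rw [neg_mul]

/-- The error bound for the normalized integrand. -/
theorem abs_sub_truncTrapezoid_nInt_le (h0 : 0 < α) (h1 : α < 1) (hh : 0 < h) (ht : 0 < t)
    (hT : c = 0 ∨ ∃ T, t ≤ T ∧ c ^ 2 * (T ^ 2 * (1 + T ^ 2)) = 1) (M N : ℕ) :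
    |(∫ x, nInt α c x) - truncTrapezoid M N h (nInt α c)| ≤
      (∫ x in Ioi (M * h), nInt α c (-x)) + (∫ x in Ioi (N * h), nInt α c x) +
      2 * (1 / (α * (1 - α)) * (√(1 + t ^ 2) ^ 3 / (exp (2 * (π * arctan t / h)) - 1))) := by
  rcases le_total 0 c with hc | hc
  · exact abs_sub_truncTrapezoid_nInt_le_of_nonneg h0 h1 hc hh ht hT M N
  -- Reflection also exchanges M and N.
  · have key := abs_sub_truncTrapezoid_nInt_le_of_nonneg (α := 1 - α) (c := -c) (by linarith)
      (by linarith) (by linarith) hh ht (by rwa [neg_eq_zero, neg_sq]) N M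
    have e : nInt (1 - α) (-c) = fun x => nInt α c (-x) := by ext x; rw [nInt_neg]
    have e2 := integral_neg_eq_self (nInt α c) volume
    simp only [e, neg_neg, truncTrapezoid_comp_neg] at key
    rw [e2, sub_sub_cancel, mul_comm (1 - α) α] at key
    linarith

end Error

/-! ### Return to the original parameters -/

theorem two_mul_sqrt_cube_le_xi {d : ℝ} (hd : 0 < d) (hd2 : d < π / 2) :
    2 * √(1 + tan d ^ 2) ^ 3 ≤ xi d := by
  have hc : 0 < cos d := cos_pos_of_mem_Ioo ⟨by linarith, hd2⟩
  have hs : 0 < sin d := sin_pos_of_pos_of_lt_pi hd (by linarith [pi_pos])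
  have hsq := sin_sq_add_cos_sq d
  have hs1 : sin d < 1 := by nlinarith
  have h1 : √(1 + tan d ^ 2) = 1 / cos d := by
    rw [← sqrt_sq (by positivity : 0 ≤ 1 / cos d), tan_eq_sin_div_cos]
    congr 1
    field_simp
    linarith
  have h2 := cos_pi_mul_le hs.le hs1.le
  have h3 : 0 < cos (π / 2 * sin d) := cos_pos_of_mem_Ioo
    ⟨by have := pi_pos; nlinarith, by have := pi_pos; nlinarith⟩
  have h4 : cos (π / 2 * sin d) ≤ cos d ^ 2 := by linarith
  unfold xi
  rw [h1, div_pow, one_pow, mul_one_div]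
  apply div_le_div_of_nonneg_left zero_le_two (by positivity)
  calc _ ≤ cos d * cos d ^ 2 := by gcongr
    _ = _ := by ring

theorem exists_pole_param {c : ℝ} (hc : c ≠ 0) :
    ∃ T : ℝ, 0 < T ∧ c ^ 2 * (T ^ 2 * (1 + T ^ 2)) = 1 := by
  have hc2 : 0 < c ^ 2 := by positivity
  have hr := sq_sqrt (by positivity : 0 ≤ 1 + 4 / c ^ 2)
  have hr1 : 1 < √(1 + 4 / c ^ 2) := by
    rw [lt_sqrt zero_le_one]
    have : 0 < 4 / c ^ 2 := by positivity
    linarith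
  set r := √(1 + 4 / c ^ 2)
  have hS : 0 < (r - 1) / 2 := by linarith
  refine ⟨√((r - 1) / 2), sqrt_pos.2 hS, ?_⟩
  rw [sq_sqrt hS.le]
  have e : (r - 1) / 2 * (1 + (r - 1) / 2) = (r ^ 2 - 1) / 4 := by ring
  rw [e, hr]
  field_simp
  ring

theorem exp_neg_div_sinh {a : ℝ} (ha : 0 < a) :
    exp (-a) / (2 * sinh a) = 1 / (exp (2 * a) - 1) := by
  have h1 : 0 < 2 * sinh a := by have := sinh_pos_iff.2 ha; positivity
  have h2 : 0 < exp (2 * a) - 1 := sub_pos.2 (one_lt_exp_iff.2 (by linarith))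
  rw [div_eq_div_iff h1.ne' h2.ne', sinh_eq, mul_sub, ← exp_add]
  rw [show -a + 2 * a = a by ring]
  ring

theorem pole_iff {lam τ : ℝ} (hlam : 0 < lam) (hτ : 0 < τ) (z : ℂ)
    (hz : cDen (log (τ / lam) / π) z = 0) :
    (τ : ℂ) + (lam : ℂ) * Complex.exp ((π : ℂ) * Complex.sinh z) = 0 := by
  unfold cDen at hz
  have hpi : (π : ℂ) ≠ 0 := by exact_mod_cast pi_ne_zero
  have h1 : Complex.exp ((π : ℂ) * Complex.sinh z) =
      Complex.exp ((π : ℂ) * (Complex.sinh z - ((log (τ / lam) / π : ℝ) : ℂ))) *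
        ((τ / lam : ℝ) : ℂ) := by
    have h2 : ((τ / lam : ℝ) : ℂ) = Complex.exp ((log (τ / lam) : ℝ) : ℂ) := by
      rw [← Complex.ofReal_exp, exp_log (by positivity)]
    rw [h2, ← Complex.exp_add]
    congr 1
    push_cast
    field_simp
    ring
  rw [h1]
  generalize Complex.exp ((π : ℂ) * (Complex.sinh z - ((log (τ / lam) / π : ℝ) : ℂ))) = E at hz ⊢
  have hl : (lam : ℂ) ≠ 0 := by exact_mod_cast hlam.ne'
  push_cast
  field_simp
  linear_combination τ * hz

theorem deIntegrand_eq_nInt {lam τ : ℝ} (hlam : 0 < lam) (hτ : 0 < τ) (α x : ℝ) :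
    deIntegrand α lam τ x = lam ^ (-α) * nInt α (log (τ / lam) / π) x := by
  rw [deIntegrand_eq hτ]
  unfold nInt logi
  have hpi := pi_pos
  have e1 : π * (sinh x - log (τ / lam) / π) = π * sinh x - log (τ / lam) := by field_simp
  have e2 : exp (α * (π * sinh x - log (τ / lam))) =
      exp (α * π * sinh x) * (τ / lam) ^ (-α) := by
    rw [rpow_def_of_pos (by positivity), ← exp_add]; congr 1; ring
  have e3 : exp (π * sinh x - log (τ / lam)) = exp (π * sinh x) * (lam / τ) := by
    rw [exp_sub, exp_log (by positivity)]; field_simp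
  have e4 : τ ^ (1 - α) = τ * τ ^ (-α) := by
    rw [sub_eq_add_neg, rpow_add hτ, rpow_one]
  have hne : lam ^ (-α) ≠ 0 := (rpow_pos_of_pos hlam _).ne'
  rw [e1, e2, e3, e4, div_rpow hτ.le hlam.le]
  have := exp_pos (π * sinh x)
  field_simp

end

end DEQuadrature

theorem mainTheorem3 (α lam τ d h : ℝ) (M N : ℕ)
    (hα0 : 0 < α) (hα1 : α < 1) (hlam : 1 ≤ lam) (hτ : 0 < τ)
    (hM : 0 < M) (hN : 0 < N) (hh : 0 < h) (hd : 0 < d)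
    (hpoles : ∀ z : ℂ, (τ : ℂ) + (lam : ℂ) * Complex.exp ((Real.pi : ℂ) * Complex.sinh z) = 0 →
      d < |z.im|) :
    MeasureTheory.Integrable (DEQuadrature.deIntegrand α lam τ) ∧
    DEQuadrature.quadError M N h (DEQuadrature.deIntegrand α lam τ) ≤
      1 / (α * (1 - α)) * DEQuadrature.xi d * lam ^ (-α) *
          (Real.exp (-(Real.pi * d / h)) / (2 * Real.sinh (Real.pi * d / h)))
        + τ ^ (-α) / (2 * α) * Real.exp (α * Real.pi / 2) *
          Real.exp (-(α * Real.pi / 2) * Real.exp ((M : ℝ) * h))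
        + lam⁻¹ * τ ^ (1 - α) / (2 * (1 - α)) * Real.exp ((1 - α) * Real.pi / 2) *
          Real.exp (-((1 - α) * Real.pi / 2) * Real.exp ((N : ℝ) * h)) := by
  open DEQuadrature Real MeasureTheory in
  have hl : 0 < lam := by linarith
  obtain ⟨c, hcdef⟩ : ∃ c, c = log (τ / lam) / π := ⟨_, rfl⟩
  have hfun : deIntegrand α lam τ = fun x => lam ^ (-α) * nInt α c x := by
    ext x
    rw [hcdef]
    exact deIntegrand_eq_nInt hl hτ α x
  have hpole : ∀ z : ℂ, Complex.sinh z = c + Complex.I → d < |z.im| := fun z hz => by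
    refine hpoles z (pole_iff hl hτ z ?_)
    rw [cDen, ← hcdef, hz, add_sub_cancel_left, Complex.exp_pi_mul_I]
    ring
  -- The pole hypothesis is used only at the first pole: iπ/2 if c = 0, and otherwise the pole of
  -- height arctan T, which gives tan d ≤ T.
  have hd2 : d < π / 2 ∧ (c = 0 ∨ ∃ T, tan d ≤ T ∧ c ^ 2 * (T ^ 2 * (1 + T ^ 2)) = 1) := by
    rcases eq_or_ne c 0 with hc | hc
    · refine ⟨?_, Or.inl hc⟩
      have h1 := hpole ((π / 2 : ℝ) * Complex.I) (by
        rw [Complex.sinh_mul_I, ← Complex.ofReal_sin, sin_pi_div_two, hc]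
        simp)
      rwa [Complex.im_ofReal_mul, Complex.I_im, mul_one,
        abs_of_pos (by positivity)] at h1
    · obtain ⟨T, hT, h1⟩ := exists_pole_param hc
      have h2 := hpole _ (sinh_pole hT (poleFn_eq_one h1))
      rw [Complex.add_im, Complex.ofReal_im, Complex.im_ofReal_mul, Complex.I_im, mul_one, zero_add,
        abs_of_pos (arctan_pos.2 hT)] at h2
      have h3 := arctan_lt_pi_div_two T
      refine ⟨h2.trans h3, Or.inr ⟨T, ?_, h1⟩⟩
      rw [← tan_arctan T]
      exact (tan_lt_tan_of_lt_of_lt_pi_div_two (by linarith [pi_pos]) h3 h2).le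
  obtain ⟨hd2, hT⟩ := hd2
  have ht : 0 < tan d := tan_pos_of_pos_of_lt_pi_div_two hd hd2
  have hint := (integrable_nInt hα0 hα1 c).1
  have hΛ : 0 < lam ^ (-α) := rpow_pos_of_pos hl _
  rw [hfun]
  refine ⟨hint.const_mul _, ?_⟩
  have key := abs_sub_truncTrapezoid_nInt_le hα0 hα1 hh ht hT M N
  rw [arctan_tan (by linarith [pi_pos]) hd2] at key
  have e1 : quadError M N h (fun x => lam ^ (-α) * nInt α c x) =
      lam ^ (-α) * |(∫ x, nInt α c x) - truncTrapezoid M N h (nInt α c)| := by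
    unfold quadError truncTrapezoid
    rw [integral_const_mul, ← Finset.mul_sum, mul_left_comm, ← mul_sub, abs_mul, abs_of_pos hΛ]
  have hec : ∀ β : ℝ, exp (β * (π * c)) = (τ / lam) ^ β := by
    intro β
    rw [rpow_def_of_pos (by positivity), hcdef]
    congr 1
    field_simp
  have t1 : lam ^ (-α) * ∫ x in Set.Ioi (M * h), nInt α c (-x) ≤
      τ ^ (-α) / (2 * α) * exp (α * π / 2) * exp (-(α * π / 2) * exp ((M : ℝ) * h)) := by
    have h1 := integral_Ioi_nInt_le_exp (α := 1 - α) (by linarith) (by linarith) (-c)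
      (by positivity : 0 ≤ (M : ℝ) * h)
    simp only [← nInt_neg, sub_sub_cancel] at h1
    have h2 : lam ^ (-α) * exp (α * (π * -c)) = τ ^ (-α) := by
      rw [show α * (π * -c) = -α * (π * c) by ring, hec, ← mul_rpow hl.le (by positivity),
        mul_div_cancel₀ _ hl.ne']
    calc _ ≤ _ := mul_le_mul_of_nonneg_left h1 hΛ.le
      _ = lam ^ (-α) * exp (α * (π * -c)) / (2 * α) * exp (α * π / 2) *
          exp (-(α * π / 2) * exp ((M : ℝ) * h)) := by ring
      _ = _ := by rw [h2]
  have t2 : lam ^ (-α) * ∫ x in Set.Ioi (N * h), nInt α c x ≤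
      lam⁻¹ * τ ^ (1 - α) / (2 * (1 - α)) * exp ((1 - α) * π / 2) *
          exp (-((1 - α) * π / 2) * exp ((N : ℝ) * h)) := by
    have h1 := integral_Ioi_nInt_le_exp hα0 hα1 c (by positivity : 0 ≤ (N : ℝ) * h)
    have h2 : lam ^ (-α) * exp ((1 - α) * (π * c)) = lam⁻¹ * τ ^ (1 - α) := by
      rw [hec, div_rpow hτ.le hl.le, show -α = (1 - α) - 1 by ring, rpow_sub_one hl.ne']
      have := (rpow_pos_of_pos hl (1 - α)).ne'
      field_simp
    calc _ ≤ _ := mul_le_mul_of_nonneg_left h1 hΛ.le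
      _ = lam ^ (-α) * exp ((1 - α) * (π * c)) / (2 * (1 - α)) * exp ((1 - α) * π / 2) *
          exp (-((1 - α) * π / 2) * exp ((N : ℝ) * h)) := by ring
      _ = _ := by rw [h2]
  have hxi := two_mul_sqrt_cube_le_xi hd hd2
  have ha : 0 < π * d / h := by have := pi_pos; positivity
  have hE : 0 < exp (2 * (π * d / h)) - 1 := sub_pos.2 (one_lt_exp_iff.2 (by linarith))
  have hB := four_le_inv_mul hα0 hα1
  have t0 : lam ^ (-α) * (2 * (1 / (α * (1 - α)) *
      (√(1 + tan d ^ 2) ^ 3 / (exp (2 * (π * d / h)) - 1)))) ≤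
      1 / (α * (1 - α)) * xi d * lam ^ (-α) *
          (exp (-(π * d / h)) / (2 * sinh (π * d / h))) := by
    rw [exp_neg_div_sinh ha]
    calc _ = 1 / (α * (1 - α)) * (2 * √(1 + tan d ^ 2) ^ 3) * lam ^ (-α) *
          (1 / (exp (2 * (π * d / h)) - 1)) := by ring
      _ ≤ _ := by gcongr
  rw [e1]
  have := mul_le_mul_of_nonneg_left key hΛ.le
  rw [mul_add, mul_add] at this
  linarith
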